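/- **Theorem.** Let $k,d\ge 1$ be integers, $T>0$, and let $X(t)=(X_1(t),\dots,X_d(t))^\top$, $t\in\mathbb R^k$, be a centered stationary $\mathbb R^d$-valued Gaussian random field, jointly measurable in $(\omega,t)$ (up to a null set of the product of the probability measure and Lebesgue measure). Put $R(t)=\mathbb E[X(t)X(0)^\top]$ and $\Sigma=R(0)$. Assume that $\Sigma$ is non-singular and that $b\in\mathbb R^d\setminus(-\infty,0]^d$ satisfies $w:=\Sigma^{-1}b>0$ (inequalities, quotients and products of vectors are componentwise). Assume further: (B0) $R$ is continuous on $\mathbb R^k$. (B1) For every $t\ne 0$ the (not necessarily symmetric) matrix $\Sigma-R(t)$ is positive definite, i.e. $x^\top(\Sigma-R(t))x>0$ for all $x\in\mathbb R^d\setminus\{0\}$. (B2) There are numbers $\alpha_1,\dots,\alpha_k>0$, strictly positive monotone functions $l_1,\dots,l_k$ on $(0,\infty)$ that are slowly varying at infinity, and a continuous $V:\mathbb R^k\to\mathbb R^{d\times d}$ with $w^\top V(t)w>0$ for all $t\neq0$, such that, with $v(u)=(l_1(u)u^{2/\alpha_1},\dots,l_k(u)u^{2/\alpha_k})$ and $\|\cdot\|_F$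 the Frobenius norm, $$\big\|u^2[\Sigma-R(t/v(u))]-V(t)\big\|_F\to 0\qquad (u\to\infty)$$ for every $t\in\mathbb R^k$, and uniformly on the Euclidean ball $\{|t|<r\}$ for some $r>0$. Let $\theta(u)=\prod_{i=1}^k v_i(u)$, $L_u(T)=\int_{[0,T]^k}\mathbf 1\{X(t)>ub\}\,dt$, and let $F_u$ be the distribution function of $\theta(u)L_u(T)$. Then: 1. On some probability space there exist a centered $\mathbb R^d$-valued Gaussian field $Y(t)$, $t\in\mathbb R^k$, with almost surely continuous sample paths and $\mathbb E[Y(t)Y(s)^\top]=V(t)+V(-s)-V(t-s)$, and, independent of $Y$, a vector $E$ of $d$ independent unit exponential random variables. 2. For every such pair $(Y,E)$, let $\mathfrak F_w$ be the (possibly defective) distribution function of $$J(Y,w)=\int_{\mathbb R^k}\mathbf 1\{Y(t)-V(t)w+E/w>0\}\,dt\in[0,\infty].$$ Then for all $x>0$ $$\lim_{u\to\infty}\frac{\int_0^x y\,dF_u(y)}{\theta(u)\,\mathbb E L_u(T)}=\mathfrak F_w(x).$$ 3. For all $u>0$, $\mathbb E L_u(T)=T^k\,\mathbb P(X(0)>ub)$,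 and for all $x>0$ $$\lim_{u\to\infty}\frac{\mathbb P(\theta(u)L_u(T)>x)}{T^k\theta(u)\,\mathbb P(X(0)>ub)}=\int_x^\infty\frac1y\,d\mathfrak F_w(y)=:\mathcal B_{Y,w}(x).$$ -/

import Mathlib

open MeasureTheory ProbabilityTheory Filter Topology
open scoped Matrix ENNReal

noncomputable section

namespace Sojourn

/-- The Euclidean norm of a vector of `ℝᵏ`, realized as `Fin k → ℝ`. -/
def euclNorm {k : ℕ} (t : Fin k → ℝ) : ℝ := Real.sqrt (∑ i, t i ^ 2)

/-- The Frobenius norm of a `d × d` matrix. -/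
def frobNorm {d : ℕ} (A : Matrix (Fin d) (Fin d) ℝ) : ℝ := Real.sqrt (∑ i, ∑ j, A i j ^ 2)

/-- Positive definiteness of a real square matrix that need not be symmetric: `xᵀ A x > 0` for
every `x ≠ 0`. (`Matrix.PosDef` would in addition require symmetry.) -/
def IsPosDef {d : ℕ} (A : Matrix (Fin d) (Fin d) ℝ) : Prop :=
  ∀ x : Fin d → ℝ, x ≠ 0 → 0 < x ⬝ᵥ (A *ᵥ x)

/-- A centered `ℝᵈ`-valued Gaussian random field indexed by `ℝᵏ`. -/
structure IsCenteredGRF {Ω : Type*} [MeasurableSpace Ω] {k d : ℕ}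
    (Z : (Fin k → ℝ) → Ω → (Fin d → ℝ)) (P : Measure Ω) : Prop where
  gaussian : IsGaussianProcess Z P
  centered : ∀ t i, ∫ ω, Z t ω i ∂P = 0

/-- Stationarity (homogeneity): the finite dimensional distributions are shift invariant. -/
def IsStationary {Ω : Type*} [MeasurableSpace Ω] {k d : ℕ}
    (Z : (Fin k → ℝ) → Ω → (Fin d → ℝ)) (P : Measure Ω) : Prop :=
  ∀ (h : Fin k → ℝ) (I : Finset (Fin k → ℝ)),
    IdentDistrib (fun ω => I.restrict (fun t => Z (t + h) ω))
      (fun ω => I.restrict (fun t => Z t ω)) P P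

/-- The matrix `E[Z(s) Z(t)ᵀ]`; for a centered field it is the covariance matrix function. -/
def covMatrix {Ω : Type*} [MeasurableSpace Ω] {k d : ℕ}
    (Z : (Fin k → ℝ) → Ω → (Fin d → ℝ)) (P : Measure Ω) (s t : Fin k → ℝ) :
    Matrix (Fin d) (Fin d) ℝ :=
  Matrix.of fun i j => ∫ ω, Z s ω i * Z t ω j ∂P

/-- The covariance matrix function `h ↦ E[Z(h) Z(0)ᵀ]` of a stationary centered field. -/
def stationaryCov {Ω : Type*} [MeasurableSpace Ω] {k d : ℕ}
    (Z : (Fin k → ℝ) → Ω → (Fin d → ℝ)) (P : Measure Ω) (h : Fin k → ℝ) :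
    Matrix (Fin d) (Fin d) ℝ :=
  covMatrix Z P h 0

/-- Slow variation at infinity. -/
def IsSlowlyVarying (l : ℝ → ℝ) : Prop :=
  ∀ c : ℝ, 0 < c → Tendsto (fun u => l (c * u) / l u) atTop (𝓝 1)

/-- The scaling vector `v(u) = (l₁(u) u^(2/α₁), …, l_k(u) u^(2/α_k))`. -/
def scaling {k : ℕ} (α : Fin k → ℝ) (l : Fin k → ℝ → ℝ) (u : ℝ) : Fin k → ℝ :=
  fun i => l i u * u ^ (2 / α i)

/-- `θ(u) = ∏ᵢ vᵢ(u)`. -/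
def theta {k : ℕ} (α : Fin k → ℝ) (l : Fin k → ℝ → ℝ) (u : ℝ) : ℝ :=
  ∏ i, scaling α l u i

/-- The local expansion of a covariance matrix function `R` at the origin, with indices `α`,
slowly varying functions `l` and limit `V`. The quotient `t / scaling α l u` is componentwise. -/
structure LocalExpansion {k d : ℕ} (R : (Fin k → ℝ) → Matrix (Fin d) (Fin d) ℝ)
    (w : Fin d → ℝ) (α : Fin k → ℝ) (l : Fin k → ℝ → ℝ)
    (V : (Fin k → ℝ) → Matrix (Fin d) (Fin d) ℝ) : Prop where
  index_pos : ∀ i, 0 < α i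
  slow_pos : ∀ i, ∀ u : ℝ, 0 < u → 0 < l i u
  slow_monotone : ∀ i, MonotoneOn (l i) (Set.Ioi 0) ∨ AntitoneOn (l i) (Set.Ioi 0)
  slow_varying : ∀ i, IsSlowlyVarying (l i)
  continuous : Continuous V
  pos : ∀ t, t ≠ 0 → 0 < w ⬝ᵥ (V t *ᵥ w)
  /-- uniform convergence on some ball around the origin -/
  uniform_limit : ∃ r : ℝ, 0 < r ∧
    TendstoUniformlyOn
      (fun (u : ℝ) (t : Fin k → ℝ) =>
        frobNorm (u ^ 2 • (R 0 - R (t / scaling α l u)) - V t))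
      (fun _ => 0) atTop {t | euclNorm t < r}
  /-- `V` is the limit at every point, also outside that ball -/
  pointwise_limit : ∀ t : Fin k → ℝ,
    Tendsto (fun u : ℝ => frobNorm (u ^ 2 • (R 0 - R (t / scaling α l u)) - V t)) atTop (𝓝 0)

/-- The sojourn time `∫_{[0,T]ᵏ} 1{X(t) > u b} dt`; the inequality is componentwise. -/
def sojournTime {Ω : Type*} {k d : ℕ} (X : (Fin k → ℝ) → Ω → (Fin d → ℝ)) (b : Fin d → ℝ)
    (T u : ℝ) (ω : Ω) : ℝ :=
  ∫ t in Set.Icc (0 : Fin k → ℝ) (fun _ => T),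
    {t : Fin k → ℝ | ∀ i, u * b i < X t ω i}.indicator (fun _ => (1 : ℝ)) t

/-- `Y` is a centered Gaussian field with continuous sample paths and covariance matrix function
`V(t) + V(-s) - V(t - s)`, and `E` is a vector of independent unit exponential variables that is
independent of `Y`. -/
structure IsLimitPair {Ω : Type*} [MeasurableSpace Ω] {k d : ℕ}
    (V : (Fin k → ℝ) → Matrix (Fin d) (Fin d) ℝ)
    (Y : (Fin k → ℝ) → Ω → (Fin d → ℝ)) (E : Ω → (Fin d → ℝ)) (P : Measure Ω) : Prop where
  grf : IsCenteredGRF Y P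
  continuous_paths : ∀ᵐ ω ∂P, Continuous (fun t => Y t ω)
  cov : ∀ t s, covMatrix Y P t s = V t + V (-s) - V (t - s)
  exp_law : ∀ i, HasLaw (fun ω => E ω i) (expMeasure 1) P
  exp_indep : iIndepFun (fun i ω => E ω i) P
  indep : IndepFun (fun ω t => Y t ω) E P

/-- `J(Y, w) = ∫_{ℝᵏ} 1{Y(t) - V(t) w + E / w > 0} dt`, a random variable in `[0, ∞]`. -/
def limitSojourn {Ω : Type*} {k d : ℕ} (V : (Fin k → ℝ) → Matrix (Fin d) (Fin d) ℝ)
    (w : Fin d → ℝ) (Y : (Fin k → ℝ) → Ω → (Fin d → ℝ)) (E : Ω → (Fin d → ℝ)) (ω : Ω) : ℝ≥0∞ :=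
  ∫⁻ t : Fin k → ℝ,
    {t : Fin k → ℝ | ∀ i, 0 < Y t ω i - (V t *ᵥ w) i + E ω i / w i}.indicator
      (fun _ => (1 : ℝ≥0∞)) t

/-- The (possibly defective) distribution function `x ↦ P(J ≤ x)`, for `x ≥ 0`, of a `[0, ∞]`-valued
random variable `J`. -/
def distFun {Ω : Type*} [MeasurableSpace Ω] (J : Ω → ℝ≥0∞) (P : Measure Ω) (x : ℝ) : ℝ :=
  P.real {ω | J ω ≤ ENNReal.ofReal x}

/-- The constant `∫_{(x,∞)} (1/y) dF(y)`, `x > 0`, where `F` is the distribution function of `J`;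
mass of `J` at `∞` does not contribute. -/
def bermanConst {Ω : Type*} [MeasurableSpace Ω] (J : Ω → ℝ≥0∞) (P : Measure Ω) (x : ℝ) : ℝ :=
  (∫⁻ y in Set.Ioi (ENNReal.ofReal x), y⁻¹ ∂(P.map J)).toReal

end Sojourn

end

/-! The argument is Berman's: a truncated first moment of the sojourn time `L` is an average of
conditional laws of `L` given an exceedance at a point. Writing one factor `L` as an integral of
indicators, Fubini gives `θ E[L; θL ≤ x] = θ ∫ P(θL ≤ x, X(s) > ub) ds` over the cube
(`integral_truncated`). Division by `θ E L = T^k θ P(X(0) > ub)` turns this into the average over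
`s` of `P(θL ≤ x | X(s) > ub)`. Stationarity moves `s` to the origin, and for each interior `s` the
conditional probability has the same limit `P(J ≤ x)` (`tendsto_cond_sojourn`). The faces of the
cube are null, so dominated convergence gives the limit of the truncated moments. The tail follows
from `1 / y = ∫_y^∞ z⁻² dz`: it is the `z⁻²`-weighted integral of the truncated moments over `(x,
z]`, which are at most 1 after normalization (`tendsto_tail_sojournTime`).

For the conditional limit, given `X(0) > ub` the vector `X(0)` is `ub + E / (u w)` up to a weight
tending to 1 (`exists_restrict_tail_eq`), and a linear combination of values of `X` splits into its
regression on `X(0)` and an independent Gaussian residual. By the local expansion the characteristic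
functions of `u (X(t / v(u)) - ub)` converge to those of `Y(t) - V(t) w + E / w`, so the
probabilities of simultaneous exceedances converge (`tendsto_cond_exceedance`). These are the mixed
moments of the exceedance indicators; hence all moments of the time spent above the level in a
bounded window converge, and since that time is bounded, Weierstrass approximation gives convergence
in law. No weak convergence in a path space is involved.

The time outside a large window is negligible in mean. With `q(τ) = wᵀ(R(0) - R(τ))w`, a Chernoff
bound gives `P(X(τ) > ub | X(0) > ub) ≤ C exp(-r u² q(τ))` (`exists_cond_exceedance_le`), and `u²
q(τ)` is at least a positive power of `‖v(u) τ‖` (`quadDefect_lower_bound`), which makes the bound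
integrable in rescaled time. Convergence holds at every `x > 0` because `J` has no atom in `(0, ∞)`:
moving `E` along `w` moves the level of a continuous function, and the volume of its superlevel set
changes strictly as long as it is finite and nonzero.

For the existence of `Y`, the kernel `V(t) + V(-s) - V(t - s)` is a limit of covariances of rescaled
increments, hence a Gram kernel. Self-similarity of `V` near 0 makes it Hölder at 0, so a Gaussian
family on the dyadic points has geometrically small increments by Borel–Cantelli and extends to a
continuous field. -/

namespace Sojourn

/-! ### Growth of the scaling vector -/

section Scaling

variable {k d : ℕ} {R V : (Fin k → ℝ) → Matrix (Fin d) (Fin d) ℝ} {w : Fin d → ℝ}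
  {α : Fin k → ℝ} {l : Fin k → ℝ → ℝ}

lemma LocalExpansion.scaling_pos (h : LocalExpansion R w α l V) (i : Fin k) {u : ℝ} (hu : 0 < u) :
    0 < scaling α l u i :=
  mul_pos (h.slow_pos i u hu) (Real.rpow_pos_of_pos hu _)

lemma LocalExpansion.theta_pos (h : LocalExpansion R w α l V) {u : ℝ} (hu : 0 < u) :
    0 < theta α l u :=
  Finset.prod_pos fun i _ => h.scaling_pos i hu

lemma LocalExpansion.tendsto_scaling_ratio (h : LocalExpansion R w α l V) (i : Fin k) {c : ℝ}
    (hc : 0 < c) :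
    Tendsto (fun u => scaling α l (c * u) i / scaling α l u i) atTop (𝓝 (c ^ (2 / α i))) := by
  have h1 := (h.slow_varying i c hc).mul_const (c ^ (2 / α i))
  rw [one_mul] at h1
  refine h1.congr' ?_
  filter_upwards [eventually_gt_atTop 0] with u hu
  have h2 := (h.slow_pos i u hu).ne'
  have h3 := (Real.rpow_pos_of_pos hu (2 / α i)).ne'
  simp only [scaling]
  rw [Real.mul_rpow hc.le hu.le]
  field_simp

/-- The ratio `v(2z) / v(z)` tends to `2 ^ (2 / α i) > 1` in each coordinate, so any `a` below and
any `M` above all these limits work from some point on. The two constants replace regular variation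
by bounds along dyadic scales. -/
lemma LocalExpansion.exists_doubling (h : LocalExpansion R w α l V) :
    ∃ z₀ a M : ℝ, 1 ≤ z₀ ∧ 1 < a ∧ 1 < M ∧ ∀ z, z₀ ≤ z → ∀ i,
      a * scaling α l z i ≤ scaling α l (2 * z) i ∧
      scaling α l (2 * z) i ≤ M * scaling α l z i := by
  obtain ⟨a, ha1, ha⟩ : ∃ a : ℝ, 1 < a ∧ ∀ i, a < 2 ^ (2 / α i) := by
    have : ∀ᶠ a in 𝓝[>] (1 : ℝ), 1 < a ∧ ∀ i, a < 2 ^ (2 / α i) := by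
      refine (eventually_mem_nhdsWithin).and (eventually_all.2 fun i => ?_)
      refine mem_nhdsWithin_of_mem_nhds (Iio_mem_nhds ?_)
      exact Real.one_lt_rpow (by norm_num) (div_pos two_pos (h.index_pos i))
    exact this.exists
  obtain ⟨M, hM1, hM⟩ : ∃ M : ℝ, 1 < M ∧ ∀ i, 2 ^ (2 / α i) < M := by
    have : ∀ᶠ M in (atTop : Filter ℝ), 1 < M ∧ ∀ i, 2 ^ (2 / α i) < M :=
      (eventually_gt_atTop 1).and (eventually_all.2 fun i => eventually_gt_atTop _)
    exact this.exists
  have key : ∀ᶠ z in (atTop : Filter ℝ), 0 < z ∧ ∀ i,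
      a < scaling α l (2 * z) i / scaling α l z i ∧
      scaling α l (2 * z) i / scaling α l z i < M := by
    refine (eventually_gt_atTop 0).and (eventually_all.2 fun i => ?_)
    have h1 := h.tendsto_scaling_ratio i (c := 2) two_pos
    exact (h1.eventually (lt_mem_nhds (ha i))).and (h1.eventually (gt_mem_nhds (hM i)))
  obtain ⟨z₀, hz₀⟩ := (key.and (eventually_ge_atTop 1)).exists_forall_of_atTop
  refine ⟨z₀, a, M, (hz₀ z₀ le_rfl).2, ha1, hM1, fun z hz i => ?_⟩
  obtain ⟨⟨hz1, hz2⟩, -⟩ := hz₀ z hz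
  have hv := h.scaling_pos i hz1
  exact ⟨((lt_div_iff₀ hv).1 (hz2 i).1).le, ((div_lt_iff₀ hv).1 (hz2 i).2).le⟩

/-- Monotonicity bounds `l i` on `[z₀, 2 z₀]` by its end values; slow variation alone gives no
control on a bounded interval. -/
lemma LocalExpansion.scaling_mem_Icc (h : LocalExpansion R w α l V) {z₀ : ℝ} (hz₀ : 0 < z₀) :
    ∃ m C : ℝ, 0 < m ∧ m ≤ C ∧ ∀ z, z₀ ≤ z → z ≤ 2 * z₀ → ∀ i,
      m ≤ scaling α l z i ∧ scaling α l z i ≤ C := by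
  have h1 : ∀ i : Fin k, ∀ z, z₀ ≤ z → z ≤ 2 * z₀ →
      min (l i z₀) (l i (2 * z₀)) * z₀ ^ (2 / α i) ≤ scaling α l z i ∧
      scaling α l z i ≤ max (l i z₀) (l i (2 * z₀)) * (2 * z₀) ^ (2 / α i) := by
    intro i z hz1 hz2
    have hz : 0 < z := hz₀.trans_le hz1
    have he : 0 ≤ 2 / α i := (div_pos two_pos (h.index_pos i)).le
    have hl : min (l i z₀) (l i (2 * z₀)) ≤ l i z ∧ l i z ≤ max (l i z₀) (l i (2 * z₀)) := by
      have m1 : z₀ ∈ Set.Ioi (0 : ℝ) := hz₀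
      have m2 : z ∈ Set.Ioi (0 : ℝ) := hz
      have m3 : 2 * z₀ ∈ Set.Ioi (0 : ℝ) := by simpa using hz₀
      rcases h.slow_monotone i with hm | hm
      · exact ⟨(min_le_left _ _).trans (hm m1 m2 hz1), (hm m2 m3 hz2).trans (le_max_right _ _)⟩
      · exact ⟨(min_le_right _ _).trans (hm m2 m3 hz2), (hm m1 m2 hz1).trans (le_max_left _ _)⟩
    have hlz := (h.slow_pos i z hz).le
    constructor
    · exact mul_le_mul hl.1 (Real.rpow_le_rpow hz₀.le hz1 he) (by positivity) hlz
    · exact mul_le_mul hl.2 (Real.rpow_le_rpow hz.le hz2 he) (by positivity) (hlz.trans hl.2)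
  have hm : ∀ i : Fin k, 0 < min (l i z₀) (l i (2 * z₀)) * z₀ ^ (2 / α i) := fun i =>
    mul_pos (lt_min (h.slow_pos i _ hz₀) (h.slow_pos i _ (by positivity))) (by positivity)
  obtain ⟨m, hm0, hm1⟩ : ∃ m : ℝ, 0 < m ∧
      ∀ i : Fin k, m < min (l i z₀) (l i (2 * z₀)) * z₀ ^ (2 / α i) := by
    have : ∀ᶠ m in 𝓝[>] (0 : ℝ), 0 < m ∧
        ∀ i : Fin k, m < min (l i z₀) (l i (2 * z₀)) * z₀ ^ (2 / α i) :=
      eventually_mem_nhdsWithin.and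
        (eventually_all.2 fun i => mem_nhdsWithin_of_mem_nhds (Iio_mem_nhds (hm i)))
    exact this.exists
  obtain ⟨C, hC0, hC⟩ : ∃ C : ℝ, m < C ∧
      ∀ i : Fin k, max (l i z₀) (l i (2 * z₀)) * (2 * z₀) ^ (2 / α i) < C := by
    have : ∀ᶠ C in (atTop : Filter ℝ), m < C ∧
        ∀ i : Fin k, max (l i z₀) (l i (2 * z₀)) * (2 * z₀) ^ (2 / α i) < C :=
      (eventually_gt_atTop m).and (eventually_all.2 fun i => eventually_gt_atTop _)
    exact this.exists
  exact ⟨m, C, hm0, hC0.le, fun z h1' h2' i =>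
    ⟨(hm1 i).le.trans (h1 i z h1' h2').1, (h1 i z h1' h2').2.trans (hC i).le⟩⟩

/-- Reduces statements about all large `u` to a compact range of `z` and a number of doublings. -/
lemma exists_dyadic_decomposition {z₀ u : ℝ} (hz₀ : 0 < z₀) (hu : z₀ ≤ u) :
    ∃ (n : ℕ) (z : ℝ), z₀ ≤ z ∧ z ≤ 2 * z₀ ∧ u = 2 ^ n * z := by
  obtain ⟨n, hn1, hn2⟩ := exists_nat_pow_near ((one_le_div hz₀).2 hu) (one_lt_two : (1 : ℝ) < 2)
  refine ⟨n, u / 2 ^ n, ?_, ?_, by field_simp⟩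
  · rw [le_div_iff₀ (by positivity), mul_comm]
    exact (le_div_iff₀ hz₀).1 hn1
  · rw [div_le_iff₀ (by positivity)]
    have := (div_lt_iff₀ hz₀).1 hn2
    rw [pow_succ] at this
    linarith

lemma geometric_bounds {f : ℝ → ℝ} {z₀ a M z : ℝ} (hz₀ : 0 < z₀) (ha : 0 ≤ a) (hM : 0 ≤ M)
    (hf : ∀ z, z₀ ≤ z → a * f z ≤ f (2 * z) ∧ f (2 * z) ≤ M * f z) (hz : z₀ ≤ z) (n : ℕ) :
    a ^ n * f z ≤ f (2 ^ n * z) ∧ f (2 ^ n * z) ≤ M ^ n * f z := by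
  induction n with
  | zero => simp
  | succ n ih =>
    have h1 : z₀ ≤ 2 ^ n * z :=
      hz.trans (le_mul_of_one_le_left (hz₀.le.trans hz) (one_le_pow₀ one_le_two))
    have h2 := hf _ h1
    rw [show (2 : ℝ) ^ (n + 1) * z = 2 * (2 ^ n * z) by ring]
    constructor
    · calc a ^ (n + 1) * f z = a * (a ^ n * f z) := by ring
        _ ≤ a * f (2 ^ n * z) := mul_le_mul_of_nonneg_left ih.1 ha
        _ ≤ _ := h2.1
    · calc f (2 * (2 ^ n * z)) ≤ M * f (2 ^ n * z) := h2.2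
        _ ≤ M * (M ^ n * f z) := mul_le_mul_of_nonneg_left ih.2 hM
        _ = _ := by ring

lemma LocalExpansion.tendsto_scaling_atTop (h : LocalExpansion R w α l V) (i : Fin k) :
    Tendsto (fun u => scaling α l u i) atTop atTop := by
  obtain ⟨z₀, a, M, hz₀, ha, hM, hv⟩ := h.exists_doubling
  have hz₀' : 0 < z₀ := one_pos.trans_le hz₀
  obtain ⟨m, C, hm, -, hmC⟩ := h.scaling_mem_Icc hz₀'
  refine tendsto_atTop.2 fun K => ?_
  obtain ⟨N, hN⟩ := pow_unbounded_of_one_lt (K / m) ha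
  -- The exponent `N + 1` rather than `N` absorbs `z ≤ 2 z₀` and forces at least `N` doublings.
  filter_upwards [eventually_ge_atTop (2 ^ (N + 1) * z₀)] with u hu
  have hu0 : z₀ ≤ u := (le_mul_of_one_le_left hz₀'.le (one_le_pow₀ one_le_two)).trans hu
  obtain ⟨n, z, hz1, hz2, rfl⟩ := exists_dyadic_decomposition hz₀' hu0
  have hnN : N ≤ n := by
    by_contra hlt
    push Not at hlt
    have h1 : (2 : ℝ) ^ n * z < 2 ^ (N + 1) * z₀ := by
      calc (2 : ℝ) ^ n * z ≤ 2 ^ n * (2 * z₀) := by gcongr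
        _ = 2 ^ (n + 1) * z₀ := by ring
        _ < 2 ^ (N + 1) * z₀ := by gcongr; norm_num
    linarith
  have h1 := (geometric_bounds (f := fun u => scaling α l u i) hz₀' (by linarith) (by linarith)
    (fun z hz => hv z hz i) hz1 n).1
  refine le_trans ?_ h1
  have h2 : K / m < a ^ n := hN.trans_le (pow_le_pow_right₀ ha.le hnN)
  have h3 : K ≤ a ^ n * m := ((div_lt_iff₀ hm).1 h2).le
  exact h3.trans (mul_le_mul_of_nonneg_left (hmC z hz1 hz2 i).1 (by positivity))

end Scaling

/-! ### Entrywise form of the local expansion -/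

section LocalLimit

variable {k d : ℕ} {R V : (Fin k → ℝ) → Matrix (Fin d) (Fin d) ℝ} {w : Fin d → ℝ}
  {α : Fin k → ℝ} {l : Fin k → ℝ → ℝ}

lemma abs_entry_le_frobNorm (A : Matrix (Fin d) (Fin d) ℝ) (i j : Fin d) :
    |A i j| ≤ frobNorm A := by
  refine Real.abs_le_sqrt ?_
  refine le_trans ?_ (Finset.single_le_sum (f := fun i => ∑ j, A i j ^ 2)
    (fun i _ => Finset.sum_nonneg fun j _ => sq_nonneg _) (Finset.mem_univ i))
  exact Finset.single_le_sum (f := fun j => A i j ^ 2) (fun j _ => sq_nonneg _) (Finset.mem_univ j)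

lemma LocalExpansion.tendsto_entry (h : LocalExpansion R w α l V) (t : Fin k → ℝ) (i j : Fin d) :
    Tendsto (fun u : ℝ => u ^ 2 * (R 0 i j - R (t / scaling α l u) i j)) atTop (𝓝 (V t i j)) := by
  rw [tendsto_iff_norm_sub_tendsto_zero]
  refine squeeze_zero (fun _ => norm_nonneg _) (fun u => ?_) (h.pointwise_limit t)
  exact abs_entry_le_frobNorm (u ^ 2 • (R 0 - R (t / scaling α l u)) - V t) i j

lemma LocalExpansion.exists_uniform_entry (h : LocalExpansion R w α l V) :
    ∃ r : ℝ, 0 < r ∧ r ≤ 1 ∧ ∀ i j, TendstoUniformlyOn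
      (fun (u : ℝ) (t : Fin k → ℝ) => u ^ 2 * (R 0 i j - R (t / scaling α l u) i j))
      (fun t => V t i j) atTop {t | ∀ m, |t m| ≤ r} := by
  obtain ⟨r, hr, hu⟩ := h.uniform_limit
  -- A sup-norm box of half-width `r / (k + 1)` lies in the open Euclidean ball of radius `r`. The
  -- cap at 1 is for later, where a point of the box must have norm at most 1.
  have hr' : 0 < min 1 (r / (k + 1)) := by positivity
  refine ⟨min 1 (r / (k + 1)), hr', min_le_left _ _, fun i j => ?_⟩
  rw [Metric.tendstoUniformlyOn_iff] at hu ⊢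
  intro ε hε
  filter_upwards [hu ε hε] with u hu' t ht
  have ht' : euclNorm t < r := by
    have h1 : ∀ m, t m ^ 2 ≤ (r / (k + 1)) ^ 2 := fun m => by
      rw [← sq_abs]
      exact pow_le_pow_left₀ (abs_nonneg _) ((ht m).trans (min_le_right _ _)) 2
    rw [euclNorm, Real.sqrt_lt' hr]
    calc ∑ m, t m ^ 2 ≤ ∑ _m : Fin k, (r / (k + 1)) ^ 2 := Finset.sum_le_sum fun m _ => h1 m
      _ = k * (r / (k + 1)) ^ 2 := by simp
      _ < (k + 1) * (r / (k + 1)) ^ 2 := by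
          have : 0 < (r / ((k : ℝ) + 1)) ^ 2 := by positivity
          nlinarith
      _ = r ^ 2 / (k + 1) := by field_simp
      _ ≤ r ^ 2 := div_le_self (by positivity) (by linarith [(Nat.cast_nonneg k : (0 : ℝ) ≤ k)])
  have h2 := hu' t ht'
  rw [dist_eq_norm, zero_sub, norm_neg] at h2
  rw [dist_comm, Real.dist_eq]
  exact ((abs_entry_le_frobNorm (u ^ 2 • (R 0 - R (t / scaling α l u)) - V t) i j).trans
    (le_abs_self _)).trans_lt h2

/-- The quadratic form of `R 0 - R τ` in the direction `w`. -/
def quadDefect (R : (Fin k → ℝ) → Matrix (Fin d) (Fin d) ℝ) (w : Fin d → ℝ) (τ : Fin k → ℝ) : ℝ :=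
  w ⬝ᵥ ((R 0 - R τ) *ᵥ w)

lemma dotProduct_mulVec_eq_sum (A : Matrix (Fin d) (Fin d) ℝ) (x y : Fin d → ℝ) :
    x ⬝ᵥ (A *ᵥ y) = ∑ i, ∑ j, x i * (A i j * y j) := by
  simp [dotProduct, Matrix.mulVec, Finset.mul_sum]

lemma LocalExpansion.exists_uniform_quadDefect (h : LocalExpansion R w α l V) :
    ∃ r : ℝ, 0 < r ∧ r ≤ 1 ∧ TendstoUniformlyOn
      (fun (u : ℝ) (t : Fin k → ℝ) => u ^ 2 * quadDefect R w (t / scaling α l u))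
      (fun t => w ⬝ᵥ (V t *ᵥ w)) atTop {t | ∀ m, |t m| ≤ r} := by
  obtain ⟨r, hr, hr1, hu⟩ := h.exists_uniform_entry
  refine ⟨r, hr, hr1, ?_⟩
  rw [Metric.tendstoUniformlyOn_iff]
  intro ε hε
  have hB : 0 < (∑ i, ∑ j, |w i * w j|) + 1 := by positivity
  have : ∀ᶠ u in (atTop : Filter ℝ), ∀ i j, ∀ t ∈ {t : Fin k → ℝ | ∀ m, |t m| ≤ r},
      dist (V t i j) (u ^ 2 * (R 0 i j - R (t / scaling α l u) i j))
        < ε / ((∑ i, ∑ j, |w i * w j|) + 1) :=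
    eventually_all.2 fun i => eventually_all.2 fun j =>
      Metric.tendstoUniformlyOn_iff.1 (hu i j) _ (by positivity)
  filter_upwards [this] with u hu' t ht
  have e1 : w ⬝ᵥ (V t *ᵥ w) - u ^ 2 * quadDefect R w (t / scaling α l u) =
      ∑ i, ∑ j, (w i * w j) * (V t i j - u ^ 2 * (R 0 i j - R (t / scaling α l u) i j)) := by
    rw [quadDefect, dotProduct_mulVec_eq_sum, dotProduct_mulVec_eq_sum, Finset.mul_sum,
      ← Finset.sum_sub_distrib]
    refine Finset.sum_congr rfl fun i _ => ?_
    rw [Finset.mul_sum, ← Finset.sum_sub_distrib]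
    refine Finset.sum_congr rfl fun j _ => ?_
    simp only [Matrix.sub_apply]
    ring
  rw [Real.dist_eq, e1]
  calc |∑ i, ∑ j, (w i * w j) * (V t i j - u ^ 2 * (R 0 i j - R (t / scaling α l u) i j))|
      ≤ ∑ i, ∑ j, |w i * w j| * (ε / ((∑ i, ∑ j, |w i * w j|) + 1)) := by
        refine (Finset.abs_sum_le_sum_abs _ _).trans (Finset.sum_le_sum fun i _ => ?_)
        refine (Finset.abs_sum_le_sum_abs _ _).trans (Finset.sum_le_sum fun j _ => ?_)
        rw [abs_mul]
        exact mul_le_mul_of_nonneg_left (hu' i j t ht).le (abs_nonneg _)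
    _ = (∑ i, ∑ j, |w i * w j|) * (ε / ((∑ i, ∑ j, |w i * w j|) + 1)) := by
        simp only [Finset.sum_mul]
    _ < ((∑ i, ∑ j, |w i * w j|) + 1) * (ε / ((∑ i, ∑ j, |w i * w j|) + 1)) := by
        have : 0 < ε / ((∑ i, ∑ j, |w i * w j|) + 1) := by positivity
        nlinarith
    _ = ε := by field_simp

end LocalLimit

/-! ### Lower bound for the rescaled quadratic form -/

section LowerBound

variable {k d : ℕ} {R V : (Fin k → ℝ) → Matrix (Fin d) (Fin d) ℝ} {w : Fin d → ℝ}
  {α : Fin k → ℝ} {l : Fin k → ℝ → ℝ}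

lemma continuous_quadForm {f : (Fin k → ℝ) → Matrix (Fin d) (Fin d) ℝ} (hf : Continuous f)
    (w : Fin d → ℝ) : Continuous fun t => w ⬝ᵥ (f t *ᵥ w) := by
  fun_prop

lemma continuous_quadDefect (hR : Continuous R) (w : Fin d → ℝ) :
    Continuous (quadDefect R w) :=
  continuous_quadForm (f := fun t => R 0 - R t) (by fun_prop) w

lemma isCompact_box_diff (r s : ℝ) :
    IsCompact {t : Fin k → ℝ | (∀ i, |t i| ≤ r) ∧ ∃ i, s ≤ |t i|} := by
  have h1 : IsCompact {t : Fin k → ℝ | ∀ i, |t i| ≤ r} := by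
    have : {t : Fin k → ℝ | ∀ i, |t i| ≤ r} = Set.Icc (fun _ => -r) (fun _ => r) := by
      ext t
      simp [Pi.le_def, abs_le, forall_and]
    rw [this]
    exact isCompact_Icc
  have h2 : IsClosed {t : Fin k → ℝ | ∃ i, s ≤ |t i|} := by
    rw [Set.ofPred_exists]
    exact isClosed_iUnion_of_finite fun i => isClosed_le (by fun_prop) (by fun_prop)
  exact h1.inter_right h2

/-- The rescaled quadratic form dominates a positive power of the rescaled argument. -/
lemma LocalExpansion.quadDefect_lower_bound (h : LocalExpansion R w α l V) (hR : Continuous R)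
    (hpos : ∀ τ, τ ≠ 0 → 0 < quadDefect R w τ) {T : ℝ} (hT : 0 < T) :
    ∃ c δ u₀ : ℝ, 0 < c ∧ 0 < δ ∧ ∀ u, u₀ ≤ u → ∀ τ : Fin k → ℝ, (∀ i, |τ i| ≤ T) →
      1 < ‖scaling α l u * τ‖ →
      c * ‖scaling α l u * τ‖ ^ δ ≤ u ^ 2 * quadDefect R w τ := by
  -- Fix `τ` and run through the scales `2 ^ j z`. At the last scale before the rescaled point
  -- leaves the box of half-width `r` it lies in a shell, where uniform convergence to the positive
  -- function `wᵀ V w` bounds the form from below. Each later doubling multiplies `u²` by 4 and the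
  -- point by at most `M`, whence the exponent `log_M 4`. If the point is outside already at the
  -- base scale, then `τ` stays away from 0 and compactness suffices.
  obtain ⟨r, hr, hr1, hunif⟩ := h.exists_uniform_quadDefect
  obtain ⟨z₀, a, M, hz₀, ha, hM, hv⟩ := h.exists_doubling
  have hM0 : 0 < M := by linarith
  -- `r / M` is the inner radius of the shell: a doubling enlarges a coordinate by at most `M`, so a
  -- coordinate that exceeds `r` at the next scale is at least `r / M` now.
  obtain ⟨c₁, hc₁, hK⟩ := (isCompact_box_diff (k := k) r (r / M)).exists_forall_le' (a := 0)
    (continuous_quadForm h.continuous w).continuousOn (fun t ht => h.pos t (by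
      rintro rfl
      obtain ⟨i, hi⟩ := ht.2
      have : 0 < r / M := by positivity
      simp at hi
      linarith))
  obtain ⟨z₂, hz₂⟩ := ((Metric.tendstoUniformlyOn_iff.1 hunif (c₁ / 2) (by positivity)).and
    (eventually_ge_atTop z₀)).exists_forall_of_atTop
  have hz₂0 : z₀ ≤ z₂ := (hz₂ z₂ le_rfl).2
  have hz₂' : 0 < z₂ := by linarith
  obtain ⟨m, C, hm, hmC, hvC⟩ := h.scaling_mem_Icc hz₂'
  have hC : 0 < C := hm.trans_le hmC
  obtain ⟨q₀, hq₀, hq⟩ := (isCompact_box_diff (k := k) T (r / C)).exists_forall_le' (a := 0)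
    (continuous_quadDefect hR w).continuousOn (fun t ht => hpos t (by
      rintro rfl
      obtain ⟨i, hi⟩ := ht.2
      have : 0 < r / C := by positivity
      simp at hi
      linarith))
  have hshell : ∀ z, z₂ ≤ z → ∀ τ : Fin k → ℝ, (∀ i, |τ i| * scaling α l z i ≤ r) →
      (∃ i, r < |τ i| * scaling α l (2 * z) i) → c₁ / 2 ≤ z ^ 2 * quadDefect R w τ := by
    intro z hz τ h1 ⟨i, hi⟩
    have hz0 : 0 < z := hz₂'.trans_le hz
    have hvz := fun j => h.scaling_pos j hz0
    have ht1 : ∀ j, |(scaling α l z * τ) j| = |τ j| * scaling α l z j := fun j => by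
      rw [Pi.mul_apply, abs_mul, abs_of_pos (hvz j), mul_comm]
    have hmem : ∀ j, |(scaling α l z * τ) j| ≤ r := fun j => (ht1 j).trans_le (h1 j)
    have h2 := (hz₂ z hz).1 (scaling α l z * τ) hmem
    have h3 : scaling α l z * τ / scaling α l z = τ := by
      ext j
      simp [(hvz j).ne']
    rw [h3, Real.dist_eq] at h2
    have h4 := hK (scaling α l z * τ) ⟨hmem, i, by
      rw [ht1, div_le_iff₀ hM0]
      have := (hv z (hz₂0.trans hz) i).2
      calc r ≤ |τ i| * scaling α l (2 * z) i := hi.le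
        _ ≤ |τ i| * (M * scaling α l z i) := mul_le_mul_of_nonneg_left this (abs_nonneg _)
        _ = _ := by ring⟩
    have h5 := (abs_lt.1 h2).2
    linarith
  have hδ : 0 < Real.logb M 4 := Real.logb_pos hM (by norm_num)
  -- The exponent is chosen so that `M ^ δ = 4`.
  have hMδ : ∀ n : ℕ, (M ^ n) ^ Real.logb M 4 = (4 : ℝ) ^ n := fun n => by
    rw [← Real.rpow_natCast, ← Real.rpow_mul hM0.le, mul_comm, Real.rpow_mul hM0.le,
      Real.rpow_logb hM0 hM.ne' (by norm_num), Real.rpow_natCast]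
  have hTC : 0 < (T * C) ^ Real.logb M 4 := by positivity
  refine ⟨min (c₁ / 2) (z₂ ^ 2 * q₀ / (T * C) ^ Real.logb M 4), Real.logb M 4, z₂,
    by positivity, hδ, ?_⟩
  intro u hu τ hτ hnorm
  obtain ⟨n, z, hz1, hz2, rfl⟩ := exists_dyadic_decomposition hz₂' hu
  have hz0 : 0 < z := hz₂'.trans_le hz1
  have hge : ∀ j : ℕ, z₂ ≤ 2 ^ j * z := fun j =>
    hz1.trans (le_mul_of_one_le_left hz0.le (one_le_pow₀ one_le_two))
  have hu0 : (0 : ℝ) < 2 ^ n * z := by positivity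
  have habs : ∀ i, |(scaling α l (2 ^ n * z) * τ) i| = |τ i| * scaling α l (2 ^ n * z) i :=
    fun i => by rw [Pi.mul_apply, abs_mul, abs_of_pos (h.scaling_pos i hu0), mul_comm]
  have hbd : ∀ i, ∀ z', z₂ ≤ z' → ∀ j : ℕ,
      scaling α l (2 ^ j * z') i ≤ M ^ j * scaling α l z' i := fun i z' hz' j =>
    (geometric_bounds (f := fun u => scaling α l u i) hz₂' (by linarith) hM0.le
      (fun y hy => hv y (hz₂0.trans hy) i) hz' j).2
  by_cases h0 : ∀ i, |τ i| * scaling α l z i ≤ r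
  · have hex : ∃ j : ℕ, ¬ ∀ i, |τ i| * scaling α l (2 ^ j * z) i ≤ r := by
      refine ⟨n, fun hcon => ?_⟩
      have : ‖scaling α l (2 ^ n * z) * τ‖ ≤ 1 :=
        (pi_norm_le_iff_of_nonneg zero_le_one).2 fun i => by
          rw [Real.norm_eq_abs, habs i]; exact (hcon i).trans hr1
      linarith
    classical
    have hj1 := Nat.find_spec hex
    have hj0 : Nat.find hex ≠ 0 := fun hcon => by
      rw [hcon] at hj1
      exact hj1 (by simpa using h0)
    obtain ⟨j, hj⟩ := Nat.exists_eq_succ_of_ne_zero hj0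
    have hjn : j + 1 ≤ n := by
      rw [← Nat.succ_eq_add_one, ← hj]
      refine Nat.find_min' hex fun hcon => ?_
      have : ‖scaling α l (2 ^ n * z) * τ‖ ≤ 1 :=
        (pi_norm_le_iff_of_nonneg zero_le_one).2 fun i => by
          rw [Real.norm_eq_abs, habs i]; exact (hcon i).trans hr1
      linarith
    have hjin : ∀ i, |τ i| * scaling α l (2 ^ j * z) i ≤ r := by
      have := Nat.find_min hex (m := j) (by omega)
      push Not at this
      exact this
    rw [hj, Nat.succ_eq_add_one] at hj1
    push Not at hj1
    have h1 := hshell (2 ^ j * z) (hge j) τ hjin (by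
      rw [show 2 * (2 ^ j * z) = 2 ^ (j + 1) * z by ring]; exact hj1)
    obtain ⟨e, rfl⟩ : ∃ e, n = j + e := ⟨n - j, by omega⟩
    have h2 : ‖scaling α l (2 ^ (j + e) * z) * τ‖ ≤ M ^ e := by
      refine (pi_norm_le_iff_of_nonneg (by positivity)).2 fun i => ?_
      rw [Real.norm_eq_abs, habs i]
      have := hbd i (2 ^ j * z) (hge j) e
      rw [show (2 : ℝ) ^ (j + e) * z = 2 ^ e * (2 ^ j * z) by ring]
      calc |τ i| * scaling α l (2 ^ e * (2 ^ j * z)) i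
          ≤ |τ i| * (M ^ e * scaling α l (2 ^ j * z) i) :=
            mul_le_mul_of_nonneg_left this (abs_nonneg _)
        _ = M ^ e * (|τ i| * scaling α l (2 ^ j * z) i) := by ring
        _ ≤ M ^ e * 1 := mul_le_mul_of_nonneg_left ((hjin i).trans hr1) (by positivity)
        _ = M ^ e := mul_one _
    calc _ ≤ c₁ / 2 * (M ^ e) ^ Real.logb M 4 := by
          refine mul_le_mul (min_le_left _ _) ?_ (by positivity) (by positivity)
          exact Real.rpow_le_rpow (norm_nonneg _) h2 hδ.le
      _ = 4 ^ e * (c₁ / 2) := by rw [hMδ]; ring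
      _ ≤ 4 ^ e * ((2 ^ j * z) ^ 2 * quadDefect R w τ) :=
          mul_le_mul_of_nonneg_left h1 (by positivity)
      _ = (2 ^ (j + e) * z) ^ 2 * quadDefect R w τ := by
          rw [show (4 : ℝ) = 2 ^ 2 by norm_num, ← pow_mul]; ring
  -- Some `|τ i|` is at least `r / C`, so the positive minimum `q₀` over that compact set takes the
  -- role of the limit.
  · push Not at h0
    obtain ⟨i₀, hi₀⟩ := h0
    have h1 := hq τ ⟨hτ, i₀, by
      rw [div_le_iff₀ hC]
      exact hi₀.le.trans (mul_le_mul_of_nonneg_left (hvC z hz1 hz2 i₀).2 (abs_nonneg _))⟩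
    have h2 : ‖scaling α l (2 ^ n * z) * τ‖ ≤ T * C * M ^ n := by
      refine (pi_norm_le_iff_of_nonneg (by positivity)).2 fun i => ?_
      rw [Real.norm_eq_abs, habs i]
      calc |τ i| * scaling α l (2 ^ n * z) i ≤ T * (M ^ n * C) := by
            refine mul_le_mul (hτ i) ?_ (h.scaling_pos i hu0).le hT.le
            exact (hbd i z hz1 n).trans
              (mul_le_mul_of_nonneg_left (hvC z hz1 hz2 i).2 (by positivity))
        _ = _ := by ring
    calc _ ≤ z₂ ^ 2 * q₀ / (T * C) ^ Real.logb M 4 * (T * C * M ^ n) ^ Real.logb M 4 := by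
          refine mul_le_mul (min_le_right _ _) ?_ (by positivity) (by positivity)
          exact Real.rpow_le_rpow (norm_nonneg _) h2 hδ.le
      _ = 4 ^ n * (z₂ ^ 2 * q₀) := by
          rw [Real.mul_rpow (x := T * C) (by positivity) (by positivity), hMδ]
          field_simp
      _ ≤ 4 ^ n * (z ^ 2 * quadDefect R w τ) := by gcongr
      _ = (2 ^ n * z) ^ 2 * quadDefect R w τ := by
          rw [show (4 : ℝ) = 2 ^ 2 by norm_num, ← pow_mul]; ring

end LowerBound

/-! ### Self-similarity of the limit and its Hölder continuity at the origin -/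

section SelfSimilar

variable {k d : ℕ} {R V : (Fin k → ℝ) → Matrix (Fin d) (Fin d) ℝ} {w : Fin d → ℝ}
  {α : Fin k → ℝ} {l : Fin k → ℝ → ℝ}

lemma LocalExpansion.apply_zero (h : LocalExpansion R w α l V) : V 0 = 0 := by
  ext i j
  have h1 := h.tendsto_entry 0 i j
  have h2 : V 0 i j = 0 := tendsto_nhds_unique h1
    (tendsto_const_nhds.congr fun u => by
      have e : (0 : Fin k → ℝ) / scaling α l u = 0 := by ext; simp
      rw [e, sub_self, mul_zero])
  exact h2

/-- Near the origin the limit of the local expansion is self-similar. -/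
lemma LocalExpansion.exists_self_similar (h : LocalExpansion R w α l V) :
    ∃ r : ℝ, 0 < r ∧ ∀ (c : ℝ) (t : Fin k → ℝ), 0 < c →
      (∀ m, |c ^ (2 / α m) * t m| < r) → ∀ i j, V (fun m => c ^ (2 / α m) * t m) i j
        = c ^ 2 * V t i j := by
  obtain ⟨r, hr, -, hu⟩ := h.exists_uniform_entry
  refine ⟨r, hr, fun c t hc ht i j => ?_⟩
  -- The argument `t' u / v(c u)` equals `t / v(u)`, so the expansion at scale `c u` and point `t'
  -- u` is `c ^ 2` times the one at scale `u` and point `t`. Because `t' u` moves, uniform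
  -- convergence around its limit is needed, which confines the limit point to a small box.
  set t' : ℝ → Fin k → ℝ := fun u m => scaling α l (c * u) m / scaling α l u m * t m with ht'
  have ht'lim : Tendsto t' atTop (𝓝 fun m => c ^ (2 / α m) * t m) :=
    tendsto_pi_nhds.2 fun m => (h.tendsto_scaling_ratio m hc).mul_const _
  have hopen : IsOpen {t : Fin k → ℝ | ∀ m, |t m| < r} := by
    rw [Set.ofPred_forall]
    exact isOpen_iInter_of_finite fun m => isOpen_lt (by fun_prop) (by fun_prop)
  have hcu : Tendsto (fun u : ℝ => c * u) atTop atTop := tendsto_id.const_mul_atTop hc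
  have hunif' : TendstoUniformlyOn
      (fun (u : ℝ) (t : Fin k → ℝ) =>
        (c * u) ^ 2 * (R 0 i j - R (t / scaling α l (c * u)) i j))
      (fun t => V t i j) atTop {t | ∀ m, |t m| < r} := by
    refine TendstoUniformlyOn.mono (s := {t | ∀ m, |t m| ≤ r}) ?_ fun t ht m => (ht m).le
    intro s hs
    exact hcu.eventually (hu i j s hs)
  have h1 : Tendsto (fun u => (c * u) ^ 2 * (R 0 i j - R (t' u / scaling α l (c * u)) i j)) atTop
      (𝓝 (V (fun m => c ^ (2 / α m) * t m) i j)) := by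
    refine hunif'.tendstoLocallyUniformlyOn.tendsto_comp (x := fun m => c ^ (2 / α m) * t m)
      ?_ ht ?_
    · exact (h.continuous.matrix_elem i j).continuousAt.continuousWithinAt
    · exact tendsto_nhdsWithin_iff.2 ⟨ht'lim, ht'lim.eventually (hopen.mem_nhds ht)⟩
  have h2 := (h.tendsto_entry t i j).const_mul (c ^ 2)
  refine tendsto_nhds_unique h1 (h2.congr' ?_)
  filter_upwards [eventually_gt_atTop 0] with u hu0
  have : t' u / scaling α l (c * u) = t / scaling α l u := by
    ext m
    have := (h.scaling_pos m (mul_pos hc hu0)).ne'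
    have := (h.scaling_pos m hu0).ne'
    simp only [ht', Pi.div_apply]
    field_simp
  rw [this]
  ring

/-- The limit of the local expansion is Hölder continuous at the origin. -/
lemma LocalExpansion.exists_holder (h : LocalExpansion R w α l V) :
    ∃ C β ρ : ℝ, 0 < C ∧ 0 < β ∧ 0 < ρ ∧ ρ ≤ 1 ∧ ∀ t : Fin k → ℝ, ‖t‖ ≤ ρ →
      ∀ i j, |V t i j| ≤ C * ‖t‖ ^ β := by
  obtain ⟨r, hr, hself⟩ := h.exists_self_similar
  obtain ⟨C, hC⟩ : ∃ C : ℝ, 0 < C ∧ ∀ t : Fin k → ℝ, ‖t‖ ≤ 1 → ∀ i j, |V t i j| ≤ C := by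
    have hcpt := isCompact_closedBall (0 : Fin k → ℝ) 1
    have h1 : ∀ i j, ∃ C, ∀ t ∈ Metric.closedBall (0 : Fin k → ℝ) 1, ‖V t i j‖ ≤ C := fun i j =>
      hcpt.exists_bound_of_continuousOn
        (h.continuous.matrix_elem i j).continuousOn
    choose C hC using h1
    refine ⟨(∑ i, ∑ j, |C i j|) + 1, by positivity, fun t ht i j => ?_⟩
    have h2 := hC i j t (by simpa using ht)
    have h3 : |C i j| ≤ ∑ i, ∑ j, |C i j| :=
      (Finset.single_le_sum (f := fun j => |C i j|) (fun j _ => abs_nonneg _)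
        (Finset.mem_univ j)).trans
      (Finset.single_le_sum (f := fun i => ∑ j, |C i j|)
        (fun i _ => Finset.sum_nonneg fun j _ => abs_nonneg _) (Finset.mem_univ i))
    rw [Real.norm_eq_abs] at h2
    linarith [le_abs_self (C i j)]
  -- With `c = ‖t‖ ^ (β / 2)` one has `c ^ (2 / α m) = ‖t‖ ^ (β / α m) ≥ ‖t‖`, as `β < α m` and `‖t‖
  -- ≤ 1`. So `t` is the scaled image of a point of the unit ball, where `V` is bounded, and the
  -- factor `c ^ 2` is `‖t‖ ^ β`.
  obtain ⟨β, hβ0, hβ⟩ : ∃ β : ℝ, 0 < β ∧ ∀ i, β < α i := by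
    have : ∀ᶠ β in 𝓝[>] (0 : ℝ), 0 < β ∧ ∀ i, β < α i :=
      eventually_mem_nhdsWithin.and
        (eventually_all.2 fun i => mem_nhdsWithin_of_mem_nhds (Iio_mem_nhds (h.index_pos i)))
    exact this.exists
  refine ⟨C, β, min 1 (r / 2), hC.1, hβ0, by positivity, min_le_left _ _, fun t ht i j => ?_⟩
  rcases eq_or_ne t 0 with rfl | ht0
  · rw [h.apply_zero, norm_zero, Real.zero_rpow hβ0.ne']
    simp
  have hn : 0 < ‖t‖ := norm_pos_iff.2 ht0
  have hn1 : ‖t‖ ≤ 1 := ht.trans (min_le_left _ _)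
  set c : ℝ := ‖t‖ ^ (β / 2) with hc
  have hc0 : 0 < c := Real.rpow_pos_of_pos hn _
  have hcm : ∀ m, ‖t‖ ≤ c ^ (2 / α m) := fun m => by
    rw [hc, ← Real.rpow_mul hn.le]
    conv_lhs => rw [← Real.rpow_one ‖t‖]
    refine Real.rpow_le_rpow_of_exponent_ge hn hn1 ?_
    have := h.index_pos m
    rw [show β / 2 * (2 / α m) = β / α m by field_simp, div_le_one this]
    exact (hβ m).le
  have hcpos : ∀ m, 0 < c ^ (2 / α m) := fun m => Real.rpow_pos_of_pos hc0 _
  have heq : (fun m => c ^ (2 / α m) * (t m / c ^ (2 / α m))) = t := by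
    ext m
    rw [mul_div_cancel₀ _ (hcpos m).ne']
  have h1 := hself c (fun m => t m / c ^ (2 / α m)) hc0 (fun m => by
    rw [mul_div_cancel₀ _ (hcpos m).ne']
    have h2 : |t m| ≤ ‖t‖ := norm_le_pi_norm t m
    have h3 : ‖t‖ ≤ r / 2 := ht.trans (min_le_right _ _)
    linarith) i j
  rw [heq] at h1
  have h2 : ‖fun m => t m / c ^ (2 / α m)‖ ≤ 1 :=
    (pi_norm_le_iff_of_nonneg zero_le_one).2 fun m => by
      rw [norm_div, Real.norm_of_nonneg (hcpos m).le, div_le_one (hcpos m)]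
      exact (norm_le_pi_norm t m).trans (hcm m)
  rw [h1, abs_mul, abs_of_pos (by positivity)]
  have h3 : c ^ 2 = ‖t‖ ^ β := by
    rw [hc, ← Real.rpow_natCast, ← Real.rpow_mul hn.le]
    norm_num
  rw [h3, mul_comm]
  exact mul_le_mul_of_nonneg_right (hC.2 _ h2 i j) (by positivity)

end SelfSimilar

/-! ### Densities of non-degenerate Gaussian laws -/

section Density

lemma withDensity_ofReal_apply_eq {X : Type*} [MeasurableSpace X] {μ : Measure X} {f : X → ℝ}
    (hf : Integrable f μ) (hf0 : ∀ x, 0 ≤ f x) {s : Set X} (hs : MeasurableSet s) :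
    μ.withDensity (fun x => ENNReal.ofReal (f x)) s
      = ENNReal.ofReal (∫ x, s.indicator f x ∂μ) := by
  rw [withDensity_apply _ hs, ← ofReal_integral_eq_lintegral_ofReal hf.integrableOn
    (Eventually.of_forall hf0), integral_indicator hs]

/-- A finite product of measures with densities has the product density. -/
lemma pi_withDensity_ofReal {ι : Type*} [Fintype ι] {f : ι → ℝ → ℝ}
    (hf : ∀ i, Integrable (f i)) (hf0 : ∀ i x, 0 ≤ f i x) :
    Measure.pi (fun i => (volume : Measure ℝ).withDensity fun x => ENNReal.ofReal (f i x))
      = (volume : Measure (ι → ℝ)).withDensity fun x => ENNReal.ofReal (∏ i, f i (x i)) := by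
  have hfin : ∀ i, IsFiniteMeasure
      ((volume : Measure ℝ).withDensity fun x => ENNReal.ofReal (f i x)) := fun i =>
    isFiniteMeasure_withDensity_ofReal (hf i).2
  refine Measure.pi_eq fun s hs => ?_
  have hint : Integrable (fun x : ι → ℝ => ∏ i, f i (x i)) := Integrable.fintype_prod hf
  rw [withDensity_ofReal_apply_eq hint (fun x => Finset.prod_nonneg fun i _ => hf0 i _)
    (MeasurableSet.univ_pi hs)]
  have e : (Set.univ.pi s).indicator (fun x : ι → ℝ => ∏ i, f i (x i))
      = fun x => ∏ i, (s i).indicator (f i) (x i) := by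
    classical
    ext x
    by_cases hx : x ∈ Set.univ.pi s
    · rw [Set.indicator_of_mem hx]
      exact Finset.prod_congr rfl fun i _ => (Set.indicator_of_mem (hx i trivial) _).symm
    · rw [Set.indicator_of_notMem hx]
      simp only [Set.mem_pi, Set.mem_univ, true_imp_iff, not_forall] at hx
      obtain ⟨i, hi⟩ := hx
      exact (Finset.prod_eq_zero (Finset.mem_univ i) (Set.indicator_of_notMem hi _)).symm
  rw [e, integral_fintype_prod_volume_eq_prod, ENNReal.ofReal_prod_of_nonneg]
  · exact Finset.prod_congr rfl fun i _ => (withDensity_ofReal_apply_eq (hf i) (hf0 i) (hs i)).symm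
  · exact fun i _ => integral_nonneg fun x => Set.indicator_nonneg (fun x _ => hf0 i x) x

lemma pi_gaussianReal_eq_withDensity (ι : Type*) [Fintype ι] :
    Measure.pi (fun _ : ι => gaussianReal 0 1)
      = (volume : Measure (ι → ℝ)).withDensity fun x =>
        ENNReal.ofReal (((√(2 * Real.pi))⁻¹) ^ Fintype.card ι * Real.exp (-(x ⬝ᵥ x) / 2)) := by
  have h := pi_withDensity_ofReal (ι := ι) (f := fun _ => gaussianPDFReal 0 1)
    (fun _ => integrable_gaussianPDFReal 0 1) (fun _ => gaussianPDFReal_nonneg 0 1)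
  rw [gaussianReal_of_var_ne_zero 0 one_ne_zero]
  refine h.trans ?_
  congr 1
  ext x
  congr 1
  simp only [gaussianPDFReal]
  rw [Finset.prod_mul_distrib, ← Real.exp_sum]
  congr 1
  · simp [Finset.card_univ]
  · congr 1
    simp only [dotProduct, pow_two, sub_zero, NNReal.coe_one, mul_one]
    rw [← Finset.sum_neg_distrib, Finset.sum_div]

open scoped MatrixOrder in
lemma exists_sq_root {d : ℕ} {S : Matrix (Fin d) (Fin d) ℝ} (hS : S.PosSemidef)
    (hdet : IsUnit S.det) :
    ∃ A : Matrix (Fin d) (Fin d) ℝ, IsUnit A.det ∧ Aᵀ = A ∧ A * A = S := by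
  refine ⟨CFC.sqrt S, ?_, ?_, CFC.sqrt_mul_sqrt_self S hS.nonneg⟩
  · have h := congrArg Matrix.det (CFC.sqrt_mul_sqrt_self S hS.nonneg)
    rw [Matrix.det_mul] at h
    rw [← h] at hdet
    exact isUnit_of_mul_isUnit_left hdet
  · have h := (CFC.sqrt_nonneg S).isSelfAdjoint
    have h2 : (CFC.sqrt S)ᴴ = CFC.sqrt S := h
    rwa [Matrix.conjTranspose_eq_transpose_of_trivial] at h2

lemma dual_eq_dotProduct {ι : Type*} [Fintype ι] [DecidableEq ι] (L : StrongDual ℝ (ι → ℝ)) :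
    (L : (ι → ℝ) → ℝ) = fun x => (fun i => L (Pi.single i 1)) ⬝ᵥ x := by
  ext x
  conv_lhs => rw [pi_eq_sum_univ' x]
  simp [dotProduct, map_sum, mul_comm]

/-- Two centered Gaussian measures on `ℝᵈ` with the same variances of linear functionals agree. -/
lemma gaussian_ext {ι : Type*} [Fintype ι] {μ ν : Measure (ι → ℝ)} [IsGaussian μ]
    [IsGaussian ν] (hμ : ∀ a : ι → ℝ, ∫ x, a ⬝ᵥ x ∂μ = 0) (hν : ∀ a : ι → ℝ, ∫ x, a ⬝ᵥ x ∂ν = 0)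
    (hvar : ∀ a : ι → ℝ, Var[fun x => a ⬝ᵥ x; μ] = Var[fun x => a ⬝ᵥ x; ν]) : μ = ν := by
  classical
  refine Measure.ext_of_charFunDual ?_
  ext L
  rw [IsGaussian.charFunDual_eq, IsGaussian.charFunDual_eq, integral_complex_ofReal,
    integral_complex_ofReal, dual_eq_dotProduct L, hμ, hν, hvar]

lemma isGaussian_pi_gaussianReal (ι : Type*) [Fintype ι] :
    IsGaussian (Measure.pi fun _ : ι => gaussianReal 0 1) := by
  have h1 : iIndepFun (fun (i : ι) (x : ι → ℝ) => x i) (Measure.pi fun _ : ι => gaussianReal 0 1) :=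
    iIndepFun_pi (X := fun _ x => x) fun i => aemeasurable_id
  have h2 := (h1.hasGaussianLaw fun i => HasLaw.hasGaussianLaw (μ := gaussianReal 0 1)
    ⟨(measurable_pi_apply i).aemeasurable, (measurePreserving_eval (fun _ : ι => gaussianReal 0 1) i).map_eq⟩).isGaussian_map
  rwa [Measure.map_id'] at h2

lemma integral_dotProduct_pi_gaussianReal {ι : Type*} [Fintype ι] (a : ι → ℝ) :
    ∫ x, a ⬝ᵥ x ∂(Measure.pi fun _ : ι => gaussianReal 0 1) = 0 := by
  simp only [dotProduct]
  rw [integral_finsetSum]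
  · refine Finset.sum_eq_zero fun i _ => ?_
    rw [integral_const_mul, integral_eval]
    simp
  · exact fun i _ => (integrable_eval IsGaussian.integrable_id).const_mul _

lemma variance_dotProduct_pi_gaussianReal {ι : Type*} [Fintype ι] (a : ι → ℝ) :
    Var[fun x => a ⬝ᵥ x; Measure.pi fun _ : ι => gaussianReal 0 1] = a ⬝ᵥ a := by
  have h := variance_sum_pi (μ := fun _ : ι => gaussianReal 0 1)
    (X := fun i x => a i * x) (fun i => IsGaussian.memLp_two_id.const_mul _)
  have e : (fun x : ι → ℝ => a ⬝ᵥ x) = ∑ i, fun ω : ι → ℝ => a i * ω i := by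
    ext x
    simp [dotProduct]
  rw [e, h]
  simp only [dotProduct]
  refine Finset.sum_congr rfl fun i _ => ?_
  have := variance_const_mul (a i) (fun x : ℝ => x) (gaussianReal 0 1)
  rw [this, variance_fun_id_gaussianReal]
  simp [pow_two]

/-- Density of a non-degenerate centered Gaussian measure. -/
lemma exists_gaussian_density {d : ℕ} {S : Matrix (Fin d) (Fin d) ℝ} (hS : S.PosSemidef)
    (hdet : IsUnit S.det) {μ : Measure (Fin d → ℝ)} [IsGaussian μ]
    (hμ : ∀ a : Fin d → ℝ, ∫ x, a ⬝ᵥ x ∂μ = 0)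
    (hvar : ∀ a : Fin d → ℝ, Var[fun x => a ⬝ᵥ x; μ] = a ⬝ᵥ (S *ᵥ a)) :
    ∃ c : ℝ, 0 < c ∧ μ = volume.withDensity fun x =>
      ENNReal.ofReal (c * Real.exp (-(x ⬝ᵥ (S⁻¹ *ᵥ x)) / 2)) := by
  -- The law is the image of the standard Gaussian law under the symmetric square root of `S`; the
  -- Jacobian enters the constant only.
  obtain ⟨A, hA, hAT, hAA⟩ := exists_sq_root hS hdet
  set γ : Measure (Fin d → ℝ) := Measure.pi fun _ => gaussianReal 0 1 with hγ
  have hdot : ∀ a x : Fin d → ℝ, a ⬝ᵥ (A *ᵥ x) = (A *ᵥ a) ⬝ᵥ x := fun a x => by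
    rw [Matrix.dotProduct_mulVec, ← Matrix.mulVec_transpose, hAT]
  have hmeasA : Measurable (fun x : Fin d → ℝ => A *ᵥ x) := by fun_prop
  have hgauss : IsGaussian (γ.map (fun x => A *ᵥ x)) := by
    have : (fun x : Fin d → ℝ => A *ᵥ x) = (Matrix.toLin' A).toContinuousLinearMap := by
      ext x
      simp
    have hγG : IsGaussian γ := isGaussian_pi_gaussianReal (Fin d)
    rw [this]
    infer_instance
  have hμγ : μ = γ.map (fun x => A *ᵥ x) := by
    refine gaussian_ext hμ (fun a => ?_) (fun a => ?_)
    · rw [integral_map hmeasA.aemeasurable (by fun_prop)]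
      simp_rw [hdot]
      exact integral_dotProduct_pi_gaussianReal _
    · rw [hvar, variance_map (by fun_prop) hmeasA.aemeasurable]
      have : (fun x => a ⬝ᵥ x) ∘ (fun x : Fin d → ℝ => A *ᵥ x) = fun x => (A *ᵥ a) ⬝ᵥ x := by
        ext x
        exact hdot a x
      rw [this, variance_dotProduct_pi_gaussianReal, ← hAA, ← Matrix.mulVec_mulVec, hdot]
  have hdet0 : LinearMap.det (Matrix.toLin' A) ≠ 0 := by
    rw [LinearMap.det_toLin']
    exact hA.ne_zero
  set c₀ : ℝ := ((√(2 * Real.pi))⁻¹) ^ Fintype.card (Fin d) with hc₀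
  have hc₀pos : 0 < c₀ := by positivity
  refine ⟨|(LinearMap.det (Matrix.toLin' A))⁻¹| * c₀, by positivity, ?_⟩
  rw [hμγ]
  ext s hs
  have hinv : ∀ x, A⁻¹ *ᵥ (A *ᵥ x) = x := fun x => by
    rw [Matrix.mulVec_mulVec, Matrix.nonsing_inv_mul _ hA, Matrix.one_mulVec]
  have hquad : ∀ y, (A⁻¹ *ᵥ y) ⬝ᵥ (A⁻¹ *ᵥ y) = y ⬝ᵥ (S⁻¹ *ᵥ y) := fun y => by
    rw [← hAA, Matrix.mul_inv_rev, ← Matrix.mulVec_mulVec, Matrix.dotProduct_mulVec,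
      Matrix.dotProduct_mulVec y, ← Matrix.mulVec_transpose,
      Matrix.transpose_nonsing_inv, hAT, ← Matrix.mulVec_transpose,
      Matrix.transpose_nonsing_inv, hAT, Matrix.dotProduct_mulVec, ← Matrix.mulVec_transpose,
      Matrix.transpose_nonsing_inv, hAT]
  have hvol : (volume : Measure (Fin d → ℝ)).map (fun x => A *ᵥ x)
      = ENNReal.ofReal |(LinearMap.det (Matrix.toLin' A))⁻¹| • volume := by
    have := Measure.map_linearMap_addHaar_eq_smul_addHaar
      (volume : Measure (Fin d → ℝ)) hdet0
    have e : (fun x : Fin d → ℝ => A *ᵥ x) = Matrix.toLin' A := by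
      ext x
      simp
    rw [e]
    exact this
  rw [Measure.map_apply hmeasA hs, hγ, pi_gaussianReal_eq_withDensity,
    withDensity_apply _ (hmeasA hs), withDensity_apply _ hs]
  have hm2 : Measurable fun y : Fin d → ℝ =>
      ENNReal.ofReal (c₀ * Real.exp (-(y ⬝ᵥ (S⁻¹ *ᵥ y)) / 2)) := by
    fun_prop
  have e1 : ∀ x : Fin d → ℝ, ENNReal.ofReal (c₀ * Real.exp (-(x ⬝ᵥ x) / 2))
      = (fun y => ENNReal.ofReal (c₀ * Real.exp (-(y ⬝ᵥ (S⁻¹ *ᵥ y)) / 2))) (A *ᵥ x) := fun x => by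
    simp only [← hquad, hinv]
  rw [lintegral_congr e1, ← setLIntegral_map hs hm2 hmeasA, hvol, Measure.restrict_smul,
    lintegral_smul_measure, smul_eq_mul, ← lintegral_const_mul _ hm2]
  refine lintegral_congr fun y => ?_
  rw [← ENNReal.ofReal_mul (abs_nonneg _), mul_assoc]

end Density

/-! ### The product exponential law -/

section ExpLaw

/-- The law of `d` independent unit exponential random variables. -/
noncomputable def expLaw (d : ℕ) : Measure (Fin d → ℝ) := Measure.pi fun _ => expMeasure 1

instance (d : ℕ) : IsProbabilityMeasure (expLaw d) := by
  have := isProbabilityMeasure_expMeasure one_pos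
  unfold expLaw
  infer_instance

lemma integrable_exponentialPDFReal {r : ℝ} (hr : 0 < r) : Integrable (exponentialPDFReal r) := by
  refine ⟨(measurable_exponentialPDFReal r).aestronglyMeasurable, ?_⟩
  rw [hasFiniteIntegral_iff_ofReal (Eventually.of_forall (exponentialPDFReal_nonneg hr))]
  exact (lintegral_exponentialPDF_eq_one hr).trans_lt ENNReal.one_lt_top

lemma expLaw_eq_withDensity (d : ℕ) : expLaw d = volume.withDensity fun x : Fin d → ℝ =>
    ENNReal.ofReal (∏ i, exponentialPDFReal 1 (x i)) :=
  pi_withDensity_ofReal (fun _ => integrable_exponentialPDFReal one_pos)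
    fun _ => exponentialPDFReal_nonneg one_pos

lemma expLaw_absolutelyContinuous (d : ℕ) : expLaw d ≪ volume := by
  rw [expLaw_eq_withDensity]
  exact withDensity_absolutelyContinuous _ _

lemma ae_ne_zero_volume_pi (d : ℕ) : ∀ᵐ x : Fin d → ℝ, ∀ i, x i ≠ 0 := by
  refine ae_all_iff.2 fun i => ?_
  exact (Measure.quasiMeasurePreserving_eval (fun _ : Fin d => (volume : Measure ℝ)) i).ae
    (p := fun x : ℝ => x ≠ 0) (by simp [ae_iff])

lemma expLaw_pos (d : ℕ) : ∀ᵐ x ∂(expLaw d), ∀ i, 0 < x i := by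
  rw [expLaw_eq_withDensity, ae_withDensity_iff (by
    refine ENNReal.measurable_ofReal.comp (Finset.measurable_fun_prod _ fun i _ => ?_)
    exact (measurable_exponentialPDFReal 1).comp (measurable_pi_apply i))]
  filter_upwards [ae_ne_zero_volume_pi d] with x hx hne i
  by_contra hi
  have hi' : x i < 0 := lt_of_le_of_ne (not_lt.1 hi) (hx i)
  refine hne ?_
  rw [Finset.prod_eq_zero (Finset.mem_univ i)]
  · simp
  · simp [exponentialPDFReal, gammaPDFReal, not_le.2 hi']

end ExpLaw

/-! ### The Gaussian tail in exponential coordinates -/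

section Tail

variable {d : ℕ}

/-- The parametrization of the tail region `{x | x > u b}` by the positive orthant. -/
noncomputable def tailPoint (b w : Fin d → ℝ) (u : ℝ) (e : Fin d → ℝ) : Fin d → ℝ :=
  fun i => u * b i + u⁻¹ * (e i / w i)

lemma measurable_tailPoint (b w : Fin d → ℝ) (u : ℝ) : Measurable (tailPoint b w u) := by
  unfold tailPoint
  fun_prop

lemma exists_volume_eq_smul_map_tailPoint (b : Fin d → ℝ) {w : Fin d → ℝ} (hw : ∀ i, 0 < w i)
    {u : ℝ} (hu : 0 < u) : ∃ K : ℝ, 0 < K ∧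
    (volume : Measure (Fin d → ℝ)) = ENNReal.ofReal K • volume.map (tailPoint b w u) := by
  set D : Fin d → ℝ := fun i => u⁻¹ / w i with hD
  have hdet : (Matrix.diagonal D).det ≠ 0 := by
    rw [Matrix.det_diagonal]
    exact Finset.prod_ne_zero_iff.2 fun i _ => (div_pos (inv_pos.2 hu) (hw i)).ne'
  refine ⟨|(Matrix.diagonal D).det|, abs_pos.2 hdet, ?_⟩
  have h1 := Real.smul_map_diagonal_volume_pi hdet
  have h2 : tailPoint b w u = (fun x => u • b + x) ∘ Matrix.toLin' (Matrix.diagonal D) := by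
    ext e i
    simp only [tailPoint, hD, Function.comp, Matrix.toLin'_apply, Pi.add_apply, Pi.smul_apply,
      smul_eq_mul, Matrix.mulVec_diagonal]
    ring
  have hm : Measurable (Matrix.toLin' (Matrix.diagonal D)) := by
    have : (Matrix.toLin' (Matrix.diagonal D) : (Fin d → ℝ) → Fin d → ℝ)
        = fun x => Matrix.diagonal D *ᵥ x := by
      ext x
      simp
    rw [this]
    fun_prop
  rw [h2, ← Measure.map_map (by fun_prop) hm, ← Measure.map_smul, h1]
  exact (map_add_left_eq_self volume (u • b)).symm

/-- The second order weight in the parametrized Gaussian tail. -/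
noncomputable def tailWeight (S : Matrix (Fin d) (Fin d) ℝ) (w : Fin d → ℝ) (u : ℝ)
    (e : Fin d → ℝ) : ℝ :=
  Real.exp (-((e / w) ⬝ᵥ (S⁻¹ *ᵥ (e / w))) / (2 * u ^ 2))

lemma continuous_tailWeight (S : Matrix (Fin d) (Fin d) ℝ) (w : Fin d → ℝ) (u : ℝ) :
    Continuous (tailWeight S w u) := by
  unfold tailWeight
  have : Continuous fun e : Fin d → ℝ => e / w := by
    refine continuous_pi fun i => ?_
    simp only [Pi.div_apply]
    fun_prop
  fun_prop

lemma tailWeight_pos (S : Matrix (Fin d) (Fin d) ℝ) (w : Fin d → ℝ) (u : ℝ) (e : Fin d → ℝ) :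
    0 < tailWeight S w u e := Real.exp_pos _

lemma tailWeight_le_one {S : Matrix (Fin d) (Fin d) ℝ} (hS : S.PosSemidef) (w : Fin d → ℝ) (u : ℝ)
    (e : Fin d → ℝ) : tailWeight S w u e ≤ 1 := by
  refine Real.exp_le_one_iff.2 ?_
  have := hS.inv.dotProduct_mulVec_nonneg (e / w)
  rw [star_trivial] at this
  rw [neg_div, neg_nonpos]
  positivity

lemma tendsto_tailWeight (S : Matrix (Fin d) (Fin d) ℝ) (w : Fin d → ℝ) (e : Fin d → ℝ) :
    Tendsto (fun u => tailWeight S w u e) atTop (𝓝 1) := by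
  have h1 : Tendsto (fun u : ℝ => 2 * u ^ 2) atTop atTop :=
    (tendsto_pow_atTop two_ne_zero).const_mul_atTop two_pos
  have h2 := (tendsto_const_nhds (x := -((e / w) ⬝ᵥ (S⁻¹ *ᵥ (e / w))))).div_atTop h1
  have h3 := (Real.continuous_exp.tendsto 0).comp h2
  rwa [Real.exp_zero] at h3

/-- The restriction of a centered Gaussian law to the tail region `{x | x > u b}` is, up to a
constant, the image of a reweighted exponential law. -/
lemma exists_restrict_tail_eq {S : Matrix (Fin d) (Fin d) ℝ} (hS : S.PosSemidef)
    (hdet : IsUnit S.det) {μ : Measure (Fin d → ℝ)} [IsGaussian μ]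
    (hμ : ∀ a : Fin d → ℝ, ∫ x, a ⬝ᵥ x ∂μ = 0)
    (hvar : ∀ a : Fin d → ℝ, Var[fun x => a ⬝ᵥ x; μ] = a ⬝ᵥ (S *ᵥ a))
    {b w : Fin d → ℝ} (hw : w = S⁻¹ *ᵥ b) (hwpos : ∀ i, 0 < w i) {u : ℝ} (hu : 0 < u) :
    ∃ C : ℝ, 0 < C ∧ μ.restrict {x | ∀ i, u * b i < x i} = ENNReal.ofReal C •
      ((expLaw d).withDensity fun e => ENNReal.ofReal (tailWeight S w u e)).map
        (tailPoint b w u) := by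
  obtain ⟨c, hc, hμc⟩ := exists_gaussian_density hS hdet hμ hvar
  obtain ⟨K, hK, hvol⟩ := exists_volume_eq_smul_map_tailPoint b hwpos hu
  have hST : (S⁻¹)ᵀ = S⁻¹ := by
    have h1 := hS.inv.isHermitian
    rwa [Matrix.IsHermitian, Matrix.conjTranspose_eq_transpose_of_trivial] at h1
  have hE : MeasurableSet {x : Fin d → ℝ | ∀ i, u * b i < x i} := by
    rw [Set.ofPred_forall]
    exact MeasurableSet.iInter fun i => measurableSet_lt measurable_const (measurable_pi_apply i)
  have hphi := measurable_tailPoint b w u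
  -- At `x = u b + e / (u w)` the form `xᵀ S⁻¹ x` equals `u² bᵀw + 2 ∑ e i + u⁻² (e / w)ᵀ S⁻¹ (e /
  -- w)`, because `w = S⁻¹ b`. The three terms produce the constant, the exponential density and
  -- `tailWeight`.
  refine ⟨K * (c * Real.exp (-(u ^ 2 * (b ⬝ᵥ w)) / 2)), by positivity, ?_⟩
  set G : (Fin d → ℝ) → ℝ≥0∞ := fun x =>
    ENNReal.ofReal (c * Real.exp (-(x ⬝ᵥ (S⁻¹ *ᵥ x)) / 2)) with hG
  have hGm : Measurable G := by
    rw [hG]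
    fun_prop
  have hq : Measurable fun e => ENNReal.ofReal (tailWeight S w u e) :=
    ENNReal.measurable_ofReal.comp (continuous_tailWeight S w u).measurable
  have hpdf : Measurable fun x : Fin d → ℝ =>
      ENNReal.ofReal (∏ i, exponentialPDFReal 1 (x i)) := by
    refine ENNReal.measurable_ofReal.comp (Finset.measurable_fun_prod _ fun i _ => ?_)
    exact (measurable_exponentialPDFReal 1).comp (measurable_pi_apply i)
  ext A hA
  rw [Measure.restrict_apply hA, Measure.smul_apply, Measure.map_apply hphi hA,
    withDensity_apply _ (hphi hA), expLaw_eq_withDensity,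
    setLIntegral_withDensity_eq_setLIntegral_mul _ hpdf hq (hphi hA), hμc,
    withDensity_apply _ (hA.inter hE)]
  rw [hvol, Measure.restrict_smul, lintegral_smul_measure, setLIntegral_map (hA.inter hE) hGm hphi,
    Set.preimage_inter, smul_eq_mul, smul_eq_mul, ENNReal.ofReal_mul hK.le, mul_assoc,
    ← lintegral_const_mul _ (hpdf.mul hq)]
  congr 1
  rw [← hvol, ← lintegral_indicator ((hphi hA).inter (hphi hE)), ← lintegral_indicator (hphi hA)]
  refine lintegral_congr_ae ?_
  -- On the faces of the orthant the exponential density does not vanish although strict exceedance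
  -- fails; they are null and are removed.
  filter_upwards [ae_ne_zero_volume_pi d] with e he
  have hmem : e ∈ tailPoint b w u ⁻¹' {x | ∀ i, u * b i < x i} ↔ ∀ i, 0 < e i := by
    simp only [tailPoint, Set.mem_preimage, Set.mem_ofPred_eq]
    refine forall_congr' fun i => ?_
    have := hwpos i
    constructor
    · intro h
      have h1 : 0 < u⁻¹ * (e i / w i) := by linarith
      have h2 := (mul_pos_iff_of_pos_left (inv_pos.2 hu)).1 h1
      exact (div_pos_iff_of_pos_right this).1 h2
    · intro h
      have : 0 < u⁻¹ * (e i / w i) := by positivity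
      linarith
  by_cases hAe : e ∈ tailPoint b w u ⁻¹' A
  swap
  · rw [Set.indicator_of_notMem (fun h => hAe h.1), Set.indicator_of_notMem hAe]
  rw [Set.indicator_of_mem hAe]
  by_cases hpos : ∀ i, 0 < e i
  · rw [Set.indicator_of_mem (Set.mem_inter hAe (hmem.2 hpos))]
    have hpd : ∏ i, exponentialPDFReal 1 (e i) = Real.exp (-∑ i, e i) := by
      rw [← Finset.sum_neg_distrib, Real.exp_sum]
      refine Finset.prod_congr rfl fun i _ => ?_
      simp [exponentialPDFReal, gammaPDFReal, (hpos i).le]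
    simp only [hG, Pi.mul_apply]
    rw [hpd, ← ENNReal.ofReal_mul (by positivity), ← ENNReal.ofReal_mul (by positivity)]
    congr 1
    rw [tailWeight, ← Real.exp_add, mul_assoc, ← Real.exp_add]
    congr 2
    have htp : tailPoint b w u e = u • b + u⁻¹ • (e / w) := by
      ext i
      simp [tailPoint]
    have hsum : w ⬝ᵥ (e / w) = ∑ i, e i := by
      simp only [dotProduct, Pi.div_apply]
      exact Finset.sum_congr rfl fun i _ => mul_div_cancel₀ _ (hwpos i).ne'
    have hcross : b ⬝ᵥ (S⁻¹ *ᵥ (e / w)) = ∑ i, e i := by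
      rw [Matrix.dotProduct_mulVec, ← Matrix.mulVec_transpose, hST, ← hw, hsum]
    rw [htp, Matrix.mulVec_add, Matrix.mulVec_smul, Matrix.mulVec_smul, ← hw]
    simp only [dotProduct_add, add_dotProduct, smul_dotProduct, dotProduct_smul, smul_eq_mul]
    rw [hcross, dotProduct_comm (e / w) w, hsum]
    field_simp
    ring
  · rw [Set.indicator_of_notMem (fun h => hpos (hmem.1 h.2))]
    push Not at hpos
    obtain ⟨i, hi⟩ := hpos
    have hi' : e i < 0 := lt_of_le_of_ne hi (he i)
    have : ∏ i, exponentialPDFReal 1 (e i) = 0 := by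
      refine Finset.prod_eq_zero (Finset.mem_univ i) ?_
      simp [exponentialPDFReal, gammaPDFReal, not_le.2 hi']
    simp [this]

end Tail

/-! ### Exponential moments of centered Gaussian variables -/

section ScalarGaussian

variable {Ω : Type*} [MeasurableSpace Ω] {P : Measure Ω} {U : Ω → ℝ} {v : ℝ}

lemma map_eq_gaussianReal_of_sq (hU : HasGaussianLaw U P) (h0 : ∫ ω, U ω ∂P = 0)
    (hv : ∫ ω, U ω ^ 2 ∂P = v) : P.map U = gaussianReal 0 v.toNNReal := by
  rw [hU.map_eq_gaussianReal, h0, variance_of_integral_eq_zero hU.aemeasurable h0, hv]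

lemma integral_sq_nonneg_of_eq (hv : ∫ ω, U ω ^ 2 ∂P = v) : 0 ≤ v :=
  hv ▸ integral_nonneg fun _ => sq_nonneg _

lemma integral_cexp_of_gaussian (hU : HasGaussianLaw U P) (h0 : ∫ ω, U ω ∂P = 0)
    (hv : ∫ ω, U ω ^ 2 ∂P = v) (x : ℝ) :
    ∫ ω, Complex.exp (x * U ω * Complex.I) ∂P = Complex.exp (-(x ^ 2 * v / 2 : ℝ)) := by
  have h1 : charFun (P.map U) x = ∫ ω, Complex.exp (x * U ω * Complex.I) ∂P := by
    rw [charFun_apply_real, integral_map hU.aemeasurable (by fun_prop)]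
  rw [← h1, map_eq_gaussianReal_of_sq hU h0 hv, charFun_gaussianReal]
  congr 1
  rw [Real.coe_toNNReal _ (integral_sq_nonneg_of_eq hv)]
  push_cast
  ring

lemma integral_exp_of_gaussian (hU : HasGaussianLaw U P) (h0 : ∫ ω, U ω ∂P = 0)
    (hv : ∫ ω, U ω ^ 2 ∂P = v) (x : ℝ) :
    ∫ ω, Real.exp (x * U ω) ∂P = Real.exp (x ^ 2 * v / 2) := by
  have h1 := mgf_gaussianReal (map_eq_gaussianReal_of_sq hU h0 hv) x
  rw [mgf] at h1
  rw [h1, Real.coe_toNNReal _ (integral_sq_nonneg_of_eq hv)]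
  congr 1
  ring

lemma integrable_exp_of_gaussian (hU : HasGaussianLaw U P) (x : ℝ) :
    Integrable (fun ω => Real.exp (x * U ω)) P := by
  have h1 := integrable_exp_mul_gaussianReal (μ := P[U]) (v := (Var[U; P]).toNNReal) x
  rw [← hU.map_eq_gaussianReal] at h1
  exact h1.comp_aemeasurable hU.aemeasurable

end ScalarGaussian

/-! ### Linear combinations of the field and regression on the origin -/

section Field

variable {Ω : Type*} [MeasurableSpace Ω] {P : Measure Ω} {k d : ℕ}
  {Z : (Fin k → ℝ) → Ω → (Fin d → ℝ)} {ι κ : Type*} [Fintype ι] [Fintype κ]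

/-- A finite linear combination of the components of a field. -/
def linComb (Z : (Fin k → ℝ) → Ω → (Fin d → ℝ)) (t : ι → Fin k → ℝ) (a : ι → Fin d → ℝ)
    (ω : Ω) : ℝ :=
  ∑ j, a j ⬝ᵥ Z (t j) ω

/-- The continuous linear functional `x ↦ a ⬝ᵥ x`. -/
noncomputable def dotCLM (a : Fin d → ℝ) : StrongDual ℝ (Fin d → ℝ) :=
  ∑ i, a i • ContinuousLinearMap.proj i

lemma dotCLM_apply (a x : Fin d → ℝ) : dotCLM a x = a ⬝ᵥ x := by
  simp [dotCLM, dotProduct]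

lemma IsCenteredGRF.hasGaussianLaw_pair (hZ : IsCenteredGRF Z P) (s : Fin k → ℝ)
    (t : ι → Fin k → ℝ) (a : ι → Fin d → ℝ) :
    HasGaussianLaw (fun ω => (Z s ω, linComb Z t a ω)) P := by
  classical
  set I : Finset (Fin k → ℝ) := insert s (Finset.univ.image t) with hI
  have hs : s ∈ I := Finset.mem_insert_self _ _
  have ht : ∀ j, t j ∈ I := fun j =>
    Finset.mem_insert_of_mem (Finset.mem_image_of_mem t (Finset.mem_univ j))
  have h := (hZ.gaussian.hasGaussianLaw I).map_fun
    (ContinuousLinearMap.prod (ContinuousLinearMap.proj (φ := fun _ : I => Fin d → ℝ) ⟨s, hs⟩)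
      (∑ j, (dotCLM (a j)).comp
        (ContinuousLinearMap.proj (φ := fun _ : I => Fin d → ℝ) ⟨t j, ht j⟩)))
  refine h.congr (Eventually.of_forall fun ω => ?_)
  simp [linComb, dotCLM_apply]

lemma IsCenteredGRF.hasGaussianLaw_linComb (hZ : IsCenteredGRF Z P)
    (t : ι → Fin k → ℝ) (a : ι → Fin d → ℝ) : HasGaussianLaw (linComb Z t a) P :=
  (hZ.hasGaussianLaw_pair 0 t a).snd

lemma IsCenteredGRF.memLp_two (hZ : IsCenteredGRF Z P) (s : Fin k → ℝ) (i : Fin d) :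
    MemLp (fun ω => Z s ω i) 2 P :=
  ((hZ.gaussian.hasGaussianLaw_eval s).eval i).memLp_two

lemma IsCenteredGRF.integrable_apply (hZ : IsCenteredGRF Z P) (s : Fin k → ℝ) (i : Fin d) :
    Integrable (fun ω => Z s ω i) P :=
  ((hZ.gaussian.hasGaussianLaw_eval s).eval i).integrable

lemma IsCenteredGRF.integrable_mul (hZ : IsCenteredGRF Z P) (s t : Fin k → ℝ) (i j : Fin d) :
    Integrable (fun ω => Z s ω i * Z t ω j) P :=
  (hZ.memLp_two s i).integrable_mul (hZ.memLp_two t j)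

lemma IsCenteredGRF.integral_linComb (hZ : IsCenteredGRF Z P)
    (t : ι → Fin k → ℝ) (a : ι → Fin d → ℝ) : ∫ ω, linComb Z t a ω ∂P = 0 := by
  simp only [linComb, dotProduct]
  rw [integral_finsetSum]
  · refine Finset.sum_eq_zero fun j _ => ?_
    rw [integral_finsetSum]
    · refine Finset.sum_eq_zero fun i _ => ?_
      rw [integral_const_mul, hZ.centered, mul_zero]
    · exact fun i _ => (hZ.integrable_apply _ i).const_mul _
  · exact fun j _ => integrable_finsetSum _ fun i _ => (hZ.integrable_apply _ i).const_mul _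

lemma IsCenteredGRF.integral_linComb_mul_linComb (hZ : IsCenteredGRF Z P)
    (t : ι → Fin k → ℝ) (a : ι → Fin d → ℝ) (s : κ → Fin k → ℝ) (c : κ → Fin d → ℝ) :
    ∫ ω, linComb Z t a ω * linComb Z s c ω ∂P
      = ∑ j, ∑ l, a j ⬝ᵥ (covMatrix Z P (t j) (s l) *ᵥ c l) := by
  have e : ∀ ω, linComb Z t a ω * linComb Z s c ω
      = ∑ j, ∑ l, ∑ i, ∑ m, (a j i * c l m) * (Z (t j) ω i * Z (s l) ω m) := fun ω => by
    simp only [linComb, dotProduct]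
    rw [Finset.sum_mul_sum]
    refine Finset.sum_congr rfl fun j _ => Finset.sum_congr rfl fun l _ => ?_
    rw [Finset.sum_mul_sum]
    exact Finset.sum_congr rfl fun i _ => Finset.sum_congr rfl fun m _ => by ring
  simp_rw [e]
  have hint : ∀ j l i m, Integrable
      (fun ω => (a j i * c l m) * (Z (t j) ω i * Z (s l) ω m)) P := fun j l i m =>
    (hZ.integrable_mul _ _ _ _).const_mul _
  rw [integral_finsetSum _ fun j _ => integrable_finsetSum _ fun l _ =>
    integrable_finsetSum _ fun i _ => integrable_finsetSum _ fun m _ => hint j l i m]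
  refine Finset.sum_congr rfl fun j _ => ?_
  rw [integral_finsetSum _ fun l _ =>
    integrable_finsetSum _ fun i _ => integrable_finsetSum _ fun m _ => hint j l i m]
  refine Finset.sum_congr rfl fun l _ => ?_
  rw [integral_finsetSum _ fun i _ => integrable_finsetSum _ fun m _ => hint j l i m,
    dotProduct_mulVec_eq_sum]
  refine Finset.sum_congr rfl fun i _ => ?_
  rw [integral_finsetSum _ fun m _ => hint j l i m]
  refine Finset.sum_congr rfl fun m _ => ?_
  rw [integral_const_mul]
  simp only [covMatrix, Matrix.of_apply]
  ring

lemma IsCenteredGRF.integral_linComb_sq (hZ : IsCenteredGRF Z P)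
    (t : ι → Fin k → ℝ) (a : ι → Fin d → ℝ) :
    ∫ ω, linComb Z t a ω ^ 2 ∂P = ∑ j, ∑ l, a j ⬝ᵥ (covMatrix Z P (t j) (t l) *ᵥ a l) := by
  simp_rw [pow_two]
  exact hZ.integral_linComb_mul_linComb t a t a

omit [MeasurableSpace Ω] in
lemma dotProduct_eq_linComb (a : Fin d → ℝ) (s : Fin k → ℝ) (ω : Ω) :
    a ⬝ᵥ Z s ω = linComb Z (fun _ : Unit => s) (fun _ => a) ω := by
  simp [linComb]

lemma covMatrix_transpose (s t : Fin k → ℝ) : (covMatrix Z P s t)ᵀ = covMatrix Z P t s := by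
  ext i j
  simp [covMatrix, Matrix.transpose_apply, mul_comm]

lemma IsCenteredGRF.covMatrix_posSemidef (hZ : IsCenteredGRF Z P) (s : Fin k → ℝ) :
    (covMatrix Z P s s).PosSemidef := by
  refine Matrix.PosSemidef.of_dotProduct_mulVec_nonneg ?_ fun x => ?_
  · rw [Matrix.IsHermitian, Matrix.conjTranspose_eq_transpose_of_trivial, covMatrix_transpose]
  · have := hZ.integral_linComb_sq (fun _ : Unit => s) (fun _ => x)
    simp only [Finset.univ_unique, Finset.sum_const, Finset.card_singleton, one_smul] at this
    rw [star_trivial, ← this]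
    exact integral_nonneg fun _ => sq_nonneg _

/-- The regression coefficient of a linear combination on the value of the field at `0`. -/
noncomputable def regCoeff (Z : (Fin k → ℝ) → Ω → (Fin d → ℝ)) (P : Measure Ω)
    (t : ι → Fin k → ℝ) (a : ι → Fin d → ℝ) : Fin d → ℝ :=
  (covMatrix Z P 0 0)⁻¹ *ᵥ ∑ j, covMatrix Z P 0 (t j) *ᵥ a j

/-- The residual of a linear combination after regression on the value of the field at `0`. -/
noncomputable def residual (Z : (Fin k → ℝ) → Ω → (Fin d → ℝ)) (P : Measure Ω)
    (t : ι → Fin k → ℝ) (a : ι → Fin d → ℝ) (ω : Ω) : ℝ :=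
  linComb Z t a ω - regCoeff Z P t a ⬝ᵥ Z 0 ω

lemma IsCenteredGRF.hasGaussianLaw_residual_pair (hZ : IsCenteredGRF Z P)
    (t : ι → Fin k → ℝ) (a : ι → Fin d → ℝ) :
    HasGaussianLaw (fun ω => (Z 0 ω, residual Z P t a ω)) P := by
  have h := (hZ.hasGaussianLaw_pair 0 t a).map_fun
    (ContinuousLinearMap.prod (ContinuousLinearMap.fst ℝ (Fin d → ℝ) ℝ)
      (ContinuousLinearMap.snd ℝ (Fin d → ℝ) ℝ -
        (dotCLM (regCoeff Z P t a)).comp (ContinuousLinearMap.fst ℝ (Fin d → ℝ) ℝ)))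
  refine h.congr (Eventually.of_forall fun ω => ?_)
  simp [residual, dotCLM_apply]

/-- `Option ι` adds the origin as one more point, so moments of the residual come from the formulas
for `linComb`. -/
lemma residual_eq_linComb (t : ι → Fin k → ℝ) (a : ι → Fin d → ℝ) (ω : Ω) :
    residual Z P t a ω = linComb Z (fun o : Option ι => o.elim 0 t)
      (fun o => o.elim (-regCoeff Z P t a) a) ω := by
  simp [residual, linComb, Fintype.sum_option, neg_dotProduct]
  ring

lemma IsCenteredGRF.integral_residual (hZ : IsCenteredGRF Z P)
    (t : ι → Fin k → ℝ) (a : ι → Fin d → ℝ) : ∫ ω, residual Z P t a ω ∂P = 0 := by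
  simp_rw [residual_eq_linComb]
  exact hZ.integral_linComb _ _

lemma IsCenteredGRF.integral_dot_mul_residual (hZ : IsCenteredGRF Z P)
    (hdet : IsUnit (covMatrix Z P 0 0).det)
    (t : ι → Fin k → ℝ) (a : ι → Fin d → ℝ) (c : Fin d → ℝ) :
    ∫ ω, (c ⬝ᵥ Z 0 ω) * residual Z P t a ω ∂P = 0 := by
  simp_rw [residual_eq_linComb, dotProduct_eq_linComb]
  rw [hZ.integral_linComb_mul_linComb]
  simp only [Finset.univ_unique, Finset.sum_const, Finset.card_singleton, one_smul,
    Fintype.sum_option, Option.elim]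
  rw [Matrix.mulVec_neg, dotProduct_neg, regCoeff, Matrix.mulVec_mulVec,
    Matrix.mul_nonsing_inv _ hdet, Matrix.one_mulVec, dotProduct_sum, neg_add_cancel]

/-- The regression coefficient makes the residual uncorrelated with `Z 0`, and for jointly Gaussian
variables this is independence. -/
lemma IsCenteredGRF.indepFun_residual (hZ : IsCenteredGRF Z P)
    (hdet : IsUnit (covMatrix Z P 0 0).det) (t : ι → Fin k → ℝ) (a : ι → Fin d → ℝ) :
    IndepFun (Z 0) (residual Z P t a) P := by
  have hpair := hZ.hasGaussianLaw_residual_pair t a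
  have := hpair.isProbabilityMeasure
  refine hpair.indepFun_of_covariance_strongDual fun L₁ L₂ => ?_
  have e1 : L₁ ∘ Z 0 = fun ω => (fun i => L₁ (Pi.single i 1)) ⬝ᵥ Z 0 ω := by
    ext ω
    exact congrFun (dual_eq_dotProduct L₁) (Z 0 ω)
  have e2 : L₂ ∘ residual Z P t a = fun ω => L₂ 1 * residual Z P t a ω := by
    ext ω
    have : residual Z P t a ω = residual Z P t a ω • (1 : ℝ) := by simp
    rw [Function.comp_apply, this, map_smul]
    simp [mul_comm]
  have m1 : MemLp (fun ω => (fun i => L₁ (Pi.single i 1)) ⬝ᵥ Z 0 ω) 2 P := by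
    rw [← e1]
    exact (hpair.fst.map L₁).memLp_two
  have m2 : MemLp (residual Z P t a) 2 P := hpair.snd.memLp_two
  rw [e1, e2, covariance_const_mul_right, covariance_eq_sub m1 m2]
  simp only [Pi.mul_apply]
  rw [hZ.integral_dot_mul_residual hdet, hZ.integral_residual]
  simp

/-- Pythagoras for the orthogonal decomposition into regression and residual. -/
lemma IsCenteredGRF.integral_residual_sq (hZ : IsCenteredGRF Z P)
    (hdet : IsUnit (covMatrix Z P 0 0).det) (t : ι → Fin k → ℝ) (a : ι → Fin d → ℝ) :
    ∫ ω, residual Z P t a ω ^ 2 ∂P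
      = ∑ j, ∑ l, a j ⬝ᵥ (covMatrix Z P (t j) (t l) *ᵥ a l)
        - regCoeff Z P t a ⬝ᵥ (covMatrix Z P 0 0 *ᵥ regCoeff Z P t a) := by
  have hpair := hZ.hasGaussianLaw_residual_pair t a
  have m1 : MemLp (fun ω => regCoeff Z P t a ⬝ᵥ Z 0 ω) 2 P := by
    have := (hpair.fst.map (dotCLM (regCoeff Z P t a))).memLp_two
    refine this.ae_eq (Eventually.of_forall fun ω => ?_)
    simp [dotCLM_apply]
  have m2 : MemLp (residual Z P t a) 2 P := hpair.snd.memLp_two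
  have e : ∀ ω, linComb Z t a ω ^ 2 = residual Z P t a ω ^ 2
      + (2 * (regCoeff Z P t a ⬝ᵥ Z 0 ω * residual Z P t a ω)
        + regCoeff Z P t a ⬝ᵥ Z 0 ω * (regCoeff Z P t a ⬝ᵥ Z 0 ω)) := fun ω => by
    simp only [residual]
    ring
  have h1 := hZ.integral_linComb_sq t a
  simp_rw [e] at h1
  have i1 : Integrable (fun ω => regCoeff Z P t a ⬝ᵥ Z 0 ω * residual Z P t a ω) P :=
    m1.integrable_mul m2
  have i2 : Integrable (fun ω => regCoeff Z P t a ⬝ᵥ Z 0 ω * (regCoeff Z P t a ⬝ᵥ Z 0 ω)) P :=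
    m1.integrable_mul m1
  have i3 : Integrable (fun ω => 2 * (regCoeff Z P t a ⬝ᵥ Z 0 ω * residual Z P t a ω)
      + regCoeff Z P t a ⬝ᵥ Z 0 ω * (regCoeff Z P t a ⬝ᵥ Z 0 ω)) P := (i1.const_mul 2).add i2
  rw [integral_add m2.integrable_sq i3, integral_add (i1.const_mul 2) i2, integral_const_mul, hZ.integral_dot_mul_residual hdet] at h1
  have h2 : ∫ ω, regCoeff Z P t a ⬝ᵥ Z 0 ω * (regCoeff Z P t a ⬝ᵥ Z 0 ω) ∂P
      = regCoeff Z P t a ⬝ᵥ (covMatrix Z P 0 0 *ᵥ regCoeff Z P t a) := by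
    simp_rw [dotProduct_eq_linComb]
    rw [hZ.integral_linComb_mul_linComb]
    simp
  rw [h2] at h1
  linarith

end Field

/-! ### Consequences of stationarity -/

section Stationary

variable {Ω : Type*} [MeasurableSpace Ω] {P : Measure Ω} {k d : ℕ}
  {X : (Fin k → ℝ) → Ω → (Fin d → ℝ)}

lemma IsStationary.covMatrix_eq (hstat : IsStationary X P) (s t : Fin k → ℝ) :
    covMatrix X P s t = stationaryCov X P (s - t) := by
  classical
  have h := hstat t {s - t, 0}
  ext i j
  simp only [covMatrix, stationaryCov, Matrix.of_apply]
  have h1 := (h.comp (u := fun x : ({s - t, 0} : Finset (Fin k → ℝ)) → Fin d → ℝ =>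
    x ⟨s - t, by simp⟩ i * x ⟨0, by simp⟩ j) (by fun_prop)).integral_eq
  simpa [Function.comp_def] using h1

lemma IsStationary.identDistrib_apply (hstat : IsStationary X P) (s : Fin k → ℝ) :
    IdentDistrib (X s) (X 0) P P := by
  classical
  have h := (hstat s {0}).comp (u := fun x : ({0} : Finset (Fin k → ℝ)) → Fin d → ℝ =>
    x ⟨0, by simp⟩) (by fun_prop)
  simpa [Function.comp_def] using h

lemma IsStationary.stationaryCov_neg (hstat : IsStationary X P) (t : Fin k → ℝ) :
    stationaryCov X P (-t) = (stationaryCov X P t)ᵀ := by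
  rw [stationaryCov, stationaryCov, covMatrix_transpose, hstat.covMatrix_eq 0 t, zero_sub,
    stationaryCov]

lemma IsCenteredGRF.shift (hX : IsCenteredGRF X P) (s : Fin k → ℝ) :
    IsCenteredGRF (fun t => X (t + s)) P :=
  ⟨hX.gaussian.comp_right (fun t => t + s), fun _ i => hX.centered _ i⟩

lemma IsStationary.shift (hstat : IsStationary X P) (s : Fin k → ℝ) :
    IsStationary (fun t => X (t + s)) P := by
  classical
  intro h I
  have h1 := hstat h (I.image (· + s))
  have h2 := h1.comp (u := fun x : (I.image (· + s)) → Fin d → ℝ => fun t : I =>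
    x ⟨t.1 + s, Finset.mem_image_of_mem _ t.2⟩) (by fun_prop)
  have e : ∀ (t : I), t.1 + h + s = t.1 + s + h := fun t => by abel
  simpa [Function.comp_def, Finset.restrict_def, e] using h2

lemma IsStationary.stationaryCov_shift (hstat : IsStationary X P) (s : Fin k → ℝ) :
    stationaryCov (fun t => X (t + s)) P = stationaryCov X P := by
  ext t i j
  have h : covMatrix X P (t + s) (0 + s) = stationaryCov X P t := by
    rw [hstat.covMatrix_eq]
    simp
  exact congrFun (congrFun h i) j

end Stationary

/-! ### Integrals over the tail event -/

section TailRepresentation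

variable {Ω : Type*} [MeasurableSpace Ω] {P : Measure Ω} {k d : ℕ}
  {X : (Fin k → ℝ) → Ω → (Fin d → ℝ)} {b w : Fin d → ℝ} {u : ℝ}

/-- The event that the field at the origin exceeds the level `u b`. -/
def tailEvent (X : (Fin k → ℝ) → Ω → (Fin d → ℝ)) (b : Fin d → ℝ) (u : ℝ) : Set Ω :=
  {ω | ∀ i, u * b i < X 0 ω i}

lemma measurableSet_level (b : Fin d → ℝ) (u : ℝ) :
    MeasurableSet {x : Fin d → ℝ | ∀ i, u * b i < x i} := by
  rw [Set.ofPred_forall]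
  exact MeasurableSet.iInter fun i => measurableSet_lt measurable_const (measurable_pi_apply i)

lemma nullMeasurableSet_tailEvent (hX : IsCenteredGRF X P) (b : Fin d → ℝ) (u : ℝ) :
    NullMeasurableSet (tailEvent X b u) P :=
  (hX.gaussian.aemeasurable 0).nullMeasurable (measurableSet_level b u)

/-- Integrals over the tail event in terms of the exponential law. -/
lemma IsCenteredGRF.exists_tail_repr (hX : IsCenteredGRF X P)
    (hdet : IsUnit (covMatrix X P 0 0).det) (hw : w = (covMatrix X P 0 0)⁻¹ *ᵥ b)
    (hwpos : ∀ i, 0 < w i) (hu : 0 < u) :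
    ∃ C : ℝ, 0 < C ∧
      P.real (tailEvent X b u) = C * ∫ e, tailWeight (covMatrix X P 0 0) w u e ∂(expLaw d) ∧
      (∀ f : (Fin d → ℝ) → ℝ, Measurable f → ∫ ω in tailEvent X b u, f (X 0 ω) ∂P
        = C * ∫ e, tailWeight (covMatrix X P 0 0) w u e * f (tailPoint b w u e) ∂(expLaw d)) ∧
      (∀ f : (Fin d → ℝ) → ℂ, Measurable f → ∫ ω in tailEvent X b u, f (X 0 ω) ∂P
        = C * ∫ e, tailWeight (covMatrix X P 0 0) w u e * f (tailPoint b w u e) ∂(expLaw d)) := by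
  have hP := hX.gaussian.isProbabilityMeasure
  have hX0 := hX.gaussian.aemeasurable 0
  have hGauss : IsGaussian (P.map (X 0)) := (hX.gaussian.hasGaussianLaw_eval 0).isGaussian_map
  have hmean : ∀ a : Fin d → ℝ, ∫ x, a ⬝ᵥ x ∂(P.map (X 0)) = 0 := fun a => by
    rw [integral_map hX0 (by fun_prop)]
    simp_rw [dotProduct_eq_linComb]
    exact hX.integral_linComb _ _
  obtain ⟨C, hC, hrestr⟩ := exists_restrict_tail_eq (μ := P.map (X 0))
    (hX.covMatrix_posSemidef 0) hdet hmean (fun a => by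
      rw [variance_of_integral_eq_zero (by fun_prop) (hmean a),
        integral_map hX0 (by fun_prop)]
      simp_rw [dotProduct_eq_linComb]
      rw [hX.integral_linComb_sq]
      simp) hw hwpos hu
  have hphi := measurable_tailPoint b w u
  have hq := continuous_tailWeight (covMatrix X P 0 0) w u
  -- One argument serves real and complex integrands, with the same constant `C`, which therefore
  -- cancels in conditional expectations.
  have key : ∀ {F : Type} [NormedAddCommGroup F] [NormedSpace ℝ F]
      (f : (Fin d → ℝ) → F), StronglyMeasurable f → ∫ ω in tailEvent X b u, f (X 0 ω) ∂P
        = C • ∫ e, tailWeight (covMatrix X P 0 0) w u e • f (tailPoint b w u e) ∂(expLaw d) := by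
    intro F _ _ f hf
    have h1 := setIntegral_map (μ := P) (f := f) (measurableSet_level b u)
      hf.aestronglyMeasurable hX0
    rw [tailEvent, show {ω | ∀ i, u * b i < X 0 ω i}
      = X 0 ⁻¹' {x | ∀ i, u * b i < x i} from rfl, ← h1, hrestr, integral_smul_measure,
      ENNReal.toReal_ofReal hC.le, integral_map hphi.aemeasurable hf.aestronglyMeasurable]
    congr 1
    rw [integral_withDensity_eq_integral_toReal_smul₀ (by fun_prop)
      (Eventually.of_forall fun _ => ENNReal.ofReal_lt_top)]
    refine integral_congr_ae (Eventually.of_forall fun e => ?_)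
    simp only
    rw [ENNReal.toReal_ofReal (tailWeight_pos _ _ _ _).le]
  refine ⟨C, hC, ?_, fun f hf => ?_, fun f hf => ?_⟩
  · have h1 := key (fun _ => (1 : ℝ)) stronglyMeasurable_const
    rw [setIntegral_const] at h1
    simpa using h1
  · simpa using key f hf.stronglyMeasurable
  · simpa using key f hf.stronglyMeasurable

lemma integral_tailWeight_pos {S : Matrix (Fin d) (Fin d) ℝ} (hS : S.PosSemidef) (w : Fin d → ℝ)
    (u : ℝ) : 0 < ∫ e, tailWeight S w u e ∂(expLaw d) := by
  rw [integral_pos_iff_support_of_nonneg (fun e => (tailWeight_pos S w u e).le)]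
  · have : Function.support (tailWeight S w u) = Set.univ := by
      ext e
      simp [(tailWeight_pos S w u e).ne']
    rw [this]
    simp
  · exact Integrable.of_bound (continuous_tailWeight S w u).aestronglyMeasurable 1
      (Eventually.of_forall fun e => by
        rw [Real.norm_of_nonneg (tailWeight_pos S w u e).le]
        exact tailWeight_le_one hS w u e)

lemma tendsto_integral_tailWeight {S : Matrix (Fin d) (Fin d) ℝ} (hS : S.PosSemidef)
    (w : Fin d → ℝ) : Tendsto (fun u => ∫ e, tailWeight S w u e ∂(expLaw d)) atTop (𝓝 1) := by
  have h := tendsto_integral_filter_of_dominated_convergence (μ := expLaw d)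
    (F := fun u e => tailWeight S w u e) (f := fun _ => (1 : ℝ)) (l := atTop) (fun _ => (1 : ℝ))
    (Eventually.of_forall fun u => (continuous_tailWeight S w u).aestronglyMeasurable)
    (Eventually.of_forall fun u => Eventually.of_forall fun e => by
      rw [Real.norm_of_nonneg (tailWeight_pos S w u e).le]
      exact tailWeight_le_one hS w u e)
    (integrable_const _) (Eventually.of_forall fun e => tendsto_tailWeight S w e)
  simpa using h

lemma IsCenteredGRF.tailEvent_pos (hX : IsCenteredGRF X P)
    (hdet : IsUnit (covMatrix X P 0 0).det) (hw : w = (covMatrix X P 0 0)⁻¹ *ᵥ b)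
    (hwpos : ∀ i, 0 < w i) (hu : 0 < u) : 0 < P.real (tailEvent X b u) := by
  obtain ⟨C, hC, h, -, -⟩ := hX.exists_tail_repr hdet hw hwpos hu
  rw [h]
  exact mul_pos hC (integral_tailWeight_pos (hX.covMatrix_posSemidef 0) w u)

variable {ι : Type*} [Fintype ι]

/-- By symmetry the inverse covariance moves onto `b` and produces `w`. This is the origin of the
drift `V(t) w` in the limit. -/
lemma regCoeff_dotProduct_level (hw : w = (covMatrix X P 0 0)⁻¹ *ᵥ b)
    (t : ι → Fin k → ℝ) (a : ι → Fin d → ℝ) :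
    regCoeff X P t a ⬝ᵥ b = ∑ j, a j ⬝ᵥ (covMatrix X P (t j) 0 *ᵥ w) := by
  have hT : ((covMatrix X P 0 0)⁻¹)ᵀ = (covMatrix X P 0 0)⁻¹ := by
    rw [Matrix.transpose_nonsing_inv, covMatrix_transpose]
  rw [regCoeff, dotProduct_comm, Matrix.dotProduct_mulVec, ← Matrix.mulVec_transpose, hT, ← hw,
    dotProduct_sum]
  refine Finset.sum_congr rfl fun j _ => ?_
  rw [Matrix.dotProduct_mulVec, ← Matrix.mulVec_transpose, covMatrix_transpose, dotProduct_comm]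

/-- The characteristic function of the rescaled exceedance over the tail event. -/
lemma IsCenteredGRF.integral_tailEvent_cexp (hX : IsCenteredGRF X P)
    (hdet : IsUnit (covMatrix X P 0 0).det) (hw : w = (covMatrix X P 0 0)⁻¹ *ᵥ b)
    (hwpos : ∀ i, 0 < w i) (hu : 0 < u) (t : ι → Fin k → ℝ) (a : ι → Fin d → ℝ) :
    (∫ ω in tailEvent X b u, Complex.exp
        ((∑ j, a j ⬝ᵥ (u • (X (t j) ω - u • b)) : ℝ) * Complex.I) ∂P) / P.real (tailEvent X b u)
      = Complex.exp (-(u ^ 2 * (∫ ω, residual X P t a ω ^ 2 ∂P) / 2 : ℝ)) *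
        (∫ e, tailWeight (covMatrix X P 0 0) w u e * Complex.exp
          ((-∑ j, a j ⬝ᵥ ((u ^ 2 • (covMatrix X P 0 0 - covMatrix X P (t j) 0)) *ᵥ w)
            + regCoeff X P t a ⬝ᵥ (e / w) : ℝ) * Complex.I) ∂(expLaw d)) /
        (∫ e, tailWeight (covMatrix X P 0 0) w u e ∂(expLaw d) : ℝ) := by
  obtain ⟨C, hC, h1, -, h2⟩ := hX.exists_tail_repr hdet hw hwpos hu
  have hI := integral_tailWeight_pos (hX.covMatrix_posSemidef 0) w u
  have hpair := hX.hasGaussianLaw_residual_pair t a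
  have hindep := hX.indepFun_residual hdet t a
  set c := regCoeff X P t a with hc
  set f : (Fin d → ℝ) → ℂ := fun x => Complex.exp
    ((u * (c ⬝ᵥ x) - u ^ 2 * ∑ j, a j ⬝ᵥ b : ℝ) * Complex.I) with hf
  have hfm : Measurable f := by
    rw [hf]
    fun_prop
  set g : ℝ → ℂ := fun x => Complex.exp ((u : ℂ) * x * Complex.I) with hg
  have hgm : Measurable g := by
    rw [hg]
    fun_prop
  -- The exponent is a function of `X 0` plus `u` times the residual. These parts are independent,
  -- and only the first one sees the tail event.
  have e1 : ∀ ω, Complex.exp ((∑ j, a j ⬝ᵥ (u • (X (t j) ω - u • b)) : ℝ) * Complex.I)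
      = f (X 0 ω) * g (residual X P t a ω) := fun ω => by
    rw [hf, hg, ← Complex.exp_add, ← add_mul]
    congr 2
    norm_cast
    simp only [residual, linComb, dotProduct_smul, dotProduct_sub, smul_eq_mul, mul_sub,
      Finset.sum_sub_distrib, ← Finset.mul_sum]
    ring
  have e2 : ∫ ω in tailEvent X b u, f (X 0 ω) * g (residual X P t a ω) ∂P
      = (∫ ω in tailEvent X b u, f (X 0 ω) ∂P) * ∫ ω, g (residual X P t a ω) ∂P := by
    have hX0 := hX.gaussian.aemeasurable 0
    have hfi : ∀ ω, (tailEvent X b u).indicator (fun ω => f (X 0 ω)) ω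
        = ({x : Fin d → ℝ | ∀ i, u * b i < x i}.indicator f) (X 0 ω) := fun ω => by
      by_cases hω : ω ∈ tailEvent X b u
      · rw [Set.indicator_of_mem hω, Set.indicator_of_mem (show X 0 ω ∈ _ from hω)]
      · rw [Set.indicator_of_notMem hω, Set.indicator_of_notMem (show X 0 ω ∉ _ from hω)]
    have hn := nullMeasurableSet_tailEvent hX b u
    rw [← integral_indicator₀ hn, ← integral_indicator₀ hn]
    have h3 := hindep.integral_fun_comp_mul_comp
      (f := {x : Fin d → ℝ | ∀ i, u * b i < x i}.indicator f) (g := g) hX0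
      hpair.snd.aemeasurable (hfm.indicator (measurableSet_level b u)).aestronglyMeasurable
      hgm.aestronglyMeasurable
    simp_rw [← hfi] at h3
    rw [← h3]
    refine integral_congr_ae (Eventually.of_forall fun ω => ?_)
    exact Set.indicator_mul_left _ _ _
  simp_rw [e1]
  rw [e2, h1, h2 f hfm]
  have e3 := integral_cexp_of_gaussian hpair.snd (hX.integral_residual t a) rfl u
  rw [hg, e3]
  have e4 : ∀ e, f (tailPoint b w u e) = Complex.exp
      ((-∑ j, a j ⬝ᵥ ((u ^ 2 • (covMatrix X P 0 0 - covMatrix X P (t j) 0)) *ᵥ w)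
            + c ⬝ᵥ (e / w) : ℝ) * Complex.I) := fun e => by
    simp only [hf]
    congr 3
    have htp : tailPoint b w u e = u • b + u⁻¹ • (e / w) := by
      ext i
      simp [tailPoint]
    have hSw : covMatrix X P 0 0 *ᵥ w = b := by
      rw [hw, Matrix.mulVec_mulVec, Matrix.mul_nonsing_inv _ hdet, Matrix.one_mulVec]
    simp only [Matrix.smul_mulVec, Matrix.sub_mulVec, dotProduct_smul, dotProduct_sub, smul_eq_mul,
      ← Finset.mul_sum, Finset.sum_sub_distrib, hSw]
    rw [← regCoeff_dotProduct_level hw, ← hc, htp, dotProduct_add, dotProduct_smul, dotProduct_smul,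
      smul_eq_mul, smul_eq_mul]
    field_simp
    ring
  simp_rw [e4]
  have hC' : (C : ℂ) ≠ 0 := by exact_mod_cast hC.ne'
  have hI' : ((∫ e, tailWeight (covMatrix X P 0 0) w u e ∂(expLaw d) : ℝ) : ℂ) ≠ 0 := by
    exact_mod_cast hI.ne'
  have aux : ∀ J K I' : ℂ, I' ≠ 0 → (C : ℂ) * J * K / (C * I') = K * J / I' := by
    intro J K I' hI'
    field_simp
  rw [Complex.ofReal_mul]
  exact aux _ _ _ hI'

end TailRepresentation

/-! ### Convergence of the conditional characteristic functions -/

section CharFunLimit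

variable {Ω : Type*} [MeasurableSpace Ω] {P : Measure Ω} {k d : ℕ}
  {X : (Fin k → ℝ) → Ω → (Fin d → ℝ)} {b w : Fin d → ℝ}
  {α : Fin k → ℝ} {l : Fin k → ℝ → ℝ} {V : (Fin k → ℝ) → Matrix (Fin d) (Fin d) ℝ}
  {ι : Type*} [Fintype ι]

/-- The rescaled defect `u² (R 0 - R (t / v(u)))` of a covariance matrix function. -/
noncomputable def scaledDefect (R : (Fin k → ℝ) → Matrix (Fin d) (Fin d) ℝ) (α : Fin k → ℝ)
    (l : Fin k → ℝ → ℝ) (u : ℝ) (t : Fin k → ℝ) : Matrix (Fin d) (Fin d) ℝ :=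
  u ^ 2 • (R 0 - R (t / scaling α l u))

lemma LocalExpansion.tendsto_scaledDefect {R : (Fin k → ℝ) → Matrix (Fin d) (Fin d) ℝ}
    (h : LocalExpansion R w α l V) (t : Fin k → ℝ) :
    Tendsto (fun u => scaledDefect R α l u t) atTop (𝓝 (V t)) :=
  tendsto_pi_nhds.2 fun i => tendsto_pi_nhds.2 fun j => h.tendsto_entry t i j

lemma eq_sub_scaledDefect (R : (Fin k → ℝ) → Matrix (Fin d) (Fin d) ℝ) (α : Fin k → ℝ)
    (l : Fin k → ℝ → ℝ) {u : ℝ} (hu : u ≠ 0) (t : Fin k → ℝ) :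
    R (t / scaling α l u) = R 0 - (u ^ 2)⁻¹ • scaledDefect R α l u t := by
  rw [scaledDefect, smul_smul, inv_mul_cancel₀ (by positivity), one_smul, sub_sub_cancel]

/-- Inherited from `R(-t) = R(t)ᵀ` by uniqueness of limits. -/
lemma LocalExpansion.limit_neg (hstat : IsStationary X P)
    (h : LocalExpansion (stationaryCov X P) w α l V) (t : Fin k → ℝ) : V (-t) = (V t)ᵀ := by
  have h1 := h.tendsto_scaledDefect (-t)
  have h2 := (Continuous.matrix_transpose continuous_id).continuousAt.tendsto.comp
    (h.tendsto_scaledDefect t)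
  refine tendsto_nhds_unique h1 (h2.congr fun u => ?_)
  have e : (-t) / scaling α l u = -(t / scaling α l u) := neg_div _ _
  simp only [Function.comp, id, scaledDefect]
  rw [e, hstat.stationaryCov_neg, Matrix.transpose_smul, Matrix.transpose_sub, ←
    hstat.stationaryCov_neg 0, neg_zero]

lemma IsStationary.covMatrix_scaled (hstat : IsStationary X P) (u : ℝ) (s t : Fin k → ℝ) :
    covMatrix X P (s / scaling α l u) (t / scaling α l u)
      = stationaryCov X P ((s - t) / scaling α l u) := by
  have e : s / scaling α l u - t / scaling α l u = (s - t) / scaling α l u := by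
    ext i
    exact (sub_div _ _ _).symm
  rw [hstat.covMatrix_eq, e]

lemma IsStationary.covMatrix_zero_scaled (hstat : IsStationary X P) (u : ℝ) (t : Fin k → ℝ) :
    covMatrix X P 0 (t / scaling α l u) = stationaryCov X P ((-t) / scaling α l u) := by
  have e : (-t) / scaling α l u = -(t / scaling α l u) := neg_div _ _
  rw [hstat.covMatrix_eq, e, zero_sub]

/-- Substituting `R = R(0) - u⁻² D`, with `D` the scaled defect, shows that the coefficient is `∑ a
j` up to a term of order `u⁻²`. Hence the excess at the origin carries over unchanged to all
rescaled points, and the same `E / w` appears at every time in the limit. -/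
lemma regCoeff_scaled (hstat : IsStationary X P) (hdet : IsUnit (covMatrix X P 0 0).det) {u : ℝ}
    (hu : u ≠ 0) (t : ι → Fin k → ℝ) (a : ι → Fin d → ℝ) :
    regCoeff X P (fun j => t j / scaling α l u) a = ∑ j, a j - (u ^ 2)⁻¹ •
      ((covMatrix X P 0 0)⁻¹ *ᵥ ∑ j, scaledDefect (stationaryCov X P) α l u (-t j) *ᵥ a j) := by
  have e : ∀ j, covMatrix X P 0 (t j / scaling α l u) *ᵥ a j = covMatrix X P 0 0 *ᵥ a j
      - (u ^ 2)⁻¹ • (scaledDefect (stationaryCov X P) α l u (-t j) *ᵥ a j) := fun j => by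
    rw [hstat.covMatrix_zero_scaled, eq_sub_scaledDefect (stationaryCov X P) α l hu, Matrix.sub_mulVec,
      Matrix.smul_mulVec]
    rfl
  rw [regCoeff, Finset.sum_congr rfl fun j _ => e j, Finset.sum_sub_distrib, ← Finset.smul_sum,
    Matrix.mulVec_sub, Matrix.mulVec_smul, ← Matrix.mulVec_sum, Matrix.mulVec_mulVec,
    Matrix.nonsing_inv_mul _ hdet, Matrix.one_mulVec]

/-- The terms in `R(0)` alone, which would be of order `u²`, cancel. What remains are scaled
defects, which converge, and a remainder with the factor `u⁻²`. -/
lemma residual_sq_scaled (hX : IsCenteredGRF X P) (hstat : IsStationary X P)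
    (hdet : IsUnit (covMatrix X P 0 0).det) {u : ℝ}
    (hu : u ≠ 0) (t : ι → Fin k → ℝ) (a : ι → Fin d → ℝ) :
    u ^ 2 * ∫ ω, residual X P (fun j => t j / scaling α l u) a ω ^ 2 ∂P
      = 2 * ((∑ j, a j) ⬝ᵥ ∑ j, scaledDefect (stationaryCov X P) α l u (-t j) *ᵥ a j)
        - ∑ j, ∑ m, a j ⬝ᵥ (scaledDefect (stationaryCov X P) α l u (t j - t m) *ᵥ a m)
        - (u ^ 2)⁻¹ * ((∑ j, scaledDefect (stationaryCov X P) α l u (-t j) *ᵥ a j) ⬝ᵥ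
          ((covMatrix X P 0 0)⁻¹ *ᵥ
            ∑ j, scaledDefect (stationaryCov X P) α l u (-t j) *ᵥ a j)) := by
  have hT : ((covMatrix X P 0 0)⁻¹)ᵀ = (covMatrix X P 0 0)⁻¹ := by
    rw [Matrix.transpose_nonsing_inv, covMatrix_transpose]
  rw [hX.integral_residual_sq hdet, regCoeff_scaled hstat hdet hu]
  set g := ∑ j, scaledDefect (stationaryCov X P) α l u (-t j) *ᵥ a j with hg
  set S := covMatrix X P 0 0 with hS
  set A := ∑ j, a j with hA
  have e1 : ∑ j, ∑ m, a j ⬝ᵥ (covMatrix X P (t j / scaling α l u) (t m / scaling α l u) *ᵥ a m)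
      = A ⬝ᵥ (S *ᵥ A) - (u ^ 2)⁻¹ *
        ∑ j, ∑ m, a j ⬝ᵥ (scaledDefect (stationaryCov X P) α l u (t j - t m) *ᵥ a m) := by
    have e2 : ∀ j m, a j ⬝ᵥ (covMatrix X P (t j / scaling α l u) (t m / scaling α l u) *ᵥ a m)
        = a j ⬝ᵥ (S *ᵥ a m) - (u ^ 2)⁻¹ *
          (a j ⬝ᵥ (scaledDefect (stationaryCov X P) α l u (t j - t m) *ᵥ a m)) := fun j m => by
      rw [hstat.covMatrix_scaled, eq_sub_scaledDefect (stationaryCov X P) α l hu, Matrix.sub_mulVec,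
        Matrix.smul_mulVec, dotProduct_sub, dotProduct_smul, smul_eq_mul]
      rfl
    simp_rw [e2, Finset.sum_sub_distrib, ← Finset.mul_sum]
    congr 1
    rw [hA, Matrix.mulVec_sum, sum_dotProduct]
    exact Finset.sum_congr rfl fun j _ => (dotProduct_sum _ _ _).symm
  have hSS : S *ᵥ (S⁻¹ *ᵥ g) = g := by
    rw [Matrix.mulVec_mulVec, Matrix.mul_nonsing_inv _ hdet, Matrix.one_mulVec]
  have hcr : (S⁻¹ *ᵥ g) ⬝ᵥ (S *ᵥ A) = A ⬝ᵥ g := by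
    rw [Matrix.dotProduct_mulVec, ← Matrix.mulVec_transpose, hS, covMatrix_transpose, ← hS, hSS,
      dotProduct_comm]
  rw [e1, Matrix.mulVec_sub, Matrix.mulVec_smul, hSS]
  simp only [sub_dotProduct, dotProduct_sub, smul_dotProduct, dotProduct_smul, smul_eq_mul]
  rw [hcr, dotProduct_comm (S⁻¹ *ᵥ g) g]
  field_simp
  ring

/-- The limiting variance is that of a field with covariance `V t + V (-s) - V (t - s)`. -/
lemma limit_variance_eq (hV : ∀ t, V (-t) = (V t)ᵀ) (t : ι → Fin k → ℝ) (a : ι → Fin d → ℝ) :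
    2 * ((∑ j, a j) ⬝ᵥ ∑ j, V (-t j) *ᵥ a j) - ∑ j, ∑ m, a j ⬝ᵥ (V (t j - t m) *ᵥ a m)
      = ∑ j, ∑ m, a j ⬝ᵥ ((V (t j) + V (-t m) - V (t j - t m)) *ᵥ a m) := by
  simp_rw [Matrix.sub_mulVec, Matrix.add_mulVec, dotProduct_sub, dotProduct_add,
    Finset.sum_sub_distrib, Finset.sum_add_distrib]
  congr 1
  have e1 : ∑ j, ∑ m, a j ⬝ᵥ (V (t j) *ᵥ a m) = (∑ j, a j) ⬝ᵥ ∑ j, V (-t j) *ᵥ a j := by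
    rw [dotProduct_sum]
    refine Finset.sum_congr rfl fun j _ => ?_
    rw [← dotProduct_sum, ← Matrix.mulVec_sum, hV, Matrix.mulVec_transpose,
      Matrix.dotProduct_mulVec, dotProduct_comm]
  have e2 : ∑ j, ∑ m, a j ⬝ᵥ (V (-t m) *ᵥ a m) = (∑ j, a j) ⬝ᵥ ∑ j, V (-t j) *ᵥ a j := by
    rw [sum_dotProduct]
    exact Finset.sum_congr rfl fun j _ => (dotProduct_sum _ _ _).symm
  rw [e1, e2]
  ring

lemma tendsto_inv_sq_atTop : Tendsto (fun u : ℝ => (u ^ 2)⁻¹) atTop (𝓝 0) :=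
  (tendsto_pow_atTop two_ne_zero).inv_tendsto_atTop

lemma continuous_div_const (w : Fin d → ℝ) : Continuous fun e : Fin d → ℝ => e / w := by
  refine continuous_pi fun i => ?_
  simp only [Pi.div_apply]
  fun_prop

/-- Convergence of the conditional characteristic functions of the rescaled exceedances. -/
lemma tendsto_tailEvent_charFun (hX : IsCenteredGRF X P) (hstat : IsStationary X P)
    (hdet : IsUnit (covMatrix X P 0 0).det) (hw : w = (covMatrix X P 0 0)⁻¹ *ᵥ b)
    (hwpos : ∀ i, 0 < w i) (h : LocalExpansion (stationaryCov X P) w α l V)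
    (t : ι → Fin k → ℝ) (a : ι → Fin d → ℝ) :
    Tendsto (fun u : ℝ => (∫ ω in tailEvent X b u, Complex.exp
        ((∑ j, a j ⬝ᵥ (u • (X (t j / scaling α l u) ω - u • b)) : ℝ) * Complex.I) ∂P)
          / P.real (tailEvent X b u)) atTop
      (𝓝 (Complex.exp
        (-((∑ j, ∑ m, a j ⬝ᵥ ((V (t j) + V (-t m) - V (t j - t m)) *ᵥ a m)) / 2 : ℝ)) *
        ∫ e, Complex.exp ((-∑ j, a j ⬝ᵥ (V (t j) *ᵥ w) + (∑ j, a j) ⬝ᵥ (e / w) : ℝ) * Complex.I)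
          ∂(expLaw d))) := by
  set S := covMatrix X P 0 0 with hS
  have hSpsd : S.PosSemidef := hX.covMatrix_posSemidef 0
  set g : ℝ → Fin d → ℝ := fun u =>
    ∑ j, scaledDefect (stationaryCov X P) α l u (-t j) *ᵥ a j with hg
  have hglim : Tendsto g atTop (𝓝 (∑ j, V (-t j) *ᵥ a j)) := by
    refine tendsto_finsetSum _ fun j _ => ?_
    exact ((Continuous.matrix_mulVec continuous_id continuous_const).continuousAt.tendsto
      (x := V (-t j)) |>.comp (h.tendsto_scaledDefect (-t j)))
  have hc : Tendsto (fun u => regCoeff X P (fun j => t j / scaling α l u) a) atTop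
      (𝓝 (∑ j, a j)) := by
    have h1 : Tendsto (fun u => ∑ j, a j - (u ^ 2)⁻¹ • (S⁻¹ *ᵥ g u)) atTop (𝓝 (∑ j, a j)) := by
      have h2 := ((Continuous.matrix_mulVec (A := fun _ : Fin d → ℝ => S⁻¹) continuous_const
        continuous_id).tendsto _).comp hglim
      have h3 := tendsto_const_nhds (x := ∑ j, a j) |>.sub (tendsto_inv_sq_atTop.smul h2)
      rw [zero_smul, sub_zero] at h3
      exact h3
    refine h1.congr' ?_
    filter_upwards [eventually_ne_atTop 0] with u hu
    rw [regCoeff_scaled hstat hdet hu]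
  have hvar : Tendsto (fun u => u ^ 2 *
      ∫ ω, residual X P (fun j => t j / scaling α l u) a ω ^ 2 ∂P) atTop
      (𝓝 (∑ j, ∑ m, a j ⬝ᵥ ((V (t j) + V (-t m) - V (t j - t m)) *ᵥ a m))) := by
    rw [← limit_variance_eq (h.limit_neg hstat)]
    have h1 : Tendsto (fun u => 2 * ((∑ j, a j) ⬝ᵥ g u)
        - ∑ j, ∑ m, a j ⬝ᵥ (scaledDefect (stationaryCov X P) α l u (t j - t m) *ᵥ a m)
        - (u ^ 2)⁻¹ * (g u ⬝ᵥ (S⁻¹ *ᵥ g u))) atTop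
        (𝓝 (2 * ((∑ j, a j) ⬝ᵥ ∑ j, V (-t j) *ᵥ a j)
          - ∑ j, ∑ m, a j ⬝ᵥ (V (t j - t m) *ᵥ a m)
          - 0 * ((∑ j, V (-t j) *ᵥ a j) ⬝ᵥ (S⁻¹ *ᵥ ∑ j, V (-t j) *ᵥ a j)))) := by
      refine (Tendsto.sub (Tendsto.const_mul _ ?_) ?_).sub (tendsto_inv_sq_atTop.mul ?_)
      · exact ((Continuous.dotProduct (A := fun _ : Fin d → ℝ => ∑ j, a j) continuous_const
          continuous_id).tendsto _).comp hglim
      · refine tendsto_finsetSum _ fun j _ => tendsto_finsetSum _ fun m _ => ?_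
        have hcont : Continuous fun M : Matrix (Fin d) (Fin d) ℝ => a j ⬝ᵥ (M *ᵥ a m) := by
          fun_prop
        exact (hcont.tendsto _).comp (h.tendsto_scaledDefect (t j - t m))
      · have hcont : Continuous fun x : Fin d → ℝ => x ⬝ᵥ (S⁻¹ *ᵥ x) := by fun_prop
        exact (hcont.tendsto _).comp hglim
    rw [zero_mul, sub_zero] at h1
    refine h1.congr' ?_
    filter_upwards [eventually_ne_atTop 0] with u hu
    rw [residual_sq_scaled hX hstat hdet hu]
  have hint : Tendsto (fun u => ∫ e, tailWeight S w u e * Complex.exp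
      ((-∑ j, a j ⬝ᵥ ((u ^ 2 • (S - covMatrix X P (t j / scaling α l u) 0)) *ᵥ w)
        + regCoeff X P (fun j => t j / scaling α l u) a ⬝ᵥ (e / w) : ℝ) * Complex.I) ∂(expLaw d))
      atTop (𝓝 (∫ e, Complex.exp ((-∑ j, a j ⬝ᵥ (V (t j) *ᵥ w)
        + (∑ j, a j) ⬝ᵥ (e / w) : ℝ) * Complex.I) ∂(expLaw d))) := by
    have hcd := continuous_div_const w
    refine tendsto_integral_filter_of_dominated_convergence (fun _ => (1 : ℝ))
      (Eventually.of_forall fun u => ?_) (Eventually.of_forall fun u =>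
        Eventually.of_forall fun e => ?_) (integrable_const _) (Eventually.of_forall fun e => ?_)
    · have := continuous_tailWeight S w u
      refine Continuous.aestronglyMeasurable ?_
      fun_prop
    · rw [norm_mul, Complex.norm_exp_ofReal_mul_I, mul_one, Complex.norm_real,
        Real.norm_of_nonneg (tailWeight_pos S w u e).le]
      exact tailWeight_le_one hSpsd w u e
    · have h1 : Tendsto (fun u => (tailWeight S w u e : ℂ)) atTop (𝓝 ((1 : ℝ) : ℂ)) :=
        (Complex.continuous_ofReal.tendsto _).comp (tendsto_tailWeight S w e)
      have h2 : Tendsto (fun u => -∑ j, a j ⬝ᵥ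
          ((u ^ 2 • (S - covMatrix X P (t j / scaling α l u) 0)) *ᵥ w)
          + regCoeff X P (fun j => t j / scaling α l u) a ⬝ᵥ (e / w)) atTop
          (𝓝 (-∑ j, a j ⬝ᵥ (V (t j) *ᵥ w) + (∑ j, a j) ⬝ᵥ (e / w))) := by
        refine Tendsto.add (Tendsto.neg (tendsto_finsetSum _ fun j _ => ?_)) ?_
        · have hcont : Continuous fun M : Matrix (Fin d) (Fin d) ℝ => a j ⬝ᵥ (M *ᵥ w) := by
            fun_prop
          exact (hcont.tendsto _).comp (h.tendsto_scaledDefect (t j))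
        · have hcont : Continuous fun x : Fin d → ℝ => x ⬝ᵥ (e / w) := by fun_prop
          exact (hcont.tendsto _).comp hc
      have hcont : Continuous fun x : ℝ => Complex.exp ((x : ℂ) * Complex.I) := by fun_prop
      have h3 := h1.mul ((hcont.tendsto _).comp h2)
      rw [Complex.ofReal_one, one_mul] at h3
      exact h3
  have hcont : Continuous fun x : ℝ => Complex.exp (-((x / 2 : ℝ) : ℂ)) := by fun_prop
  have hden : Tendsto (fun u => ((∫ e, tailWeight S w u e ∂(expLaw d) : ℝ) : ℂ)) atTop
      (𝓝 ((1 : ℝ) : ℂ)) :=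
    (Complex.continuous_ofReal.tendsto _).comp (tendsto_integral_tailWeight hSpsd w)
  have hall := (((hcont.tendsto _).comp hvar).mul hint).div hden (by simp)
  rw [Complex.ofReal_one, div_one] at hall
  refine hall.congr' ?_
  filter_upwards [eventually_gt_atTop 0] with u hu
  rw [hX.integral_tailEvent_cexp hdet hw hwpos hu]
  rfl

end CharFunLimit

/-! ### The limit field -/

section LimitPair

variable {Ω' : Type*} [MeasurableSpace Ω'] {P' : Measure Ω'} {k d : ℕ}
  {V : (Fin k → ℝ) → Matrix (Fin d) (Fin d) ℝ} {w : Fin d → ℝ}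
  {Y : (Fin k → ℝ) → Ω' → (Fin d → ℝ)} {E : Ω' → (Fin d → ℝ)}
  {ι : Type*} [Fintype ι]

lemma IsLimitPair.isProbabilityMeasure (h : IsLimitPair V Y E P') : IsProbabilityMeasure P' :=
  h.grf.gaussian.isProbabilityMeasure

lemma IsLimitPair.aemeasurable_exp (h : IsLimitPair V Y E P') : AEMeasurable E P' :=
  aemeasurable_pi_lambda E fun i => (h.exp_law i).aemeasurable

lemma IsLimitPair.map_exp (h : IsLimitPair V Y E P') : P'.map E = expLaw d := by
  have := h.isProbabilityMeasure
  have h1 := (iIndepFun_iff_map_fun_eq_pi_map fun i => (h.exp_law i).aemeasurable).1 h.exp_indep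
  rw [expLaw, show E = fun ω i => E ω i from rfl, h1]
  congr 1
  ext1 i
  exact (h.exp_law i).map_eq

/-- The limit field at a point, `Y(t) - V(t) w + E / w`. -/
noncomputable def limitField (V : (Fin k → ℝ) → Matrix (Fin d) (Fin d) ℝ) (w : Fin d → ℝ)
    (Y : (Fin k → ℝ) → Ω' → (Fin d → ℝ)) (E : Ω' → (Fin d → ℝ)) (t : Fin k → ℝ) (ω : Ω') :
    Fin d → ℝ :=
  Y t ω - V t *ᵥ w + E ω / w

lemma IsLimitPair.aemeasurable_limitField (h : IsLimitPair V Y E P') (w : Fin d → ℝ)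
    (t : Fin k → ℝ) : AEMeasurable (limitField V w Y E t) P' :=
  ((h.grf.gaussian.aemeasurable t).sub_const _).add
    ((continuous_div_const w).measurable.comp_aemeasurable h.aemeasurable_exp)

lemma IsLimitPair.integral_cexp (h : IsLimitPair V Y E P') (w : Fin d → ℝ)
    (t : ι → Fin k → ℝ) (a : ι → Fin d → ℝ) :
    ∫ ω, Complex.exp ((∑ j, a j ⬝ᵥ limitField V w Y E (t j) ω : ℝ) * Complex.I) ∂P'
      = Complex.exp
        (-((∑ j, ∑ m, a j ⬝ᵥ ((V (t j) + V (-t m) - V (t j - t m)) *ᵥ a m)) / 2 : ℝ)) *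
        ∫ e, Complex.exp ((-∑ j, a j ⬝ᵥ (V (t j) *ᵥ w) + (∑ j, a j) ⬝ᵥ (e / w) : ℝ) * Complex.I)
          ∂(expLaw d) := by
  have hcd := continuous_div_const w
  have hindep : IndepFun (linComb Y t a) E P' :=
    h.indep.comp (φ := fun y : (Fin k → ℝ) → Fin d → ℝ => ∑ j, a j ⬝ᵥ y (t j)) (ψ := id)
      (Finset.measurable_fun_sum _ fun j _ => by
        simp only [dotProduct]
        fun_prop) measurable_id
  set f : ℝ → ℂ := fun x => Complex.exp (((1 : ℝ) : ℂ) * x * Complex.I) with hf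
  set g : (Fin d → ℝ) → ℂ := fun e => Complex.exp
    ((-∑ j, a j ⬝ᵥ (V (t j) *ᵥ w) + (∑ j, a j) ⬝ᵥ (e / w) : ℝ) * Complex.I) with hg
  have hgc : Continuous g := by
    rw [hg]
    fun_prop
  have hfc : Continuous f := by
    rw [hf]
    fun_prop
  have e1 : ∀ ω, Complex.exp ((∑ j, a j ⬝ᵥ limitField V w Y E (t j) ω : ℝ) * Complex.I)
      = f (linComb Y t a ω) * g (E ω) := fun ω => by
    simp only [hf, hg]
    rw [← Complex.exp_add, ← add_mul]
    congr 2
    norm_cast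
    simp only [linComb, limitField, dotProduct_sub, dotProduct_add, Finset.sum_add_distrib,
      Finset.sum_sub_distrib, sum_dotProduct]
    ring
  simp_rw [e1]
  have hL := h.grf.hasGaussianLaw_linComb t a
  rw [hindep.integral_fun_comp_mul_comp hL.aemeasurable h.aemeasurable_exp
    hfc.aestronglyMeasurable hgc.aestronglyMeasurable]
  have e2 := integral_cexp_of_gaussian hL (h.grf.integral_linComb t a)
    (h.grf.integral_linComb_sq t a) 1
  congr 1
  · simp only [hf]
    rw [e2]
    simp_rw [h.cov]
    norm_num
  · rw [← h.map_exp, integral_map h.aemeasurable_exp hgc.aestronglyMeasurable]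

lemma expMeasure_singleton (x : ℝ) : expMeasure 1 {x} = 0 :=
  (withDensity_absolutelyContinuous volume (gammaPDF 1 1)) (by simp)

/-- For a given value of `Y` a single value of `E i` yields 0, and the exponential law has no atoms.
This makes the boundary of the orthant null in the portmanteau theorem. -/
lemma IsLimitPair.ae_limitField_ne_zero (h : IsLimitPair V Y E P') {w : Fin d → ℝ}
    (hw : ∀ i, 0 < w i) (t : Fin k → ℝ) (i : Fin d) :
    ∀ᵐ ω ∂P', limitField V w Y E t ω i ≠ 0 := by
  have hP := h.isProbabilityMeasure
  have hYm : AEMeasurable (fun ω => Y t ω i) P' :=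
    (measurable_pi_apply i).comp_aemeasurable (h.grf.gaussian.aemeasurable t)
  have hindep : IndepFun (fun ω => Y t ω i) (fun ω => E ω i) P' :=
    h.indep.comp (φ := fun y : (Fin k → ℝ) → Fin d → ℝ => y t i)
      (ψ := fun e : Fin d → ℝ => e i)
      ((measurable_pi_apply i).comp (measurable_pi_apply t)) (measurable_pi_apply i)
  have hmap := (indepFun_iff_map_prod_eq_prod_map_map hYm (h.exp_law i).aemeasurable).1 hindep
  rw [(h.exp_law i).map_eq] at hmap
  have := isProbabilityMeasure_expMeasure one_pos
  have hms : MeasurableSet {p : ℝ × ℝ | p.1 - (V t *ᵥ w) i + p.2 / w i ≠ 0} := by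
    have : Measurable fun p : ℝ × ℝ => p.1 - (V t *ᵥ w) i + p.2 / w i := by fun_prop
    exact this (measurableSet_singleton 0).compl
  have h1 : ∀ᵐ p ∂(P'.map fun ω => (Y t ω i, E ω i)), p.1 - (V t *ᵥ w) i + p.2 / w i ≠ 0 := by
    rw [hmap]
    refine (Measure.ae_prod_iff_ae_ae hms).2 (Eventually.of_forall fun y => ?_)
    refine compl_mem_ae_iff.2 (measure_mono_null (t := {((V t *ᵥ w) i - y) * w i}) ?_
      (expMeasure_singleton _))
    intro e he
    have he' : y - (V t *ᵥ w) i + e / w i = 0 := he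
    have := (hw i).ne'
    have h2 : e / w i = (V t *ᵥ w) i - y := by linarith
    rw [Set.mem_singleton_iff, ← h2]
    field_simp
  exact ae_of_ae_map (hYm.prodMk (h.exp_law i).aemeasurable) h1

end LimitPair

/-! ### Simultaneous exceedances at finitely many points -/

section FiniteDimensional

variable {Ω : Type*} [MeasurableSpace Ω] {P : Measure Ω} {k d : ℕ}
  {X : (Fin k → ℝ) → Ω → (Fin d → ℝ)} {b w : Fin d → ℝ}
  {α : Fin k → ℝ} {l : Fin k → ℝ → ℝ} {V : (Fin k → ℝ) → Matrix (Fin d) (Fin d) ℝ}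
  {Ω' : Type*} [MeasurableSpace Ω'] {P' : Measure Ω'}
  {Y : (Fin k → ℝ) → Ω' → (Fin d → ℝ)} {E : Ω' → (Fin d → ℝ)}
  {ι : Type*} [Fintype ι]

lemma inner_prod_eq_sum (x a : EuclideanSpace ℝ (ι × Fin d)) :
    inner ℝ x a = ∑ j, (fun i => a (j, i)) ⬝ᵥ fun i => x (j, i) := by
  simp [PiLp.inner_apply, dotProduct, Fintype.sum_prod_type]

/-- Conditionally on an exceedance at the origin, the probability of simultaneous exceedances
at rescaled points converges. -/
lemma tendsto_cond_exceedance (hX : IsCenteredGRF X P) (hstat : IsStationary X P)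
    (hdet : IsUnit (covMatrix X P 0 0).det) (hw : w = (covMatrix X P 0 0)⁻¹ *ᵥ b)
    (hwpos : ∀ i, 0 < w i) (h : LocalExpansion (stationaryCov X P) w α l V)
    (hYE : IsLimitPair V Y E P') {u : ℕ → ℝ} (hu0 : ∀ n, 0 < u n) (hu : Tendsto u atTop atTop)
    (t : ι → Fin k → ℝ) :
    Tendsto (fun n => P[|tailEvent X b (u n)]
        {ω | ∀ j i, u n * b i < X (t j / scaling α l (u n)) ω i}) atTop
      (𝓝 (P' {ω | ∀ j i, 0 < limitField V w Y E (t j) ω i})) := by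
  have hP := hX.gaussian.isProbabilityMeasure
  have hP' := hYE.isProbabilityMeasure
  have hpos : ∀ n, 0 < P.real (tailEvent X b (u n)) := fun n =>
    hX.tailEvent_pos hdet hw hwpos (hu0 n)
  have hne : ∀ n, P (tailEvent X b (u n)) ≠ 0 := fun n h0 => by
    have := hpos n
    simp [Measure.real, h0] at this
  have hprob : ∀ n, IsProbabilityMeasure (P[|tailEvent X b (u n)]) := fun n =>
    cond_isProbabilityMeasure (hne n)
  -- Points and components are flattened into one Euclidean space, so that Lévy's continuity theorem
  -- treats all of them at once.
  set ξ : ℕ → Ω → EuclideanSpace ℝ (ι × Fin d) := fun n ω => WithLp.toLp 2 fun p =>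
    (u n • (X (t p.1 / scaling α l (u n)) ω - u n • b)) p.2 with hξ
  set η : Ω' → EuclideanSpace ℝ (ι × Fin d) := fun ω => WithLp.toLp 2 fun p =>
    limitField V w Y E (t p.1) ω p.2 with hη
  have hξm : ∀ n, AEMeasurable (ξ n) (P[|tailEvent X b (u n)]) := fun n => by
    have h1 : AEMeasurable (ξ n) P := by
      refine (WithLp.measurable_toLp 2 _).comp_aemeasurable (aemeasurable_pi_lambda _ fun p => ?_)
      have := hX.gaussian.aemeasurable (t p.1 / scaling α l (u n))
      have hm : Measurable fun x : Fin d → ℝ => (u n • (x - u n • b)) p.2 := by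
        simp only [Pi.smul_apply, Pi.sub_apply]
        fun_prop
      exact hm.comp_aemeasurable this
    exact h1.mono_ac (cond_absolutelyContinuous)
  have hηm : AEMeasurable η P' := by
    refine (WithLp.measurable_toLp 2 _).comp_aemeasurable (aemeasurable_pi_lambda _ fun p => ?_)
    exact (measurable_pi_apply p.2).comp_aemeasurable (hYE.aemeasurable_limitField w (t p.1))
  set μ : ℕ → ProbabilityMeasure (EuclideanSpace ℝ (ι × Fin d)) := fun n =>
    ⟨(P[|tailEvent X b (u n)]).map (ξ n), Measure.isProbabilityMeasure_map (hξm n)⟩ with hμ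
  set ν : ProbabilityMeasure (EuclideanSpace ℝ (ι × Fin d)) :=
    ⟨P'.map η, Measure.isProbabilityMeasure_map hηm⟩ with hν
  have hconv : Tendsto μ atTop (𝓝 ν) := by
    rw [ProbabilityMeasure.tendsto_iff_tendsto_charFun]
    intro a
    have h1 := (tendsto_tailEvent_charFun hX hstat hdet hw hwpos h t
      (fun j i => a (j, i))).comp hu
    rw [← hYE.integral_cexp w t] at h1
    have e1 : charFun (ν : Measure (EuclideanSpace ℝ (ι × Fin d))) a
        = ∫ ω, Complex.exp ((∑ j, (fun i => a (j, i)) ⬝ᵥ limitField V w Y E (t j) ω : ℝ)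
          * Complex.I) ∂P' := by
      rw [hν, ProbabilityMeasure.coe_mk, charFun_apply, integral_map hηm (by fun_prop)]
      refine integral_congr_ae (Eventually.of_forall fun ω => ?_)
      simp only [inner_prod_eq_sum, hη]
    rw [e1]
    refine h1.congr fun n => ?_
    rw [hμ, ProbabilityMeasure.coe_mk, charFun_apply, integral_map (hξm n) (by fun_prop),
      ProbabilityTheory.cond, integral_smul_measure]
    simp only [Function.comp, inner_prod_eq_sum, hξ]
    rw [ENNReal.toReal_inv, ← Measure.real, Complex.real_smul, Complex.ofReal_inv, mul_comm,
      div_eq_mul_inv]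
  set G : Set (EuclideanSpace ℝ (ι × Fin d)) := {x | ∀ p, 0 < x p} with hG
  have hGo : IsOpen G := by
    rw [hG, Set.ofPred_forall]
    exact isOpen_iInter_of_finite fun p => isOpen_lt continuous_const (by fun_prop)
  have hcl : closure G ⊆ {x | ∀ p, 0 ≤ x p} := by
    refine closure_minimal (fun x hx p => (hx p).le) ?_
    rw [Set.ofPred_forall]
    exact isClosed_iInter fun p => isClosed_le continuous_const (by fun_prop)
  -- The closure of the open orthant lies in the closed one, so a boundary point has a vanishing
  -- coordinate.
  have hfr : (ν : Measure (EuclideanSpace ℝ (ι × Fin d))) (frontier G) = 0 := by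
    rw [hν, ProbabilityMeasure.coe_mk, Measure.map_apply_of_aemeasurable hηm
      isClosed_frontier.measurableSet]
    have hae : ∀ᵐ ω ∂P', ∀ p : ι × Fin d, limitField V w Y E (t p.1) ω p.2 ≠ 0 :=
      ae_all_iff.2 fun p => hYE.ae_limitField_ne_zero hwpos (t p.1) p.2
    refine measure_mono_null ?_ hae
    intro ω hω hcon
    have h1 : η ω ∈ frontier G := hω
    rw [hGo.frontier_eq] at h1
    refine h1.2 fun p => lt_of_le_of_ne (hcl h1.1 p) ?_
    exact (hcon p).symm
  have hfinal := ProbabilityMeasure.tendsto_measure_of_null_frontier_of_tendsto' hconv hfr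
  have e1 : (ν : Measure (EuclideanSpace ℝ (ι × Fin d))) G
      = P' {ω | ∀ j i, 0 < limitField V w Y E (t j) ω i} := by
    rw [hν, ProbabilityMeasure.coe_mk, Measure.map_apply_of_aemeasurable hηm hGo.measurableSet]
    congr 1
    ext ω
    simp [hG, hη]
  rw [e1] at hfinal
  refine hfinal.congr fun n => ?_
  rw [hμ, ProbabilityMeasure.coe_mk, Measure.map_apply_of_aemeasurable (hξm n) hGo.measurableSet]
  congr 1
  ext ω
  simp only [hG, hξ, Set.mem_preimage, Set.mem_ofPred_eq, Prod.forall, Pi.smul_apply, Pi.sub_apply,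
    smul_eq_mul, mul_pos_iff_of_pos_left (hu0 n), sub_pos]

end FiniteDimensional

/-! ### Exponential bound for a second exceedance -/

section Chernoff

lemma integrable_exp_half_expMeasure : Integrable (fun x => Real.exp (x / 2)) (expMeasure 1) := by
  have h1 : expMeasure 1 = volume.withDensity fun x => ENNReal.ofReal (exponentialPDFReal 1 x) := rfl
  rw [h1, integrable_withDensity_iff_integrable_smul₀'
    (measurable_exponentialPDFReal 1).ennreal_ofReal.aemeasurable
    (Eventually.of_forall fun _ => ENNReal.ofReal_lt_top)]
  refine ((integrable_exponentialPDFReal (r := 1 / 2) (by norm_num)).const_mul 2).congr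
    (Eventually.of_forall fun x => ?_)
  simp only [smul_eq_mul]
  rw [ENNReal.toReal_ofReal (exponentialPDFReal_nonneg one_pos x)]
  simp only [exponentialPDFReal, gammaPDFReal]
  split_ifs with hx
  · simp only [Real.rpow_one, Real.Gamma_one, sub_self, Real.rpow_zero]
    rw [div_one, div_one, mul_one, mul_one, one_mul, ← Real.exp_add, ← mul_assoc]
    norm_num
    ring
  · simp

lemma integrable_exp_half_sum_expLaw (d : ℕ) :
    Integrable (fun e : Fin d → ℝ => Real.exp (∑ i, e i / 2)) (expLaw d) := by
  have := isProbabilityMeasure_expMeasure one_pos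
  simp_rw [Real.exp_sum]
  exact Integrable.fintype_prod (f := fun _ : Fin d => fun x => Real.exp (x / 2))
    fun _ => integrable_exp_half_expMeasure

variable {Ω : Type*} [MeasurableSpace Ω] {P : Measure Ω} {k d : ℕ}
  {X : (Fin k → ℝ) → Ω → (Fin d → ℝ)} {b w : Fin d → ℝ} {u : ℝ}

lemma mulVec_weight_eq (hdet : IsUnit (covMatrix X P 0 0).det)
    (hw : w = (covMatrix X P 0 0)⁻¹ *ᵥ b) : covMatrix X P 0 0 *ᵥ w = b := by
  rw [hw, Matrix.mulVec_mulVec, Matrix.mul_nonsing_inv _ hdet, Matrix.one_mulVec]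

lemma quadDefect_stationaryCov (w : Fin d → ℝ) (t : Fin k → ℝ) :
    quadDefect (stationaryCov X P) w t
      = w ⬝ᵥ (covMatrix X P 0 0 *ᵥ w) - w ⬝ᵥ (covMatrix X P t 0 *ᵥ w) := by
  rw [quadDefect, Matrix.sub_mulVec, dotProduct_sub]
  rfl

lemma regCoeff_level_eq (hdet : IsUnit (covMatrix X P 0 0).det)
    (hw : w = (covMatrix X P 0 0)⁻¹ *ᵥ b) (t : Fin k → ℝ) :
    regCoeff X P (fun _ : Unit => t) (fun _ => w) ⬝ᵥ b
      = w ⬝ᵥ b - quadDefect (stationaryCov X P) w t := by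
  rw [regCoeff_dotProduct_level hw, quadDefect_stationaryCov, mulVec_weight_eq hdet hw]
  simp

/-- With `Σ = R(0)`, `c` the regression coefficient and `q` the defect, the residual variance is
`wᵀΣw - cᵀΣc`, while `cᵀΣw = cᵀb = wᵀb - q`. Expanding `(c - w)ᵀΣ(c - w) ≥ 0` gives `cᵀΣc ≥ wᵀb -
2q`. -/
lemma residual_weight_sq_le (hX : IsCenteredGRF X P) (hstat : IsStationary X P)
    (hdet : IsUnit (covMatrix X P 0 0).det) (hw : w = (covMatrix X P 0 0)⁻¹ *ᵥ b)
    (t : Fin k → ℝ) :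
    ∫ ω, residual X P (fun _ : Unit => t) (fun _ => w) ω ^ 2 ∂P
      ≤ 2 * quadDefect (stationaryCov X P) w t := by
  rw [hX.integral_residual_sq hdet]
  have h1 := regCoeff_level_eq hdet hw t
  set c := regCoeff X P (fun _ : Unit => t) (fun _ => w) with hc
  have h2 := (hX.covMatrix_posSemidef 0).dotProduct_mulVec_nonneg (c - w)
  have hb := mulVec_weight_eq hdet hw
  have hsymm : w ⬝ᵥ (covMatrix X P 0 0 *ᵥ c) = c ⬝ᵥ b := by
    rw [Matrix.dotProduct_mulVec, ← Matrix.mulVec_transpose, covMatrix_transpose, hb,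
      dotProduct_comm]
  rw [star_trivial, Matrix.mulVec_sub, hb, sub_dotProduct, dotProduct_sub, dotProduct_sub, hsymm,
    h1] at h2
  have h3 : covMatrix X P t t = covMatrix X P 0 0 := by
    rw [hstat.covMatrix_eq, sub_self]
    rfl
  simp only [Finset.univ_unique, Finset.sum_const, Finset.card_singleton, one_smul, h3, hb]
  linarith

lemma quadDefect_nonneg (hX : IsCenteredGRF X P) (hstat : IsStationary X P)
    (hdet : IsUnit (covMatrix X P 0 0).det) (hw : w = (covMatrix X P 0 0)⁻¹ *ᵥ b)
    (t : Fin k → ℝ) : 0 ≤ quadDefect (stationaryCov X P) w t := by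
  have h1 := residual_weight_sq_le hX hstat hdet hw t
  have h2 : 0 ≤ ∫ ω, residual X P (fun _ : Unit => t) (fun _ => w) ω ^ 2 ∂P :=
    integral_nonneg fun _ => sq_nonneg _
  linarith

lemma continuous_regCoeff (hstat : IsStationary X P) (hR : Continuous (stationaryCov X P))
    (w : Fin d → ℝ) :
    Continuous fun t : Fin k → ℝ => regCoeff X P (fun _ : Unit => t) (fun _ => w) := by
  simp only [regCoeff, Finset.univ_unique, Finset.sum_const, Finset.card_singleton, one_smul,
    hstat.covMatrix_eq 0]
  have : Continuous fun t : Fin k → ℝ => stationaryCov X P (0 - t) := by fun_prop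
  exact Continuous.matrix_mulVec continuous_const (this.matrix_mulVec continuous_const)

/-- The joint probability of exceedances at `0` and `t` before normalization. -/
lemma real_tailEvent_inter_le (hX : IsCenteredGRF X P) (hstat : IsStationary X P)
    (hdet : IsUnit (covMatrix X P 0 0).det) (hw : w = (covMatrix X P 0 0)⁻¹ *ᵥ b)
    (hwpos : ∀ i, 0 < w i) (hu : 0 < u) {r : ℝ} (hr : 0 < r) (hr2 : r ≤ 1 / 2) (t : Fin k → ℝ)
    (hc : ∀ i, r * regCoeff X P (fun _ : Unit => t) (fun _ => w) i ≤ w i / 2) :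
    P.real (tailEvent X b u ∩ {ω | ∀ i, u * b i < X t ω i}) *
        ∫ e, tailWeight (covMatrix X P 0 0) w u e ∂(expLaw d) ≤
      (∫ e, Real.exp (∑ i, e i / 2) ∂(expLaw d)) *
        Real.exp (-(r / 2 * (u ^ 2 * quadDefect (stationaryCov X P) w t)))
        * P.real (tailEvent X b u) := by
  have hP := hX.gaussian.isProbabilityMeasure
  obtain ⟨C, hC, hmass, hint, -⟩ := hX.exists_tail_repr hdet hw hwpos hu
  have hlev := regCoeff_level_eq hdet hw t
  have hvar := residual_weight_sq_le hX hstat hdet hw t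
  have hq := quadDefect_nonneg hX hstat hdet hw t
  set c := regCoeff X P (fun _ : Unit => t) (fun _ => w) with hcdef
  set N := residual X P (fun _ : Unit => t) (fun _ => w) with hN
  set q := quadDefect (stationaryCov X P) w t with hqdef
  set s := w ⬝ᵥ b with hs
  have hpair := hX.hasGaussianLaw_residual_pair (fun _ : Unit => t) (fun _ => w)
  -- Exponential Markov inequality in the direction `w`: if `X(t) > u b`, then `wᵀ X(t) ≥ u wᵀ b` as
  -- `w > 0`. The regression part of the exponent is `-r u² q` plus at most `∑ e i / 2`; the
  -- residual adds at most `r² u² q ≤ r u² q / 2`. The net decay is `exp(-r u² q / 2)`.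
  set F : Ω → ℝ := (tailEvent X b u).indicator fun ω => Real.exp (r * u * (w ⬝ᵥ X t ω - u * s))
    with hF
  have hTm := nullMeasurableSet_tailEvent hX b u
  have hFint : Integrable F P := by
    refine Integrable.indicator₀ ?_ hTm
    have := integrable_exp_of_gaussian (hX.hasGaussianLaw_linComb (fun _ : Unit => t) fun _ => w)
      (r * u)
    refine (this.const_mul (Real.exp (-(r * u * (u * s))))).congr (Eventually.of_forall fun ω => ?_)
    simp only [← dotProduct_eq_linComb]
    rw [← Real.exp_add]
    congr 1
    ring
  have hAm : NullMeasurableSet (tailEvent X b u ∩ {ω | ∀ i, u * b i < X t ω i}) P :=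
    hTm.inter ((hX.gaussian.aemeasurable t).nullMeasurable (measurableSet_level b u))
  have h1 : P.real (tailEvent X b u ∩ {ω | ∀ i, u * b i < X t ω i}) ≤ ∫ ω, F ω ∂P := by
    have h0 : ∫ ω, (tailEvent X b u ∩ {ω | ∀ i, u * b i < X t ω i}).indicator
        (fun _ => (1 : ℝ)) ω ∂P = P.real (tailEvent X b u ∩ {ω | ∀ i, u * b i < X t ω i}) := by
      rw [integral_indicator₀ hAm]
      simp
    rw [← h0]
    refine integral_mono ((integrable_const (1 : ℝ)).indicator₀ hAm) hFint fun ω => ?_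
    rw [hF]
    by_cases hω : ω ∈ tailEvent X b u ∩ {ω | ∀ i, u * b i < X t ω i}
    · rw [Set.indicator_of_mem hω, Set.indicator_of_mem hω.1]
      refine Real.one_le_exp (mul_nonneg (by positivity) ?_)
      rw [hs, ← smul_eq_mul, ← dotProduct_smul, ← dotProduct_sub]
      refine Finset.sum_nonneg fun i _ => mul_nonneg (hwpos i).le ?_
      simpa using (hω.2 i).le
    · rw [Set.indicator_of_notMem hω]
      exact Set.indicator_nonneg (fun _ _ => (Real.exp_pos _).le) _
  set f : (Fin d → ℝ) → ℝ := {x | ∀ i, u * b i < x i}.indicator fun x =>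
    Real.exp (r * u * (c ⬝ᵥ x - u * s)) with hf
  have hfm : Measurable f := by
    refine Measurable.indicator ?_ (measurableSet_level b u)
    have : Continuous fun x : Fin d → ℝ => Real.exp (r * u * (c ⬝ᵥ x - u * s)) := by fun_prop
    exact this.measurable
  have h2 : ∫ ω, F ω ∂P = (∫ ω, f (X 0 ω) ∂P) * ∫ ω, Real.exp (r * u * N ω) ∂P := by
    rw [← (hX.indepFun_residual hdet (fun _ : Unit => t) fun _ => w).integral_fun_comp_mul_comp
      (g := fun x => Real.exp (r * u * x)) hpair.fst.aemeasurable hpair.snd.aemeasurable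
      hfm.aestronglyMeasurable (by fun_prop)]
    refine integral_congr_ae (Eventually.of_forall fun ω => ?_)
    simp only [hF, hf]
    by_cases hω : ω ∈ tailEvent X b u
    · rw [Set.indicator_of_mem hω, Set.indicator_of_mem (show X 0 ω ∈ _ from hω), ← Real.exp_add]
      congr 1
      rw [dotProduct_eq_linComb, residual]
      ring
    · rw [Set.indicator_of_notMem hω, Set.indicator_of_notMem (show X 0 ω ∉ _ from hω), zero_mul]
  have h3 := integral_exp_of_gaussian hpair.snd (hX.integral_residual _ _) rfl (r * u)
  have h4 : ∫ ω, f (X 0 ω) ∂P = C * ∫ e, tailWeight (covMatrix X P 0 0) w u e *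
      Real.exp (r * u * (c ⬝ᵥ tailPoint b w u e - u * s)) ∂(expLaw d) := by
    rw [← hint (fun x => Real.exp (r * u * (c ⬝ᵥ x - u * s))) (by
      have : Continuous fun x : Fin d → ℝ => Real.exp (r * u * (c ⬝ᵥ x - u * s)) := by fun_prop
      exact this.measurable), ← integral_indicator₀ hTm]
    rfl
  set M := ∫ e, Real.exp (∑ i, e i / 2) ∂(expLaw d) with hM
  have hMint := integrable_exp_half_sum_expLaw d
  have h5 : ∫ e, tailWeight (covMatrix X P 0 0) w u e *
      Real.exp (r * u * (c ⬝ᵥ tailPoint b w u e - u * s)) ∂(expLaw d)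
      ≤ Real.exp (-(r * u ^ 2 * q)) * M := by
    rw [hM, ← integral_const_mul]
    refine integral_mono_of_nonneg (Eventually.of_forall fun e => ?_) (hMint.const_mul _) ?_
    · exact mul_nonneg (tailWeight_pos _ _ _ _).le (Real.exp_pos _).le
    filter_upwards [expLaw_pos d] with e he
    refine (mul_le_of_le_one_left (Real.exp_pos _).le
      (tailWeight_le_one (hX.covMatrix_posSemidef 0) w u e)).trans ?_
    rw [← Real.exp_add, Real.exp_le_exp]
    have e1 : c ⬝ᵥ tailPoint b w u e = u * (s - q) + u⁻¹ * ∑ i, c i * (e i / w i) := by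
      rw [← hlev]
      simp only [dotProduct, tailPoint, mul_add, Finset.sum_add_distrib, Finset.mul_sum]
      congr 1 <;> exact Finset.sum_congr rfl fun i _ => by ring
    have e2 : r * u * (c ⬝ᵥ tailPoint b w u e - u * s)
        = -(r * u ^ 2 * q) + ∑ i, r * c i * (e i / w i) := by
      rw [e1]
      simp_rw [mul_assoc r, ← Finset.mul_sum]
      field_simp
      ring
    rw [e2]
    refine add_le_add le_rfl (Finset.sum_le_sum fun i _ => ?_)
    calc r * c i * (e i / w i) ≤ w i / 2 * (e i / w i) :=
          mul_le_mul_of_nonneg_right (hc i) (div_nonneg (he i).le (hwpos i).le)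
      _ = e i / 2 := by
          have := (hwpos i).ne'
          field_simp
  have h6 : Real.exp ((r * u) ^ 2 * (∫ ω, N ω ^ 2 ∂P) / 2) ≤ Real.exp (r / 2 * (u ^ 2 * q)) := by
    rw [Real.exp_le_exp]
    have : (r * u) ^ 2 * (∫ ω, N ω ^ 2 ∂P) ≤ (r * u) ^ 2 * (2 * q) :=
      mul_le_mul_of_nonneg_left hvar (by positivity)
    have h7 : r * (r * (u ^ 2 * q)) ≤ 1 / 2 * (r * (u ^ 2 * q)) :=
      mul_le_mul_of_nonneg_right hr2 (by positivity)
    nlinarith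
  have h8 : ∫ ω, F ω ∂P ≤ C * M * Real.exp (-(r / 2 * (u ^ 2 * q))) := by
    rw [h2, h3, h4]
    have hM0 : 0 ≤ M := integral_nonneg fun _ => (Real.exp_pos _).le
    calc _ ≤ (C * (Real.exp (-(r * u ^ 2 * q)) * M)) * Real.exp (r / 2 * (u ^ 2 * q)) :=
          mul_le_mul (mul_le_mul_of_nonneg_left h5 hC.le) h6 (Real.exp_pos _).le (by positivity)
      _ = C * M * (Real.exp (-(r * u ^ 2 * q)) * Real.exp (r / 2 * (u ^ 2 * q))) := by ring
      _ = _ := by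
          rw [← Real.exp_add]
          congr 2
          ring
  have hI := integral_tailWeight_pos (hX.covMatrix_posSemidef 0) w u
  rw [hmass]
  calc _ ≤ (C * M * Real.exp (-(r / 2 * (u ^ 2 * q)))) *
        ∫ e, tailWeight (covMatrix X P 0 0) w u e ∂(expLaw d) :=
        mul_le_mul_of_nonneg_right (h1.trans h8) hI.le
    _ = _ := by ring

/-- Conditionally on an exceedance at the origin, an exceedance at `t` has a probability that
decays exponentially in the rescaled quadratic form. -/
lemma exists_cond_exceedance_le (hX : IsCenteredGRF X P) (hstat : IsStationary X P)
    (hdet : IsUnit (covMatrix X P 0 0).det) (hw : w = (covMatrix X P 0 0)⁻¹ *ᵥ b)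
    (hwpos : ∀ i, 0 < w i) (hR : Continuous (stationaryCov X P)) (T : ℝ) :
    ∃ r C u₀ : ℝ, 0 < r ∧ 0 < C ∧ 0 < u₀ ∧ ∀ u, u₀ ≤ u → ∀ t : Fin k → ℝ, (∀ i, |t i| ≤ T) →
      (P[|tailEvent X b u]).real {ω | ∀ i, u * b i < X t ω i}
        ≤ C * Real.exp (-(r * (u ^ 2 * quadDefect (stationaryCov X P) w t))) := by
  have hP := hX.gaussian.isProbabilityMeasure
  have hS := hX.covMatrix_posSemidef 0
  have hcomp : IsCompact {t : Fin k → ℝ | ∀ i, |t i| ≤ T} := by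
    have : {t : Fin k → ℝ | ∀ i, |t i| ≤ T} = Set.Icc (fun _ => -T) (fun _ => T) := by
      ext t
      simp [Pi.le_def, abs_le, forall_and]
    rw [this]
    exact isCompact_Icc
  obtain ⟨K, hK⟩ := hcomp.exists_bound_of_continuousOn (continuous_regCoeff hstat hR w).continuousOn
  obtain ⟨m, hm, hmw⟩ : ∃ m : ℝ, 0 < m ∧ ∀ i, m ≤ w i := by
    rcases isEmpty_or_nonempty (Fin d) with hd | hd
    · exact ⟨1, one_pos, fun i => hd.elim i⟩
    · obtain ⟨j, hj⟩ := Finite.exists_min w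
      exact ⟨w j, hwpos j, hj⟩
  obtain ⟨u₀, hu₀⟩ := ((tendsto_integral_tailWeight hS w).eventually
    (lt_mem_nhds (show (1 / 2 : ℝ) < 1 by norm_num))).exists_forall_of_atTop
  set M := ∫ e, Real.exp (∑ i, e i / 2) ∂(expLaw d) with hM
  have hM0 : 0 ≤ M := integral_nonneg fun _ => (Real.exp_pos _).le
  set K' := |K| + 1 with hK'
  have hK'0 : 0 < K' := by positivity
  -- The bound needs `r c i ≤ w i / 2`; on the box the coefficient is at most `K'` and every `w i`
  -- is at least `m`, hence `m / (2 K')`. The factor 2 in the constant pays for dividing by the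
  -- integral of `tailWeight`, which exceeds `1 / 2` for large `u`.
  refine ⟨min (1 / 2) (m / (2 * K')) / 2, 2 * M + 1, max u₀ 1, by positivity, by positivity,
    by positivity, fun u hu t ht => ?_⟩
  have hu0 : 0 < u := lt_of_lt_of_le (by positivity) hu
  set r := min (1 / 2) (m / (2 * K')) with hr
  have hr0 : 0 < r := by positivity
  have h1 := real_tailEvent_inter_le hX hstat hdet hw hwpos hu0 hr0 (min_le_left _ _) t (fun i => by
    have e1 : |regCoeff X P (fun _ : Unit => t) (fun _ => w) i| ≤ K' := by
      refine (norm_le_pi_norm (regCoeff X P (fun _ : Unit => t) (fun _ => w)) i).trans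
        ((hK t ht).trans ?_)
      have := le_abs_self K
      linarith
    calc r * regCoeff X P (fun _ : Unit => t) (fun _ => w) i ≤ r * K' :=
          mul_le_mul_of_nonneg_left (le_of_abs_le e1) hr0.le
      _ ≤ m / (2 * K') * K' := mul_le_mul_of_nonneg_right (min_le_right _ _) hK'0.le
      _ = m / 2 := by field_simp
      _ ≤ w i / 2 := by linarith [hmw i])
  have hI := hu₀ u ((le_max_left _ _).trans hu)
  have hp := hX.tailEvent_pos hdet hw hwpos hu0
  set I := ∫ e, tailWeight (covMatrix X P 0 0) w u e ∂(expLaw d) with hIdef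
  set p := P.real (tailEvent X b u) with hpdef
  set ex := Real.exp (-(r / 2 * (u ^ 2 * quadDefect (stationaryCov X P) w t))) with hex
  have hex0 : 0 < ex := Real.exp_pos _
  set a := P.real (tailEvent X b u ∩ {ω | ∀ i, u * b i < X t ω i}) with ha
  have ha0 : 0 ≤ a := measureReal_nonneg
  have h2 : (P[|tailEvent X b u]).real {ω | ∀ i, u * b i < X t ω i} = a / p := by
    rw [ProbabilityTheory.cond, measureReal_ennreal_smul_apply, ENNReal.toReal_inv,
      Measure.real, Measure.restrict_apply₀' (nullMeasurableSet_tailEvent hX b u), Set.inter_comm,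
      inv_mul_eq_div]
    rfl
  rw [h2, div_le_iff₀ hp]
  have h3 : a * (1 / 2) ≤ M * ex * p := (mul_le_mul_of_nonneg_left hI.le ha0).trans h1
  nlinarith [mul_pos hex0 hp]

end Chernoff

/-! ### Convergence in law of bounded integrals by moments -/

section Moments

variable {Ω : Type*} [MeasurableSpace Ω] {S : Type*} [MeasurableSpace S]

lemma quasiMeasurePreserving_prod_eval {ι : Type*} [Fintype ι] (Q : Measure Ω) [SFinite Q]
    (μ : Measure S) [SigmaFinite μ] (j : ι) :
    Measure.QuasiMeasurePreserving (fun p : Ω × (ι → S) => (p.1, p.2 j))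
      (Q.prod (Measure.pi fun _ => μ)) (Q.prod μ) := by
  have hm : Measurable fun p : Ω × (ι → S) => (p.1, p.2 j) := by fun_prop
  refine ⟨hm, Measure.AbsolutelyContinuous.mk fun s hs h0 => ?_⟩
  rw [Measure.map_apply hm hs, Measure.measure_prod_null (hm hs)]
  filter_upwards [(Measure.measure_prod_null hs).1 h0] with ω hω
  exact (Measure.quasiMeasurePreserving_eval (fun _ : ι => μ) j).preimage_null hω

lemma integrable_prod_eval {ι : Type*} [Fintype ι] (Q : Measure Ω) [IsFiniteMeasure Q]
    (μ : Measure S) [IsFiniteMeasure μ] {g : Ω → S → ℝ}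
    (hg : AEStronglyMeasurable (Function.uncurry g) (Q.prod μ)) (hb : ∀ ω t, |g ω t| ≤ 1) :
    Integrable (fun p : Ω × (ι → S) => ∏ j, g p.1 (p.2 j)) (Q.prod (Measure.pi fun _ => μ)) := by
  refine Integrable.of_bound (C := 1) ?_ (Eventually.of_forall fun p => ?_)
  · refine Finset.aestronglyMeasurable_fun_prod _ fun j _ => ?_
    exact hg.comp_quasiMeasurePreserving (quasiMeasurePreserving_prod_eval Q μ j)
  · rw [Real.norm_eq_abs, Finset.abs_prod]
    exact Finset.prod_le_one (fun _ _ => abs_nonneg _) fun j _ => hb _ _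

/-- A power of an integral is an integral of a product over the product space; Fubini then brings
the expectation inside. -/
lemma integral_pow_integral {ι : Type*} [Fintype ι] (Q : Measure Ω) [IsFiniteMeasure Q]
    (μ : Measure S) [IsFiniteMeasure μ] {g : Ω → S → ℝ}
    (hg : AEStronglyMeasurable (Function.uncurry g) (Q.prod μ)) (hb : ∀ ω t, |g ω t| ≤ 1) :
    ∫ ω, (∫ t, g ω t ∂μ) ^ Fintype.card ι ∂Q
      = ∫ t : ι → S, ∫ ω, ∏ j, g ω (t j) ∂Q ∂(Measure.pi fun _ => μ) := by
  rw [← integral_integral_swap (f := fun ω (t : ι → S) => ∏ j, g ω (t j))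
    (integrable_prod_eval Q μ hg hb)]
  simp_rw [integral_fintype_prod_eq_pow]

lemma abs_integral_le_real {μ : Measure S} [IsFiniteMeasure μ] {g : S → ℝ} (hb : ∀ t, |g t| ≤ 1) :
    |∫ t, g t ∂μ| ≤ μ.real Set.univ := by
  have := norm_integral_le_of_norm_le_const (μ := μ) (f := g) (C := 1) (Eventually.of_forall hb)
  simpa using this

variable {Ω' : Type*} [MeasurableSpace Ω'] {μ : Measure S} [IsFiniteMeasure μ]
  {Q : ℕ → Measure Ω} {Q' : Measure Ω'} [∀ n, IsProbabilityMeasure (Q n)] [IsProbabilityMeasure Q']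
  {g : ℕ → Ω → S → ℝ} {g' : Ω' → S → ℝ}

/-- Convergence of all moments of the integrals from convergence of the mixed moments. -/
lemma tendsto_moment (hg : ∀ n, AEStronglyMeasurable (Function.uncurry (g n)) ((Q n).prod μ))
    (hb : ∀ n ω t, |g n ω t| ≤ 1)
    (hg' : AEStronglyMeasurable (Function.uncurry g') (Q'.prod μ)) (hb' : ∀ ω t, |g' ω t| ≤ 1)
    (hlim : ∀ (m : ℕ) (t : Fin m → S), Tendsto (fun n => ∫ ω, ∏ j, g n ω (t j) ∂(Q n)) atTop
      (𝓝 (∫ ω, ∏ j, g' ω (t j) ∂Q'))) (m : ℕ) :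
    Tendsto (fun n => ∫ ω, (∫ t, g n ω t ∂μ) ^ m ∂(Q n)) atTop
      (𝓝 (∫ ω, (∫ t, g' ω t ∂μ) ^ m ∂Q')) := by
  have e1 : ∀ n, ∫ ω, (∫ t, g n ω t ∂μ) ^ m ∂(Q n)
      = ∫ t : Fin m → S, ∫ ω, ∏ j, g n ω (t j) ∂(Q n) ∂(Measure.pi fun _ => μ) := fun n => by
    have := integral_pow_integral (ι := Fin m) (Q n) μ (hg n) (hb n)
    rwa [Fintype.card_fin] at this
  have e2 := integral_pow_integral (ι := Fin m) Q' μ hg' hb'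
  rw [Fintype.card_fin] at e2
  simp_rw [e1]
  rw [e2]
  refine tendsto_integral_of_dominated_convergence (fun _ => 1) (fun n => ?_) (integrable_const _)
    (fun n => Eventually.of_forall fun t => ?_) (Eventually.of_forall fun t => hlim m t)
  · exact (integrable_prod_eval (Q n) μ (hg n) (hb n)).integral_prod_right.aestronglyMeasurable
  · refine (norm_integral_le_of_norm_le_const (C := 1) (Eventually.of_forall fun ω => ?_)).trans ?_
    · rw [Real.norm_eq_abs, Finset.abs_prod]
      exact Finset.prod_le_one (fun _ _ => abs_nonneg _) fun j _ => hb _ _ _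
    · simp

lemma aemeasurable_integral_slice {Q : Measure Ω} [SFinite Q] {μ : Measure S} [SFinite μ]
    {g : Ω → S → ℝ}
    (hg : AEStronglyMeasurable (Function.uncurry g) (Q.prod μ)) :
    AEMeasurable (fun ω => ∫ t, g ω t ∂μ) Q :=
  hg.integral_prod_right'.aemeasurable

/-- Weak convergence of the integrals from convergence of the mixed moments. -/
lemma tendsto_law_integral
    (hg : ∀ n, AEStronglyMeasurable (Function.uncurry (g n)) ((Q n).prod μ))
    (hb : ∀ n ω t, |g n ω t| ≤ 1)
    (hg' : AEStronglyMeasurable (Function.uncurry g') (Q'.prod μ)) (hb' : ∀ ω t, |g' ω t| ≤ 1)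
    (hlim : ∀ (m : ℕ) (t : Fin m → S), Tendsto (fun n => ∫ ω, ∏ j, g n ω (t j) ∂(Q n)) atTop
      (𝓝 (∫ ω, ∏ j, g' ω (t j) ∂Q'))) (f : ℝ → ℝ) (hf : Continuous f) :
    Tendsto (fun n => ∫ ω, f (∫ t, g n ω t ∂μ) ∂(Q n)) atTop
      (𝓝 (∫ ω, f (∫ t, g' ω t ∂μ) ∂Q')) := by
  -- All the integrals lie in `[-M, M]`, so uniform approximation by polynomials on this interval
  -- passes from moments to continuous test functions.
  set M := μ.real Set.univ with hM
  have hint : ∀ {Ω₁ : Type _} [MeasurableSpace Ω₁] (Q₁ : Measure Ω₁) [IsProbabilityMeasure Q₁]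
      (D : Ω₁ → ℝ), AEMeasurable D Q₁ → (∀ ω, |D ω| ≤ M) → ∀ F : ℝ → ℝ, Continuous F →
      Integrable (fun ω => F (D ω)) Q₁ := by
    intro Ω₁ _ Q₁ _ D hD hDM F hF
    obtain ⟨C, hC⟩ := (isCompact_Icc (a := -M) (b := M)).exists_bound_of_continuousOn
      hF.continuousOn
    exact Integrable.of_bound (hF.measurable.comp_aemeasurable hD).aestronglyMeasurable C
      (Eventually.of_forall fun ω => hC _ (abs_le.1 (hDM ω)))
  have hint' : ∀ F : ℝ → ℝ, Continuous F → Integrable (fun ω => F (∫ t, g' ω t ∂μ)) Q' := by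
    intro F hF
    obtain ⟨C, hC⟩ := (isCompact_Icc (a := -M) (b := M)).exists_bound_of_continuousOn
      hF.continuousOn
    exact Integrable.of_bound
      (hF.measurable.comp_aemeasurable (aemeasurable_integral_slice hg')).aestronglyMeasurable C
      (Eventually.of_forall fun ω => hC _ (abs_le.1 (abs_integral_le_real (hb' ω))))
  have hintn : ∀ n, ∀ F : ℝ → ℝ, Continuous F →
      Integrable (fun ω => F (∫ t, g n ω t ∂μ)) (Q n) := fun n F hF =>
    hint (Q n) _ (aemeasurable_integral_slice (hg n)) (fun ω => abs_integral_le_real (hb n ω)) F hF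
  have hpoly : ∀ p : Polynomial ℝ, Tendsto (fun n => ∫ ω, p.eval (∫ t, g n ω t ∂μ) ∂(Q n)) atTop
      (𝓝 (∫ ω, p.eval (∫ t, g' ω t ∂μ) ∂Q')) := by
    intro p
    simp_rw [Polynomial.eval_eq_sum_range]
    rw [integral_finsetSum _ fun i _ => hint' (fun x => p.coeff i * x ^ i) (by fun_prop)]
    have : ∀ n, ∫ ω, ∑ i ∈ Finset.range (p.natDegree + 1), p.coeff i * (∫ t, g n ω t ∂μ) ^ i ∂(Q n)
        = ∑ i ∈ Finset.range (p.natDegree + 1),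
          ∫ ω, p.coeff i * (∫ t, g n ω t ∂μ) ^ i ∂(Q n) := fun n =>
      integral_finsetSum _ fun i _ => hintn n (fun x => p.coeff i * x ^ i) (by fun_prop)
    simp_rw [this, integral_const_mul]
    exact tendsto_finsetSum _ fun i _ => (tendsto_moment hg hb hg' hb' hlim i).const_mul _
  rw [Metric.tendsto_atTop]
  intro ε hε
  obtain ⟨p, hp⟩ := exists_polynomial_near_of_continuousOn (-M) M f hf.continuousOn (ε / 4)
    (by positivity)
  obtain ⟨n₀, hn₀⟩ := Metric.tendsto_atTop.1 (hpoly p) (ε / 4) (by positivity)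
  refine ⟨n₀, fun n hn => ?_⟩
  have h1 := hn₀ n hn
  have h2 : |∫ ω, p.eval (∫ t, g n ω t ∂μ) ∂(Q n) - ∫ ω, f (∫ t, g n ω t ∂μ) ∂(Q n)| ≤ ε / 4 := by
    rw [← integral_sub (hintn n _ p.continuous) (hintn n f hf)]
    rw [← Real.norm_eq_abs]
    refine (norm_integral_le_of_norm_le_const (C := ε / 4) (Eventually.of_forall fun ω => ?_)).trans
      ?_
    · exact (hp _ (abs_le.1 (abs_integral_le_real (hb n ω)))).le
    · simp
  have h3 : |∫ ω, p.eval (∫ t, g' ω t ∂μ) ∂Q' - ∫ ω, f (∫ t, g' ω t ∂μ) ∂Q'| ≤ ε / 4 := by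
    rw [← integral_sub (hint' _ p.continuous) (hint' f hf)]
    rw [← Real.norm_eq_abs]
    refine (norm_integral_le_of_norm_le_const (C := ε / 4) (Eventually.of_forall fun ω => ?_)).trans
      ?_
    · exact (hp _ (abs_le.1 (abs_integral_le_real (hb' ω)))).le
    · simp
  rw [Real.dist_eq, abs_lt] at *
  rw [abs_le] at h2 h3
  constructor <;> linarith [h1.1, h1.2, h2.1, h2.2, h3.1, h3.2]

/-- One-sided bounds for the distribution functions in a limit theorem for bounded integrals. -/
lemma eventually_real_le_of_moments
    (hg : ∀ n, AEStronglyMeasurable (Function.uncurry (g n)) ((Q n).prod μ))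
    (hb : ∀ n ω t, |g n ω t| ≤ 1)
    (hg' : AEStronglyMeasurable (Function.uncurry g') (Q'.prod μ)) (hb' : ∀ ω t, |g' ω t| ≤ 1)
    (hlim : ∀ (m : ℕ) (t : Fin m → S), Tendsto (fun n => ∫ ω, ∏ j, g n ω (t j) ∂(Q n)) atTop
      (𝓝 (∫ ω, ∏ j, g' ω (t j) ∂Q'))) (x : ℝ) {ε : ℝ} (hε : 0 < ε) :
    (∀ᶠ n in atTop, (Q n).real {ω | ∫ t, g n ω t ∂μ ≤ x}
        ≤ Q'.real {ω | ∫ t, g' ω t ∂μ ≤ x} + ε) ∧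
      ∀ᶠ n in atTop, Q'.real {ω | ∫ t, g' ω t ∂μ < x} - ε
        ≤ (Q n).real {ω | ∫ t, g n ω t ∂μ < x} := by
  have hDn := fun n => aemeasurable_integral_slice (hg n)
  have hD' := aemeasurable_integral_slice hg'
  set ν : ℕ → ProbabilityMeasure ℝ := fun n =>
    ⟨(Q n).map fun ω => ∫ t, g n ω t ∂μ, Measure.isProbabilityMeasure_map (hDn n)⟩ with hν
  set ν' : ProbabilityMeasure ℝ :=
    ⟨Q'.map fun ω => ∫ t, g' ω t ∂μ, Measure.isProbabilityMeasure_map hD'⟩ with hν'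
  have hconv : Tendsto ν atTop (𝓝 ν') := by
    rw [ProbabilityMeasure.tendsto_iff_forall_integral_tendsto]
    intro f
    have h1 := tendsto_law_integral hg hb hg' hb' hlim f f.continuous
    simp only [hν, hν', ProbabilityMeasure.coe_mk]
    rw [integral_map hD' f.continuous.aestronglyMeasurable]
    refine h1.congr fun n => ?_
    rw [integral_map (hDn n) f.continuous.aestronglyMeasurable]
  have hval : ∀ s : Set ℝ, MeasurableSet s → ∀ n, (ν n : Measure ℝ) s
      = ENNReal.ofReal ((Q n).real {ω | ∫ t, g n ω t ∂μ ∈ s}) := fun s hs n => by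
    rw [hν, ProbabilityMeasure.coe_mk, Measure.map_apply_of_aemeasurable (hDn n) hs,
      ofReal_measureReal]
    rfl
  have hval' : ∀ s : Set ℝ, MeasurableSet s → (ν' : Measure ℝ) s
      = ENNReal.ofReal (Q'.real {ω | ∫ t, g' ω t ∂μ ∈ s}) := fun s hs => by
    rw [hν', ProbabilityMeasure.coe_mk, Measure.map_apply_of_aemeasurable hD' hs,
      ofReal_measureReal]
    rfl
  constructor
  · have h1 := ProbabilityMeasure.limsup_measure_closed_le_of_tendsto hconv (isClosed_Iic (a := x))
    simp_rw [hval _ measurableSet_Iic, hval' _ measurableSet_Iic] at h1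
    have h2 := eventually_lt_of_limsup_lt (h1.trans_lt ((ENNReal.ofReal_lt_ofReal_iff
      (by positivity)).2 (lt_add_of_pos_right (Q'.real {ω | ∫ t, g' ω t ∂μ ∈ Set.Iic x}) hε)))
    filter_upwards [h2] with n hn
    exact ((ENNReal.ofReal_lt_ofReal_iff (by positivity)).1 hn).le
  · have h1 := ProbabilityMeasure.le_liminf_measure_open_of_tendsto hconv (isOpen_Iio (a := x))
    simp_rw [hval _ measurableSet_Iio, hval' _ measurableSet_Iio] at h1
    -- A nonpositive lower bound is trivial; excluding it makes `ENNReal.ofReal` strictly monotone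
    -- where it is used.
    by_cases hc : Q'.real {ω | ∫ t, g' ω t ∂μ < x} - ε ≤ 0
    · exact Eventually.of_forall fun n => hc.trans measureReal_nonneg
    have hc' : 0 < Q'.real {ω | ∫ t, g' ω t ∂μ < x} := by linarith
    have h2 := eventually_lt_of_lt_liminf (((ENNReal.ofReal_lt_ofReal_iff hc').2
      (sub_lt_self _ hε)).trans_le h1)
    filter_upwards [h2] with n hn
    exact ((ENNReal.ofReal_lt_ofReal_iff_of_nonneg (not_le.1 hc).le).1 hn).le

end Moments

/-! ### Recovering a path from its dyadic values -/

section Dyadic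

variable {k d : ℕ}

/-- The point of the dyadic lattice of order `n` with integer coordinates `z`. -/
noncomputable def dyadicPoint (p : ℕ × (Fin k → ℤ)) : Fin k → ℝ := fun i => p.2 i / 2 ^ p.1

/-- The coordinates of the dyadic lattice point of order `n` next to `t`. -/
noncomputable def dyadicFloor (n : ℕ) (t : Fin k → ℝ) : Fin k → ℤ := fun i => ⌊2 ^ n * t i⌋

lemma measurable_dyadicFloor (n : ℕ) : Measurable (dyadicFloor n : (Fin k → ℝ) → Fin k → ℤ) := by
  unfold dyadicFloor
  fun_prop

lemma tendsto_dyadicPoint (t : Fin k → ℝ) :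
    Tendsto (fun n => dyadicPoint (n, dyadicFloor n t)) atTop (𝓝 t) := by
  rw [tendsto_pi_nhds]
  intro i
  have h1 : Tendsto (fun n : ℕ => ((2 : ℝ) ^ n)) atTop atTop :=
    tendsto_pow_atTop_atTop_of_one_lt (by norm_num)
  have h2 := (tendsto_nat_floor_mul_div_atTop (R := ℝ) (a := 0) le_rfl)
  have h3 : Tendsto (fun n : ℕ => t i - 1 / 2 ^ n) atTop (𝓝 (t i)) := by
    simpa using tendsto_const_nhds.sub (h1.inv_tendsto_atTop)
  refine tendsto_of_tendsto_of_tendsto_of_le_of_le h3 tendsto_const_nhds (fun n => ?_) fun n => ?_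
  · have : (0 : ℝ) < 2 ^ n := by positivity
    simp only [dyadicPoint, dyadicFloor]
    rw [le_div_iff₀ this, sub_mul, one_div, inv_mul_cancel₀ this.ne', mul_comm]
    exact (Int.sub_one_lt_floor _).le
  · have : (0 : ℝ) < 2 ^ n := by positivity
    simp only [dyadicPoint, dyadicFloor]
    rw [div_le_iff₀ this, mul_comm]
    exact Int.floor_le _

/-- The path with prescribed values near dyadic points. -/
noncomputable def pathOf (y : ℕ × (Fin k → ℤ) → Fin d → ℝ) (t : Fin k → ℝ) : Fin d → ℝ :=
  fun i => limsup (fun n => y (n, dyadicFloor n t) i) atTop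

/-- The dyadic floor takes countably many values, so reconstruction from countably many coordinates
is jointly measurable in data and time. Joint measurability of the limit field, whose paths are
continuous only almost surely, is obtained through this map. -/
lemma measurable_pathOf : Measurable fun p : (ℕ × (Fin k → ℤ) → Fin d → ℝ) × (Fin k → ℝ) =>
    pathOf p.1 p.2 := by
  refine measurable_pi_lambda _ fun i => Measurable.limsup fun n => ?_
  have h1 : Measurable fun q : (ℕ × (Fin k → ℤ) → Fin d → ℝ) × (Fin k → ℤ) => q.1 (n, q.2) i :=
    measurable_from_prod_countable_left fun z =>
      (measurable_pi_apply i).comp (measurable_pi_apply (n, z))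
  exact h1.comp (measurable_fst.prodMk ((measurable_dyadicFloor n).comp measurable_snd))

lemma pathOf_eq_of_tendsto {y : ℕ × (Fin k → ℤ) → Fin d → ℝ} {t : Fin k → ℝ} {x : Fin d → ℝ}
    (h : Tendsto (fun n => y (n, dyadicFloor n t)) atTop (𝓝 x)) : pathOf y t = x := by
  ext i
  exact ((tendsto_pi_nhds.1 h) i).limsup_eq

lemma pathOf_dyadicPoint {f : (Fin k → ℝ) → Fin d → ℝ} (hf : Continuous f) :
    pathOf (fun p => f (dyadicPoint p)) = f := by
  ext1 t
  exact pathOf_eq_of_tendsto ((hf.tendsto t).comp (tendsto_dyadicPoint t))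

end Dyadic

/-! ### Superlevel sets of the drifted path -/

section ExceedSet

variable {k d : ℕ} {V : (Fin k → ℝ) → Matrix (Fin d) (Fin d) ℝ} {w : Fin d → ℝ}

/-- The set of times at which the drifted path, shifted by `e / w`, is positive. -/
def exceedSet (V : (Fin k → ℝ) → Matrix (Fin d) (Fin d) ℝ) (w : Fin d → ℝ)
    (f : (Fin k → ℝ) → Fin d → ℝ) (e : Fin d → ℝ) : Set (Fin k → ℝ) :=
  {t | ∀ i, 0 < f t i - (V t *ᵥ w) i + e i / w i}

lemma isOpen_exceedSet (hV : Continuous V) {f : (Fin k → ℝ) → Fin d → ℝ} (hf : Continuous f)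
    (e : Fin d → ℝ) : IsOpen (exceedSet V w f e) := by
  rw [exceedSet, Set.ofPred_forall]
  have h1 : Continuous fun t => V t *ᵥ w := hV.matrix_mulVec continuous_const
  exact isOpen_iInter_of_finite fun i => isOpen_lt continuous_const
    (((continuous_apply i).comp hf).sub ((continuous_apply i).comp h1) |>.add continuous_const)

/-- Adding `s • w` to `e` raises all components by `s`, so the set is `{m > -s}` for the minimum `m`
of the components. If two levels gave the same finite volume, the open set between them would be
null, hence empty. But `m` exceeds the upper level somewhere since the volume is nonzero, and falls
below the lower one since the volume is finite, so the intermediate value theorem gives a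
contradiction. -/
lemma volume_exceedSet_injective (hk : 0 < k) (hd : Nonempty (Fin d)) (hV : Continuous V)
    (hw : ∀ i, 0 < w i) {f : (Fin k → ℝ) → Fin d → ℝ} (hf : Continuous f) (e : Fin d → ℝ)
    {x : ℝ≥0∞} (hx0 : x ≠ 0) (hx : x ≠ ⊤) :
    {s : ℝ | volume (exceedSet V w f (e + s • w)) = x}.Subsingleton := by
  have : Nonempty (Fin k) := ⟨⟨0, hk⟩⟩
  have : NoncompactSpace (Fin k → ℝ) := NormedSpace.noncompactSpace ℝ _
  set φ : Fin d → (Fin k → ℝ) → ℝ := fun i t => f t i - (V t *ᵥ w) i + e i / w i with hφ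
  have h1 : Continuous fun t => V t *ᵥ w := hV.matrix_mulVec continuous_const
  have hφc : ∀ i, Continuous (φ i) := fun i =>
    ((continuous_apply i).comp hf).sub ((continuous_apply i).comp h1) |>.add continuous_const
  set m : (Fin k → ℝ) → ℝ := fun t => Finset.univ.inf' Finset.univ_nonempty fun i => φ i t with hm
  have hmc : Continuous m := Continuous.finset_inf'_apply _ fun i _ => hφc i
  have hset : ∀ s : ℝ, exceedSet V w f (e + s • w) = {t | -s < m t} := fun s => by
    ext t
    simp only [exceedSet, Set.mem_ofPred_eq, hm, Finset.lt_inf'_iff, Finset.mem_univ, true_imp_iff]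
    refine forall_congr' fun i => ?_
    have : (e + s • w) i / w i = e i / w i + s := by
      have := (hw i).ne'
      simp
      field_simp
    rw [this, hφ]
    constructor <;> intro h <;> linarith
  have key : ∀ s s' : ℝ, s < s' → volume (exceedSet V w f (e + s • w)) = x →
      volume (exceedSet V w f (e + s' • w)) = x → False := by
    intro s s' hss hs hs'
    rw [hset] at hs hs'
    have hms : MeasurableSet {t | -s < m t} := measurableSet_lt measurable_const hmc.measurable
    have hsub : {t | -s < m t} ⊆ {t | -s' < m t} := fun t ht => lt_trans (neg_lt_neg hss) ht
    have hdiff : volume ({t | -s' < m t} \ {t | -s < m t}) = 0 := by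
      rw [measure_sdiff hsub hms.nullMeasurableSet (by rw [hs]; exact hx), hs, hs', tsub_self]
    have hU : IsOpen {t | -s' < m t ∧ m t < -s} :=
      (isOpen_lt continuous_const hmc).inter (isOpen_lt hmc continuous_const)
    have hUsub : {t | -s' < m t ∧ m t < -s} ⊆ {t | -s' < m t} \ {t | -s < m t} := fun t ht =>
      ⟨ht.1, not_lt.2 (le_of_lt ht.2)⟩
    have hUe : {t | -s' < m t ∧ m t < -s} = ∅ :=
      (hU.measure_eq_zero_iff volume).1 (measure_mono_null hUsub hdiff)
    obtain ⟨t₀, ht₀⟩ : {t | -s < m t}.Nonempty := by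
      rw [Set.nonempty_iff_ne_empty]
      intro h0
      rw [h0, measure_empty] at hs
      exact hx0 hs.symm
    obtain ⟨t₁, ht₁⟩ : ∃ t, m t ≤ -s' := by
      by_contra hcon
      push Not at hcon
      have huniv : {t | -s' < m t} = Set.univ := Set.eq_univ_of_forall hcon
      rw [huniv, measure_univ_of_isAddLeftInvariant] at hs'
      exact hx hs'.symm
    obtain ⟨t, ht⟩ := mem_range_of_exists_le_of_exists_ge hmc (c := -(s + s') / 2)
      ⟨t₁, by linarith⟩ ⟨t₀, by have : -s < m t₀ := ht₀; linarith⟩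
    have : t ∈ {t | -s' < m t ∧ m t < -s} := ⟨by linarith, by linarith⟩
    rw [hUe] at this
    exact this
  intro s hs s' hs'
  rcases lt_trichotomy s s' with h | h | h
  · exact (key s s' h hs hs').elim
  · exact h
  · exact (key s' s h hs' hs).elim

lemma measurableSet_exceed (hV : Continuous V) (w : Fin d → ℝ) :
    MeasurableSet {q : ((ℕ × (Fin k → ℤ) → Fin d → ℝ) × (Fin d → ℝ)) × (Fin k → ℝ) |
      q.2 ∈ exceedSet V w (pathOf q.1.1) q.1.2} := by
  have h1 : Continuous fun t => V t *ᵥ w := hV.matrix_mulVec continuous_const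
  simp only [exceedSet, Set.mem_ofPred_eq]
  rw [Set.ofPred_forall]
  refine MeasurableSet.iInter fun i => measurableSet_lt measurable_const ?_
  have h2 : Measurable fun q : ((ℕ × (Fin k → ℤ) → Fin d → ℝ) × (Fin d → ℝ)) × (Fin k → ℝ) =>
      pathOf q.1.1 q.2 i := (measurable_pi_apply i).comp (measurable_pathOf.comp
    ((measurable_fst.comp measurable_fst).prodMk measurable_snd))
  have h3 : Measurable fun q : ((ℕ × (Fin k → ℤ) → Fin d → ℝ) × (Fin d → ℝ)) × (Fin k → ℝ) =>
      (V q.2 *ᵥ w) i := (measurable_pi_apply i).comp (h1.measurable.comp measurable_snd)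
  exact (h2.sub h3).add (by fun_prop)

lemma measurable_volume_exceedSet (hV : Continuous V) (w : Fin d → ℝ) :
    Measurable fun q : (ℕ × (Fin k → ℤ) → Fin d → ℝ) × (Fin d → ℝ) =>
      volume (exceedSet V w (pathOf q.1) q.2) :=
  measurable_measure_prodMk_left (measurableSet_exceed hV w)

/-- Every line in the direction `w` meets the set in at most one point, so the set is Lebesgue null,
and the exponential law is absolutely continuous. -/
lemma expLaw_volume_exceedSet_eq (hk : 0 < k) (hd : Nonempty (Fin d)) (hV : Continuous V)
    (hw : ∀ i, 0 < w i) {y : ℕ × (Fin k → ℤ) → Fin d → ℝ} (hf : Continuous (pathOf y))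
    {x : ℝ≥0∞} (hx0 : x ≠ 0) (hx : x ≠ ⊤) :
    expLaw d {e | volume (exceedSet V w (pathOf y) e) = x} = 0 := by
  refine expLaw_absolutelyContinuous d ?_
  have hm : MeasurableSet {e | volume (exceedSet V w (pathOf y) e) = x} :=
    ((measurable_volume_exceedSet hV w).comp (measurable_const.prodMk measurable_id))
      (measurableSet_singleton x)
  have := ae_mem_of_ae_add_linearMap_mem (𝕜 := ℝ) (LinearMap.toSpanSingleton ℝ (Fin d → ℝ) w)
    volume volume hm.compl (fun e => by
      have h1 := (volume_exceedSet_injective hk hd hV hw hf e hx0 hx).measure_zero volume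
      refine measure_mono_null ?_ h1
      intro s hs
      simpa using hs)
  exact measure_mono_null (fun e he => not_not.2 he) this

end ExceedSet

/-! ### Measurability and atoms of the limiting sojourn time -/

section Limit

variable {Ω' : Type*} [MeasurableSpace Ω'] {P' : Measure Ω'} {k d : ℕ}
  {V : (Fin k → ℝ) → Matrix (Fin d) (Fin d) ℝ} {w : Fin d → ℝ}
  {Y : (Fin k → ℝ) → Ω' → (Fin d → ℝ)} {E : Ω' → (Fin d → ℝ)}

/-- The values of the field at dyadic points, together with the exponential variables. -/
noncomputable def dyadicSample (Y : (Fin k → ℝ) → Ω' → (Fin d → ℝ)) (E : Ω' → (Fin d → ℝ))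
    (ω : Ω') : (ℕ × (Fin k → ℤ) → Fin d → ℝ) × (Fin d → ℝ) :=
  (fun p => Y (dyadicPoint p) ω, E ω)

lemma IsLimitPair.aemeasurable_dyadicSample (h : IsLimitPair V Y E P') :
    AEMeasurable (dyadicSample Y E) P' :=
  (aemeasurable_pi_lambda _ fun p => h.grf.gaussian.aemeasurable (dyadicPoint p)).prodMk
    h.aemeasurable_exp

/-- The product form allows the path to be fixed while only `E` varies. -/
lemma IsLimitPair.map_dyadicSample (h : IsLimitPair V Y E P') :
    P'.map (dyadicSample Y E)
      = (P'.map fun ω (p : ℕ × (Fin k → ℤ)) => Y (dyadicPoint p) ω).prod (expLaw d) := by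
  have := h.isProbabilityMeasure
  have hindep : IndepFun (fun ω (p : ℕ × (Fin k → ℤ)) => Y (dyadicPoint p) ω) E P' :=
    h.indep.comp
      (φ := fun (y : (Fin k → ℝ) → Fin d → ℝ) (p : ℕ × (Fin k → ℤ)) => y (dyadicPoint p))
      (ψ := id) (measurable_pi_lambda _ fun p => measurable_pi_apply _) measurable_id
  rw [← h.map_exp]
  exact (indepFun_iff_map_prod_eq_prod_map_map
    (aemeasurable_pi_lambda _ fun p => h.grf.gaussian.aemeasurable (dyadicPoint p))
    h.aemeasurable_exp).1 hindep

lemma IsLimitPair.ae_pathOf (h : IsLimitPair V Y E P') :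
    ∀ᵐ ω ∂P', pathOf (dyadicSample Y E ω).1 = fun t => Y t ω := by
  filter_upwards [h.continuous_paths] with ω hω
  exact pathOf_dyadicPoint (f := fun t => Y t ω) hω

lemma IsLimitPair.ae_limitSojourn (h : IsLimitPair V Y E P') (hV : Continuous V)
    (w : Fin d → ℝ) : ∀ᵐ ω ∂P', limitSojourn V w Y E ω
      = volume (exceedSet V w (fun t => Y t ω) (E ω)) := by
  filter_upwards [h.continuous_paths] with ω hω
  rw [limitSojourn, ← lintegral_indicator_one (isOpen_exceedSet hV hω (E ω)).measurableSet]
  rfl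

lemma IsLimitPair.ae_limitSojourn_eq (h : IsLimitPair V Y E P') (hV : Continuous V)
    (w : Fin d → ℝ) : limitSojourn V w Y E =ᵐ[P'] fun ω =>
      volume (exceedSet V w (pathOf (dyadicSample Y E ω).1) (dyadicSample Y E ω).2) := by
  filter_upwards [h.ae_limitSojourn hV w, h.ae_pathOf] with ω h1 h2
  rw [h1, h2]
  rfl

lemma IsLimitPair.aemeasurable_limitSojourn (h : IsLimitPair V Y E P') (hV : Continuous V)
    (w : Fin d → ℝ) : AEMeasurable (limitSojourn V w Y E) P' :=
  ((measurable_volume_exceedSet hV w).comp_aemeasurable h.aemeasurable_dyadicSample).congr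
    (h.ae_limitSojourn_eq hV w).symm

/-- The exceedance set of the limit field is jointly measurable. -/
lemma IsLimitPair.nullMeasurableSet_exceed (h : IsLimitPair V Y E P') (hV : Continuous V)
    (w : Fin d → ℝ) (μ : Measure (Fin k → ℝ)) [SFinite μ] :
    NullMeasurableSet {p : Ω' × (Fin k → ℝ) | p.2 ∈ exceedSet V w (fun t => Y t p.1) (E p.1)}
      (P'.prod μ) := by
  have := h.isProbabilityMeasure
  have h1 : AEMeasurable (fun p : Ω' × (Fin k → ℝ) => (dyadicSample Y E p.1, p.2)) (P'.prod μ) :=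
    (h.aemeasurable_dyadicSample.comp_quasiMeasurePreserving
      Measure.quasiMeasurePreserving_fst).prodMk measurable_snd.aemeasurable
  refine (h1.nullMeasurable (measurableSet_exceed hV w)).congr ?_
  filter_upwards [Measure.quasiMeasurePreserving_fst.ae h.ae_pathOf] with p hp
  have : (p ∈ (fun p : Ω' × (Fin k → ℝ) => (dyadicSample Y E p.1, p.2)) ⁻¹'
      {q | q.2 ∈ exceedSet V w (pathOf q.1.1) q.1.2})
      = (p.2 ∈ exceedSet V w (fun t => Y t p.1) (E p.1)) := by
    rw [← hp]
    rfl
  exact this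

/-- The limiting sojourn time has no atoms in `(0, ∞)`. -/
lemma IsLimitPair.measure_limitSojourn_eq (h : IsLimitPair V Y E P') (hk : 0 < k)
    (hd : Nonempty (Fin d)) (hV : Continuous V) (hw : ∀ i, 0 < w i)
    {x : ℝ≥0∞} (hx0 : x ≠ 0) (hx : x ≠ ⊤) : P' {ω | limitSojourn V w Y E ω = x} = 0 := by
  have := h.isProbabilityMeasure
  set B : Set ((ℕ × (Fin k → ℤ) → Fin d → ℝ) × (Fin d → ℝ)) :=
    {q | volume (exceedSet V w (pathOf q.1) q.2) = x} with hB
  have hBm : MeasurableSet B := (measurable_volume_exceedSet hV w) (measurableSet_singleton x)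
  have hYm : AEMeasurable (fun ω (p : ℕ × (Fin k → ℤ)) => Y (dyadicPoint p) ω) P' :=
    aemeasurable_pi_lambda _ fun p => h.grf.gaussian.aemeasurable (dyadicPoint p)
  have h1 : P' {ω | limitSojourn V w Y E ω = x} = P' (dyadicSample Y E ⁻¹' B) := by
    refine measure_congr ?_
    filter_upwards [h.ae_limitSojourn_eq hV w] with ω hω
    have : (limitSojourn V w Y E ω = x) = (dyadicSample Y E ω ∈ B) := by
      rw [hω]
      rfl
    exact this
  rw [h1, ← Measure.map_apply_of_aemeasurable h.aemeasurable_dyadicSample hBm, h.map_dyadicSample,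
    Measure.measure_prod_null hBm]
  have hms : MeasurableSet {y : ℕ × (Fin k → ℤ) → Fin d → ℝ | expLaw d (Prod.mk y ⁻¹' B) = 0} :=
    (measurable_measure_prodMk_left hBm) (measurableSet_singleton 0)
  refine (ae_map_iff hYm hms).2 ?_
  filter_upwards [h.ae_pathOf, h.continuous_paths] with ω h2 h3
  have h4 : Continuous (pathOf fun p : ℕ × (Fin k → ℤ) => Y (dyadicPoint p) ω) := by
    have : pathOf (fun p : ℕ × (Fin k → ℤ) => Y (dyadicPoint p) ω) = fun t => Y t ω := h2
    rw [this]
    exact h3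
  exact expLaw_volume_exceedSet_eq hk hd hV hw h4 hx0 hx

end Limit

/-! ### Rescaling of time -/

section ChangeOfVariables

variable {k : ℕ}

lemma measurable_div_vec (v : Fin k → ℝ) : Measurable fun t : Fin k → ℝ => t / v :=
  measurable_pi_lambda _ fun i => (measurable_pi_apply i).div_const _

lemma map_div_volume {v : Fin k → ℝ} (hv : ∀ i, 0 < v i) :
    (volume : Measure (Fin k → ℝ)).map (fun t => t / v) = ENNReal.ofReal (∏ i, v i) • volume := by
  set D : Fin k → ℝ := fun i => (v i)⁻¹ with hD
  have hprod : 0 < ∏ i, v i := Finset.prod_pos fun i _ => hv i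
  have hdetv : (Matrix.diagonal D).det = (∏ i, v i)⁻¹ := by
    rw [Matrix.det_diagonal, hD, Finset.prod_inv_distrib]
  have hdet : (Matrix.diagonal D).det ≠ 0 := by
    rw [hdetv]
    exact (inv_pos.2 hprod).ne'
  have h1 := Real.smul_map_diagonal_volume_pi hdet
  have h2 : (fun t : Fin k → ℝ => t / v) = Matrix.toLin' (Matrix.diagonal D) := by
    ext t i
    simp [hD, Matrix.mulVec_diagonal, div_eq_inv_mul]
  rw [h2]
  rw [hdetv, abs_of_pos (inv_pos.2 hprod)] at h1
  nth_rewrite 2 [← h1]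
  rw [smul_smul, ← ENNReal.ofReal_mul hprod.le, mul_inv_cancel₀ hprod.ne', ENNReal.ofReal_one,
    one_smul]

/-- The componentwise division by a positive vector. -/
noncomputable def divEquiv {v : Fin k → ℝ} (hv : ∀ i, 0 < v i) : (Fin k → ℝ) ≃ᵐ (Fin k → ℝ) where
  toFun t := t / v
  invFun t := t * v
  left_inv t := by
    ext i
    have := (hv i).ne'
    simp [this]
  right_inv t := by
    ext i
    have := (hv i).ne'
    simp [this]
  measurable_toFun := measurable_div_vec v
  measurable_invFun := measurable_id.mul_const v

/-- Division by `v` is a measurable equivalence, so `F` need not be measurable; this matters because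
the formula is applied to every path. -/
lemma integral_comp_div {v : Fin k → ℝ} (hv : ∀ i, 0 < v i) (F : (Fin k → ℝ) → ℝ) :
    ∫ t, F (t / v) = (∏ i, v i) * ∫ t, F t := by
  have h1 := integral_map_equiv (μ := volume) (divEquiv hv) F
  have h2 : (volume : Measure (Fin k → ℝ)).map (divEquiv hv) = _ := map_div_volume hv
  rw [h2, integral_smul_measure, ENNReal.toReal_ofReal (Finset.prod_pos fun i _ => hv i).le,
    smul_eq_mul] at h1
  exact h1.symm

lemma quasiMeasurePreserving_prod_div {Ω : Type*} [MeasurableSpace Ω] (P : Measure Ω) [SFinite P]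
    {v : Fin k → ℝ} (hv : ∀ i, 0 < v i) :
    Measure.QuasiMeasurePreserving (fun p : Ω × (Fin k → ℝ) => (p.1, p.2 / v))
      (P.prod volume) (P.prod volume) := by
  refine ⟨measurable_fst.prodMk ((measurable_div_vec v).comp measurable_snd), ?_⟩
  have h1 := Measure.map_prod_map P (volume : Measure (Fin k → ℝ)) measurable_id
    (measurable_div_vec v)
  rw [Measure.map_id, map_div_volume hv] at h1
  have h2 : (fun p : Ω × (Fin k → ℝ) => (p.1, p.2 / v)) = Prod.map id fun t => t / v := rfl
  rw [h2, ← h1]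
  exact Measure.AbsolutelyContinuous.rfl.prod Measure.smul_absolutelyContinuous

/-- Polar coordinates reduce this to a one-dimensional integral of a power times a stretched
exponential. -/
lemma integrable_exp_neg_norm_rpow (hk : 0 < k) {a δ : ℝ} (ha : 0 < a) (hδ : 0 < δ) :
    Integrable fun s : Fin k → ℝ => Real.exp (-(a * ‖s‖ ^ δ)) := by
  have : Nonempty (Fin k) := ⟨⟨0, hk⟩⟩
  have h1 := integrable_fun_norm_addHaar (volume : Measure (Fin k → ℝ))
    (f := fun y => Real.exp (-(a * y ^ δ)))
  rw [h1]
  have h2 := integrableOn_rpow_mul_exp_neg_mul_rpow (s := ((Module.finrank ℝ (Fin k → ℝ) - 1 : ℕ) : ℝ))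
    (p := δ) (b := a) (by
      have : (0 : ℝ) ≤ ((Module.finrank ℝ (Fin k → ℝ) - 1 : ℕ) : ℝ) := by positivity
      linarith) hδ ha
  refine h2.congr_fun (fun y _ => ?_) measurableSet_Ioi
  simp only [Real.rpow_natCast, smul_eq_mul]
  ring_nf

lemma tendsto_setIntegral_norm_gt {f : (Fin k → ℝ) → ℝ} (hf : Integrable f) :
    Tendsto (fun N : ℕ => ∫ s in {s : Fin k → ℝ | (N : ℝ) < ‖s‖}, f s) atTop (𝓝 0) := by
  have h1 := tendsto_setIntegral_of_antitone (μ := volume) (f := f)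
    (s := fun N : ℕ => {s : Fin k → ℝ | (N : ℝ) < ‖s‖})
    (fun N => measurableSet_lt measurable_const measurable_norm)
    (fun N M hNM s (hs : (M : ℝ) < ‖s‖) =>
      show (N : ℝ) < ‖s‖ from lt_of_le_of_lt (Nat.cast_le.2 hNM) hs) ⟨0, hf.integrableOn⟩
  have h2 : ⋂ N : ℕ, {s : Fin k → ℝ | (N : ℝ) < ‖s‖} = ∅ := by
    refine Set.eq_empty_of_forall_notMem fun s hs => ?_
    obtain ⟨N, hN⟩ := exists_nat_ge ‖s‖
    have h3 : (N : ℝ) < ‖s‖ := Set.mem_iInter.1 hs N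
    linarith
  rw [h2] at h1
  simpa using h1

end ChangeOfVariables

/-! ### The exceedance indicator -/

section LevelIndicator

variable {Ω : Type*} [MeasurableSpace Ω] {P : Measure Ω} {k d : ℕ}
  {X : (Fin k → ℝ) → Ω → (Fin d → ℝ)} {b : Fin d → ℝ} {u : ℝ}

/-- The indicator function of the set of times at which the path exceeds the level `u b`. -/
noncomputable def levelInd (X : (Fin k → ℝ) → Ω → (Fin d → ℝ)) (b : Fin d → ℝ) (u : ℝ) (ω : Ω)
    (t : Fin k → ℝ) : ℝ :=
  {t : Fin k → ℝ | ∀ i, u * b i < X t ω i}.indicator (fun _ => (1 : ℝ)) t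

omit [MeasurableSpace Ω] in
lemma levelInd_nonneg (ω : Ω) (t : Fin k → ℝ) : 0 ≤ levelInd X b u ω t :=
  Set.indicator_nonneg (fun _ _ => zero_le_one) _

omit [MeasurableSpace Ω] in
lemma levelInd_le_one (ω : Ω) (t : Fin k → ℝ) : levelInd X b u ω t ≤ 1 :=
  Set.indicator_le_self' (fun _ _ => zero_le_one) _

omit [MeasurableSpace Ω] in
lemma abs_levelInd_le_one (ω : Ω) (t : Fin k → ℝ) : |levelInd X b u ω t| ≤ 1 := by
  rw [abs_of_nonneg (levelInd_nonneg ω t)]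
  exact levelInd_le_one ω t

omit [MeasurableSpace Ω] in
lemma levelInd_eq_indicator (t : Fin k → ℝ) : (fun ω => levelInd X b u ω t)
    = {ω | ∀ i, u * b i < X t ω i}.indicator fun _ => (1 : ℝ) := by
  ext ω
  simp only [levelInd, Set.indicator, Set.mem_ofPred_eq]

lemma aestronglyMeasurable_levelInd
    (hmeas : AEMeasurable (fun p : Ω × (Fin k → ℝ) => X p.2 p.1) (P.prod volume)) (b : Fin d → ℝ)
    (u : ℝ) : AEStronglyMeasurable (Function.uncurry (levelInd X b u)) (P.prod volume) := by
  have h1 : AEMeasurable (fun p : Ω × (Fin k → ℝ) =>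
      {x : Fin d → ℝ | ∀ i, u * b i < x i}.indicator (fun _ => (1 : ℝ)) (X p.2 p.1))
      (P.prod volume) :=
    (measurable_const.indicator (measurableSet_level b u)).comp_aemeasurable hmeas
  exact h1.aestronglyMeasurable

lemma aestronglyMeasurable_levelInd_scaled [SFinite P]
    (hmeas : AEMeasurable (fun p : Ω × (Fin k → ℝ) => X p.2 p.1) (P.prod volume)) (b : Fin d → ℝ)
    (u : ℝ) {v : Fin k → ℝ} (hv : ∀ i, 0 < v i) :
    AEStronglyMeasurable (Function.uncurry fun ω t => levelInd X b u ω (t / v))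
      (P.prod volume) :=
  (aestronglyMeasurable_levelInd hmeas b u).comp_quasiMeasurePreserving
    (quasiMeasurePreserving_prod_div P hv)

end LevelIndicator

/-! ### The limiting sojourn time through bounded windows -/

section Window

variable {Ω' : Type*} [MeasurableSpace Ω'] {P' : Measure Ω'} {k d : ℕ}
  {V : (Fin k → ℝ) → Matrix (Fin d) (Fin d) ℝ} {w : Fin d → ℝ}
  {Y : (Fin k → ℝ) → Ω' → (Fin d → ℝ)} {E : Ω' → (Fin d → ℝ)}

/-- The box `[-N, N]ᵏ`. -/
def window (k N : ℕ) : Set (Fin k → ℝ) := {t | ‖t‖ ≤ N}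

lemma measurableSet_window (k N : ℕ) : MeasurableSet (window k N) :=
  measurableSet_le measurable_norm measurable_const

lemma volume_window_lt_top (k N : ℕ) : volume (window k N) < ⊤ := by
  have : window k N = Metric.closedBall 0 N := by
    ext t
    simp [window]
  rw [this]
  exact measure_closedBall_lt_top

instance (k N : ℕ) : IsFiniteMeasure ((volume : Measure (Fin k → ℝ)).restrict (window k N)) :=
  isFiniteMeasure_restrict.2 (volume_window_lt_top k N).ne

lemma monotone_window (k : ℕ) : Monotone (window k) := fun N M hNM t (ht : ‖t‖ ≤ N) =>
  show ‖t‖ ≤ (M : ℝ) from ht.trans (Nat.cast_le.2 hNM)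

lemma iUnion_window (k : ℕ) : ⋃ N, window k N = Set.univ :=
  Set.eq_univ_of_forall fun t => Set.mem_iUnion.2 (exists_nat_ge ‖t‖)

/-- The indicator of the exceedance set of the limit field. -/
noncomputable def limitInd (V : (Fin k → ℝ) → Matrix (Fin d) (Fin d) ℝ) (w : Fin d → ℝ)
    (Y : (Fin k → ℝ) → Ω' → (Fin d → ℝ)) (E : Ω' → (Fin d → ℝ)) (ω : Ω') (t : Fin k → ℝ) : ℝ :=
  (exceedSet V w (fun t => Y t ω) (E ω)).indicator (fun _ => (1 : ℝ)) t

omit [MeasurableSpace Ω'] in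
lemma abs_limitInd_le_one (ω : Ω') (t : Fin k → ℝ) : |limitInd V w Y E ω t| ≤ 1 := by
  rw [limitInd, abs_of_nonneg (Set.indicator_nonneg (fun _ _ => zero_le_one) _)]
  exact Set.indicator_le_self' (fun _ _ => zero_le_one) _

lemma IsLimitPair.aestronglyMeasurable_limitInd (h : IsLimitPair V Y E P') (hV : Continuous V)
    (w : Fin d → ℝ) (μ : Measure (Fin k → ℝ)) [SFinite μ] :
    AEStronglyMeasurable (Function.uncurry (limitInd V w Y E)) (P'.prod μ) := by
  have h1 : AEStronglyMeasurable
      ({p : Ω' × (Fin k → ℝ) | p.2 ∈ exceedSet V w (fun t => Y t p.1) (E p.1)}.indicator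
        fun _ => (1 : ℝ)) (P'.prod μ) :=
    aestronglyMeasurable_const.indicator₀ (h.nullMeasurableSet_exceed hV w μ)
  exact h1

lemma IsLimitPair.ae_integral_limitInd (h : IsLimitPair V Y E P') (hV : Continuous V)
    (w : Fin d → ℝ) : ∀ᵐ ω ∂P', ∀ N : ℕ, ∫ t in window k N, limitInd V w Y E ω t
      = (volume (exceedSet V w (fun t => Y t ω) (E ω) ∩ window k N)).toReal := by
  filter_upwards [h.continuous_paths] with ω hω N
  have hm := (isOpen_exceedSet (w := w) hV hω (E ω)).measurableSet
  simp only [limitInd]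
  rw [integral_indicator hm, setIntegral_const, smul_eq_mul, mul_one, measureReal_restrict_apply hm,
    Measure.real]

lemma volume_inter_window_ne_top (A : Set (Fin k → ℝ)) (N : ℕ) : volume (A ∩ window k N) ≠ ⊤ :=
  (lt_of_le_of_lt (measure_mono Set.inter_subset_right) (volume_window_lt_top k N)).ne

/-- The time spent in the windows increases to `J`, so the events decrease to `{J ≤ x}`; the case `J
= ∞` is included. -/
lemma IsLimitPair.tendsto_window (h : IsLimitPair V Y E P') (hV : Continuous V)
    (w : Fin d → ℝ) {x : ℝ} (hx : 0 ≤ x) :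
    Tendsto (fun N : ℕ => P'.real {ω | ∫ t in window k N, limitInd V w Y E ω t ≤ x}) atTop
      (𝓝 (P'.real {ω | limitSojourn V w Y E ω ≤ ENNReal.ofReal x})) := by
  have := h.isProbabilityMeasure
  set K : ℕ → Ω' → ℝ≥0∞ := fun N ω => volume (exceedSet V w (fun t => Y t ω) (E ω) ∩ window k N)
    with hK
  have hae := h.ae_integral_limitInd hV w
  have hKae : ∀ N, (fun ω => ENNReal.ofReal (∫ t in window k N, limitInd V w Y E ω t)) =ᵐ[P'] K N :=
    fun N => by
      filter_upwards [hae] with ω hω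
      rw [hω N, ENNReal.ofReal_toReal (volume_inter_window_ne_top _ _)]
  have hKm : ∀ N, AEMeasurable (K N) P' := fun N =>
    (ENNReal.measurable_ofReal.comp_aemeasurable (aemeasurable_integral_slice
      (h.aestronglyMeasurable_limitInd hV w (volume.restrict (window k N))))).congr (hKae N)
  have h1 := tendsto_measure_iInter_atTop (μ := P')
    (s := fun N : ℕ => {ω | K N ω ≤ ENNReal.ofReal x})
    (fun N => nullMeasurableSet_le (hKm N) aemeasurable_const)
    (fun N M hNM ω (hω : K M ω ≤ _) => show K N ω ≤ _ from
      (measure_mono (Set.inter_subset_inter_right _ (monotone_window k hNM))).trans hω)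
    ⟨0, measure_ne_top _ _⟩
  have h2 : P' (⋂ N : ℕ, {ω | K N ω ≤ ENNReal.ofReal x})
      = P' {ω | limitSojourn V w Y E ω ≤ ENNReal.ofReal x} := by
    refine measure_congr ?_
    filter_upwards [h.ae_limitSojourn hV w] with ω hω
    have h3 : limitSojourn V w Y E ω = ⨆ N, K N ω := by
      rw [hω, hK]
      simp only
      rw [← Monotone.measure_iUnion (fun N M hNM =>
        Set.inter_subset_inter_right _ (monotone_window k hNM)), ← Set.inter_iUnion,
        iUnion_window, Set.inter_univ]
    have h4 : (ω ∈ ⋂ N : ℕ, {ω | K N ω ≤ ENNReal.ofReal x})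
        = (limitSojourn V w Y E ω ≤ ENNReal.ofReal x) := by
      rw [h3]
      simp [iSup_le_iff]
    exact h4
  rw [h2] at h1
  have h5 := (ENNReal.tendsto_toReal (measure_ne_top P' _)).comp h1
  refine h5.congr fun N => ?_
  refine congrArg ENNReal.toReal (measure_congr ?_)
  filter_upwards [hae] with ω hω
  have h6 : (K N ω ≤ ENNReal.ofReal x) = (∫ t in window k N, limitInd V w Y E ω t ≤ x) := by
    rw [hω N, ENNReal.le_ofReal_iff_toReal_le (volume_inter_window_ne_top _ _) hx]
  exact h6

lemma IsLimitPair.real_limitSojourn_lt_le (h : IsLimitPair V Y E P') (hV : Continuous V)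
    (w : Fin d → ℝ) (x : ℝ) (N : ℕ) :
    P'.real {ω | limitSojourn V w Y E ω < ENNReal.ofReal x}
      ≤ P'.real {ω | ∫ t in window k N, limitInd V w Y E ω t < x} := by
  have := h.isProbabilityMeasure
  refine ENNReal.toReal_mono (measure_ne_top _ _) (measure_mono_ae ?_)
  filter_upwards [h.ae_limitSojourn hV w, h.ae_integral_limitInd hV w] with ω h1 h2
    (h3 : limitSojourn V w Y E ω < ENNReal.ofReal x)
  have h4 : volume (exceedSet V w (fun t => Y t ω) (E ω) ∩ window k N) < ENNReal.ofReal x :=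
    (measure_mono Set.inter_subset_left).trans_lt (by rwa [← h1])
  have h5 : ∫ t in window k N, limitInd V w Y E ω t < x := by
    rw [h2 N]
    exact (ENNReal.lt_ofReal_iff_toReal_lt (volume_inter_window_ne_top _ _)).1 h4
  exact h5

/-- The events exhaust `{J < x}`, which differs from `{J ≤ x}` only by the null event `{J = x}`. -/
lemma IsLimitPair.tendsto_real_limitSojourn_lt (h : IsLimitPair V Y E P') (hk : 0 < k)
    (hd : Nonempty (Fin d)) (hV : Continuous V) (hw : ∀ i, 0 < w i) {x : ℝ} (hx : 0 < x) :
    Tendsto (fun m : ℕ => P'.real {ω | limitSojourn V w Y E ω < ENNReal.ofReal (x - x / (m + 1))})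
      atTop (𝓝 (P'.real {ω | limitSojourn V w Y E ω ≤ ENNReal.ofReal x})) := by
  have := h.isProbabilityMeasure
  have hmono : Monotone fun m : ℕ => {ω | limitSojourn V w Y E ω < ENNReal.ofReal (x - x / (m + 1))} := by
    intro m n hmn ω (hω : limitSojourn V w Y E ω < ENNReal.ofReal (x - x / (m + 1)))
    refine lt_of_lt_of_le hω (ENNReal.ofReal_le_ofReal ?_)
    have : x / ((n : ℝ) + 1) ≤ x / (m + 1) := by gcongr
    linarith
  have h1 := tendsto_measure_iUnion_atTop (μ := P') hmono
  have h2 : ⋃ m : ℕ, {ω | limitSojourn V w Y E ω < ENNReal.ofReal (x - x / (m + 1))}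
      = {ω | limitSojourn V w Y E ω < ENNReal.ofReal x} := by
    ext ω
    simp only [Set.mem_iUnion, Set.mem_ofPred_eq]
    constructor
    · rintro ⟨m, hm⟩
      refine lt_of_lt_of_le hm (ENNReal.ofReal_le_ofReal ?_)
      have : 0 ≤ x / ((m : ℝ) + 1) := by positivity
      linarith
    · intro hω
      have h3 : Tendsto (fun m : ℕ => ENNReal.ofReal (x - x / (m + 1))) atTop
          (𝓝 (ENNReal.ofReal x)) := by
        refine (ENNReal.continuous_ofReal.tendsto x).comp ?_
        have h4 : Tendsto (fun m : ℕ => x * (1 / ((m : ℝ) + 1))) atTop (𝓝 (x * 0)) :=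
          tendsto_one_div_add_atTop_nhds_zero_nat.const_mul x
        have h5 := tendsto_const_nhds (x := x) |>.sub h4
        simpa [div_eq_mul_inv] using h5
      exact (h3.eventually (lt_mem_nhds hω)).exists
  rw [h2] at h1
  have h3 : P' {ω | limitSojourn V w Y E ω < ENNReal.ofReal x}
      = P' {ω | limitSojourn V w Y E ω ≤ ENNReal.ofReal x} := by
    refine measure_congr ?_
    have h0 : ∀ᵐ ω ∂P', limitSojourn V w Y E ω ≠ ENNReal.ofReal x := by
      refine measure_mono_null (fun ω hω => not_not.1 hω)
        (h.measure_limitSojourn_eq hk hd hV hw (x := ENNReal.ofReal x) (by simpa using hx) (by simp))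
    filter_upwards [h0] with ω hω
    have h4 : (limitSojourn V w Y E ω < ENNReal.ofReal x)
        = (limitSojourn V w Y E ω ≤ ENNReal.ofReal x) :=
      propext ⟨le_of_lt, fun hle => lt_of_le_of_ne hle hω⟩
    exact h4
  rw [h3] at h1
  exact (ENNReal.tendsto_toReal (measure_ne_top P' _)).comp h1

end Window

/-! ### The conditional limit theorem -/

section Core

variable {Ω : Type*} [MeasurableSpace Ω] {P : Measure Ω} {k d : ℕ}
  {X : (Fin k → ℝ) → Ω → (Fin d → ℝ)} {b w : Fin d → ℝ}
  {α : Fin k → ℝ} {l : Fin k → ℝ → ℝ} {V : (Fin k → ℝ) → Matrix (Fin d) (Fin d) ℝ}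
  {Ω' : Type*} [MeasurableSpace Ω'] {P' : Measure Ω'}
  {Y : (Fin k → ℝ) → Ω' → (Fin d → ℝ)} {E : Ω' → (Fin d → ℝ)}

omit [MeasurableSpace Ω] in
lemma scaled_sojourn_eq (b : Fin d → ℝ) (u : ℝ) (ω : Ω) {v : Fin k → ℝ} (hv : ∀ i, 0 < v i)
    {W : Set (Fin k → ℝ)} (hW : MeasurableSet W) :
    (∏ i, v i) * ∫ t in W, levelInd X b u ω t
      = ∫ s in {s | s / v ∈ W}, levelInd X b u ω (s / v) := by
  have hU : MeasurableSet {s : Fin k → ℝ | s / v ∈ W} := measurable_div_vec v hW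
  rw [← integral_indicator hW, ← integral_comp_div hv, ← integral_indicator hU]
  rfl

lemma prod_indicator_eq {Ω₁ ι : Type*} [Fintype ι] (A : ι → Set Ω₁) (ω : Ω₁) :
    ∏ j, (A j).indicator (fun _ => (1 : ℝ)) ω
      = {ω | ∀ j, ω ∈ A j}.indicator (fun _ => (1 : ℝ)) ω := by
  classical
  simp only [Set.indicator_apply, Set.mem_ofPred_eq, Finset.prod_boole, Finset.mem_univ,
    true_imp_iff]

lemma integral_prod_indicator {Ω₁ ι : Type*} [MeasurableSpace Ω₁] [Fintype ι] (Q : Measure Ω₁)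
    [IsFiniteMeasure Q]
    (A : ι → Set Ω₁) (hA : ∀ j, NullMeasurableSet (A j) Q) :
    ∫ ω, ∏ j, (A j).indicator (fun _ => (1 : ℝ)) ω ∂Q = Q.real {ω | ∀ j, ω ∈ A j} := by
  have hm : NullMeasurableSet {ω | ∀ j, ω ∈ A j} Q := by
    rw [Set.ofPred_forall]
    exact NullMeasurableSet.iInter hA
  simp_rw [prod_indicator_eq]
  rw [integral_indicator₀ hm]
  simp

/-- A product of exceedance indicators is the indicator of a simultaneous exceedance, so
`tendsto_cond_exceedance` applies. -/
lemma tendsto_mixed_moments (hX : IsCenteredGRF X P) (hstat : IsStationary X P)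
    (hdet : IsUnit (covMatrix X P 0 0).det) (hw : w = (covMatrix X P 0 0)⁻¹ *ᵥ b)
    (hwpos : ∀ i, 0 < w i) (h : LocalExpansion (stationaryCov X P) w α l V)
    (hYE : IsLimitPair V Y E P') {u : ℕ → ℝ} (hu0 : ∀ n, 0 < u n) (hu : Tendsto u atTop atTop)
    (m : ℕ) (t : Fin m → Fin k → ℝ) :
    Tendsto (fun n => ∫ ω, ∏ j, levelInd X b (u n) ω (t j / scaling α l (u n))
      ∂(P[|tailEvent X b (u n)])) atTop (𝓝 (∫ ω, ∏ j, limitInd V w Y E ω (t j) ∂P')) := by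
  have hP := hX.gaussian.isProbabilityMeasure
  have hP' := hYE.isProbabilityMeasure
  have h1 := tendsto_cond_exceedance hX hstat hdet hw hwpos h hYE hu0 hu t
  have h2 := (ENNReal.tendsto_toReal (measure_ne_top P' _)).comp h1
  have e1 : ∫ ω, ∏ j, limitInd V w Y E ω (t j) ∂P'
      = P'.real {ω | ∀ j i, 0 < limitField V w Y E (t j) ω i} := by
    refine integral_prod_indicator P' (fun j => {ω | ∀ i, 0 < limitField V w Y E (t j) ω i}) ?_
    · intro j
      have hm : MeasurableSet {x : Fin d → ℝ | ∀ i, 0 < x i} := by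
        simpa using measurableSet_level (0 : Fin d → ℝ) 0
      exact (hYE.aemeasurable_limitField w (t j)).nullMeasurable hm
  rw [e1]
  refine h2.congr fun n => ?_
  have e2 := integral_prod_indicator (P[|tailEvent X b (u n)])
    (fun j => {ω | ∀ i, u n * b i < X (t j / scaling α l (u n)) ω i}) (fun j =>
      (((hX.gaussian.aemeasurable _).nullMeasurable (measurableSet_level b (u n)))).mono_ac
        cond_absolutelyContinuous)
  exact e2.symm

/-- Expected time spent above the level in a region, by Fubini. -/
lemma integral_sojourn_le {Q : Measure Ω} [SFinite P] [IsProbabilityMeasure Q] (hQ : Q ≪ P)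
    (hmeas : AEMeasurable (fun p : Ω × (Fin k → ℝ) => X p.2 p.1) (P.prod volume)) (b : Fin d → ℝ)
    (u : ℝ) {v : Fin k → ℝ} (hv : ∀ i, 0 < v i)
    (hnull : ∀ s, NullMeasurableSet {ω | ∀ i, u * b i < X s ω i} Q)
    {U : Set (Fin k → ℝ)} (hUm : MeasurableSet U)
    (hU : volume U ≠ ⊤) {ψ : (Fin k → ℝ) → ℝ} (hψ : Integrable ψ)
    (hle : ∀ s ∈ U, Q.real {ω | ∀ i, u * b i < X (s / v) ω i} ≤ ψ s) :
    Integrable (fun ω => ∫ s in U, levelInd X b u ω (s / v)) Q ∧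
      ∫ ω, (∫ s in U, levelInd X b u ω (s / v)) ∂Q ≤ ∫ s in U, ψ s := by
  have : IsFiniteMeasure ((volume : Measure (Fin k → ℝ)).restrict U) :=
    isFiniteMeasure_restrict.2 hU
  have hint : Integrable (Function.uncurry fun ω s => levelInd X b u ω (s / v))
      (Q.prod (volume.restrict U)) := by
    refine Integrable.of_bound ((aestronglyMeasurable_levelInd_scaled hmeas b u hv).mono_ac
      (hQ.prod Measure.restrict_le_self.absolutelyContinuous)) 1
      (Eventually.of_forall fun p => abs_levelInd_le_one _ _)
  refine ⟨hint.integral_prod_left, ?_⟩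
  rw [integral_integral_swap hint]
  refine setIntegral_mono_on hint.integral_prod_right hψ.integrableOn hUm fun s hs => ?_
  refine le_trans (le_of_eq ?_) (hle s hs)
  rw [levelInd_eq_indicator, integral_indicator₀ (hnull _)]
  simp

lemma ae_integrable_levelInd {Q : Measure Ω} [SFinite P] [IsProbabilityMeasure Q] (hQ : Q ≪ P)
    (hmeas : AEMeasurable (fun p : Ω × (Fin k → ℝ) => X p.2 p.1) (P.prod volume)) (b : Fin d → ℝ)
    (u : ℝ) {v : Fin k → ℝ} (hv : ∀ i, 0 < v i) {U : Set (Fin k → ℝ)} (hU : volume U ≠ ⊤) :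
    ∀ᵐ ω ∂Q, IntegrableOn (fun s => levelInd X b u ω (s / v)) U := by
  have : IsFiniteMeasure ((volume : Measure (Fin k → ℝ)).restrict U) :=
    isFiniteMeasure_restrict.2 hU
  have hint : Integrable (Function.uncurry fun ω s => levelInd X b u ω (s / v))
      (Q.prod (volume.restrict U)) := by
    refine Integrable.of_bound ((aestronglyMeasurable_levelInd_scaled hmeas b u hv).mono_ac
      (hQ.prod Measure.restrict_le_self.absolutelyContinuous)) 1
      (Eventually.of_forall fun p => abs_levelInd_le_one _ _)
  exact hint.prod_right_ae

/-- Conditionally on an exceedance at the origin, the rescaled sojourn time in a bounded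
neighbourhood of the origin converges in law. -/
theorem tendsto_cond_sojourn (hX : IsCenteredGRF X P) (hstat : IsStationary X P)
    (hmeas : AEMeasurable (fun p : Ω × (Fin k → ℝ) => X p.2 p.1) (P.prod volume))
    (hdet : IsUnit (covMatrix X P 0 0).det) (hw : w = (covMatrix X P 0 0)⁻¹ *ᵥ b)
    (hwpos : ∀ i, 0 < w i) (hR : Continuous (stationaryCov X P))
    (hpos : ∀ τ, τ ≠ 0 → 0 < quadDefect (stationaryCov X P) w τ)
    (h : LocalExpansion (stationaryCov X P) w α l V) (hYE : IsLimitPair V Y E P')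
    (hk : 0 < k) (hd : Nonempty (Fin d)) {T : ℝ} (hT : 0 < T) {W : Set (Fin k → ℝ)}
    (hWm : MeasurableSet W) (hW0 : W ∈ 𝓝 0) (hWT : ∀ t ∈ W, ∀ i, |t i| ≤ T)
    {u : ℕ → ℝ} (hu0 : ∀ n, 0 < u n) (hu : Tendsto u atTop atTop) {x : ℝ} (hx : 0 < x) :
    Tendsto (fun n => (P[|tailEvent X b (u n)]).real
        {ω | theta α l (u n) * ∫ t in W, levelInd X b (u n) ω t ≤ x}) atTop
      (𝓝 (distFun (limitSojourn V w Y E) P' x)) := by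
  have hP := hX.gaussian.isProbabilityMeasure
  have hP' := hYE.isProbabilityMeasure
  have hV := h.continuous
  have hne : ∀ n, P (tailEvent X b (u n)) ≠ 0 := fun n h0 => by
    have := hX.tailEvent_pos hdet hw hwpos (hu0 n)
    simp [Measure.real, h0] at this
  have hprob : ∀ n, IsProbabilityMeasure (P[|tailEvent X b (u n)]) := fun n =>
    cond_isProbabilityMeasure (hne n)
  have hac : ∀ n, P[|tailEvent X b (u n)] ≪ P := fun n => cond_absolutelyContinuous
  have hv : ∀ n i, 0 < scaling α l (u n) i := fun n i => h.scaling_pos i (hu0 n)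
  set Q : ℕ → Measure Ω := fun n => P[|tailEvent X b (u n)] with hQ
  set U : ℕ → Set (Fin k → ℝ) := fun n => {s | s / scaling α l (u n) ∈ W} with hU
  have hUm : ∀ n, MeasurableSet (U n) := fun n => measurable_div_vec _ hWm
  have hUfin : ∀ n, volume (U n) ≠ ⊤ := fun n => by
    have hsub : U n ⊆ Set.Icc (fun i => -(T * scaling α l (u n) i))
        fun i => T * scaling α l (u n) i := fun s hs => by
      have h1 : ∀ i, |s i| ≤ T * scaling α l (u n) i := fun i => by
        have h2 := hWT _ hs i
        rw [Pi.div_apply, abs_div, abs_of_pos (hv n i), div_le_iff₀ (hv n i)] at h2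
        exact h2
      exact ⟨fun i => (abs_le.1 (h1 i)).1, fun i => (abs_le.1 (h1 i)).2⟩
    exact ((measure_mono hsub).trans_lt isCompact_Icc.measure_lt_top).ne
  have hL : ∀ n ω, theta α l (u n) * ∫ t in W, levelInd X b (u n) ω t
      = ∫ s in U n, levelInd X b (u n) ω (s / scaling α l (u n)) := fun n ω =>
    scaled_sojourn_eq b (u n) ω (hv n) hWm
  simp_rw [hL]
  -- window contained in the rescaled region
  have hwin : ∀ N : ℕ, ∀ᶠ n in atTop, window k N ⊆ U n := fun N => by
    obtain ⟨ε, hε, hball⟩ := Metric.mem_nhds_iff.1 hW0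
    have h1 : ∀ i, ∀ᶠ n in atTop, (N : ℝ) / ε < scaling α l (u n) i := fun i =>
      ((h.tendsto_scaling_atTop i).comp hu).eventually_gt_atTop _
    filter_upwards [eventually_all.2 h1] with n hn s (hs : ‖s‖ ≤ N)
    refine hball ?_
    rw [mem_ball_zero_iff, pi_norm_lt_iff hε]
    intro i
    rw [Pi.div_apply, norm_div, Real.norm_of_nonneg (hv n i).le, div_lt_iff₀ (hv n i)]
    have h2 := (div_lt_iff₀ hε).1 (hn i)
    linarith [norm_le_pi_norm s i, mul_comm ε (scaling α l (u n) i)]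
  -- tails
  obtain ⟨r, C, u₁, hr, hC, hu₁, hcher⟩ := exists_cond_exceedance_le hX hstat hdet hw hwpos hR T
  obtain ⟨c, δ, u₂, hc, hδ, hlow⟩ := h.quadDefect_lower_bound hR hpos hT
  -- The Chernoff bound and the lower bound for the rescaled form together dominate the conditional
  -- exceedance probability at `s / v(u)` for `‖s‖ > 1`, uniformly in large `u`.
  set ψ : (Fin k → ℝ) → ℝ := fun s => C * Real.exp (-(r * c * ‖s‖ ^ δ)) with hψ
  have hψint : Integrable ψ := (integrable_exp_neg_norm_rpow hk (mul_pos hr hc) hδ).const_mul C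
  have hψtail := tendsto_setIntegral_norm_gt hψint
  have htail : ∀ N : ℕ, 1 ≤ N → ∀ᶠ n in atTop,
      Integrable (fun ω => ∫ s in U n \ window k N,
        levelInd X b (u n) ω (s / scaling α l (u n))) (Q n) ∧
      ∫ ω, (∫ s in U n \ window k N, levelInd X b (u n) ω (s / scaling α l (u n))) ∂(Q n)
        ≤ ∫ s in {s : Fin k → ℝ | (N : ℝ) < ‖s‖}, ψ s := fun N hN => by
    filter_upwards [hu.eventually_ge_atTop u₁, hu.eventually_ge_atTop u₂] with n hn1 hn2
    have h1 := integral_sojourn_le (hac n) hmeas b (u n) (hv n)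
      (fun s => ((hX.gaussian.aemeasurable s).nullMeasurable (measurableSet_level b (u n))).mono_ac
        (hac n)) ((hUm n).diff (measurableSet_window k N))
      ((measure_mono Set.sdiff_subset).trans_lt (hUfin n).lt_top).ne hψint (fun s hs => by
        have hs1 : (N : ℝ) < ‖s‖ := not_le.1 hs.2
        have hs2 : scaling α l (u n) * (s / scaling α l (u n)) = s := by
          ext i
          have := (hv n i).ne'
          simp only [Pi.mul_apply, Pi.div_apply]
          field_simp
        have hN' : (1 : ℝ) ≤ N := by exact_mod_cast hN
        have h2 := hlow (u n) hn2 (s / scaling α l (u n)) (hWT _ hs.1) (by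
          rw [hs2]
          linarith)
        rw [hs2] at h2
        refine (hcher (u n) hn1 _ (hWT _ hs.1)).trans ?_
        refine mul_le_mul_of_nonneg_left (Real.exp_le_exp.2 (neg_le_neg ?_)) hC.le
        rw [mul_assoc]
        exact mul_le_mul_of_nonneg_left h2 hr.le)
    refine ⟨h1.1, h1.2.trans ?_⟩
    have hsub : U n \ window k N ≤ {s : Fin k → ℝ | (N : ℝ) < ‖s‖} := fun s hs =>
      show (N : ℝ) < ‖s‖ from not_le.1 hs.2
    exact setIntegral_mono_set hψint.integrableOn
      (Eventually.of_forall fun s => mul_nonneg hC.le (Real.exp_pos _).le)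
      hsub.eventuallyLE
  -- decomposition of the sojourn time
  have hsplit : ∀ N : ℕ, ∀ᶠ n in atTop, ∀ᵐ ω ∂(Q n),
      ∫ s in U n, levelInd X b (u n) ω (s / scaling α l (u n))
        = (∫ s in window k N, levelInd X b (u n) ω (s / scaling α l (u n)))
          + ∫ s in U n \ window k N, levelInd X b (u n) ω (s / scaling α l (u n)) := fun N => by
    filter_upwards [hwin N] with n hn
    filter_upwards [ae_integrable_levelInd (hac n) hmeas b (u n) (hv n) (hUfin n)] with ω hω
    rw [← setIntegral_union Set.disjoint_sdiff_right ((hUm n).diff (measurableSet_window k N))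
      (hω.mono_set hn) (hω.mono_set Set.sdiff_subset), Set.union_sdiff_cancel hn]
  have hmom := fun (N : ℕ) (y ε : ℝ) (hε : 0 < ε) => eventually_real_le_of_moments
    (μ := (volume : Measure (Fin k → ℝ)).restrict (window k N)) (Q := Q) (Q' := P')
    (g := fun n ω t => levelInd X b (u n) ω (t / scaling α l (u n)))
    (g' := limitInd V w Y E)
    (fun n => (aestronglyMeasurable_levelInd_scaled hmeas b (u n) (hv n)).mono_ac
      ((hac n).prod Measure.restrict_le_self.absolutelyContinuous))
    (fun n ω t => abs_levelInd_le_one _ _)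
    (hYE.aestronglyMeasurable_limitInd hV w _) (fun ω t => abs_limitInd_le_one _ _)
    (fun m t => tendsto_mixed_moments hX hstat hdet hw hwpos h hYE hu0 hu m t) y hε
  rw [Metric.tendsto_atTop']
  intro ε hε
  set F := distFun (limitSojourn V w Y E) P' x with hF
  have hlow1 := hYE.tendsto_real_limitSojourn_lt hk hd hV hwpos hx
  -- The shift `η` is fixed first, from the continuity of the limit law at `x`. The window `N` is
  -- chosen afterwards, so that by Markov's inequality the time outside it reaches `η` with
  -- probability below `ε / 4`.
  obtain ⟨m, hm⟩ := (hlow1.eventually (lt_mem_nhds (show F - ε / 4 < F by linarith))).exists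
  set η := x / ((m : ℝ) + 1) with hη
  have hη0 : 0 < η := by positivity
  have hup := hYE.tendsto_window hV w hx.le
  obtain ⟨N, hN1, hN2, hN3⟩ := ((hup.eventually (gt_mem_nhds (show F < F + ε / 4 by linarith))).and
    ((hψtail.eventually (gt_mem_nhds (show 0 < η * (ε / 4) by positivity))).and
      (eventually_ge_atTop 1))).exists
  have hev := ((hmom N x (ε / 4) (by positivity)).1.and
    ((hmom N (x - η) (ε / 4) (by positivity)).2.and
      ((htail N hN3).and (hsplit N))))
  obtain ⟨n₀, hn₀⟩ := hev.exists_forall_of_atTop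
  refine ⟨n₀, fun n hn => ?_⟩
  obtain ⟨h1, h2, ⟨h3, h4⟩, h5⟩ := hn₀ n hn.le
  have hR0 : ∀ ω, 0 ≤ ∫ s in U n \ window k N, levelInd X b (u n) ω (s / scaling α l (u n)) :=
    fun ω => integral_nonneg fun s => levelInd_nonneg _ _
  have hmark := mul_meas_ge_le_integral_of_nonneg (Eventually.of_forall hR0) h3 η
  set A : Set Ω := {ω | ∫ s in U n, levelInd X b (u n) ω (s / scaling α l (u n)) ≤ x} with hA
  have hA1 : (Q n).real A
      ≤ (Q n).real {ω | ∫ s in window k N, levelInd X b (u n) ω (s / scaling α l (u n)) ≤ x} := by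
    refine ENNReal.toReal_mono (measure_ne_top _ _) (measure_mono_ae ?_)
    filter_upwards [h5] with ω hω
      (hωA : ∫ s in U n, levelInd X b (u n) ω (s / scaling α l (u n)) ≤ x)
    have : ∫ s in window k N, levelInd X b (u n) ω (s / scaling α l (u n)) ≤ x := by
      linarith [hR0 ω]
    exact this
  have hA2 : (Q n).real
      {ω | ∫ s in window k N, levelInd X b (u n) ω (s / scaling α l (u n)) < x - η}
      ≤ (Q n).real A + (Q n).real
        {ω | η ≤ ∫ s in U n \ window k N, levelInd X b (u n) ω (s / scaling α l (u n))} := by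
    refine le_trans ?_ (measureReal_union_le _ _)
    refine ENNReal.toReal_mono (measure_ne_top _ _) (measure_mono_ae ?_)
    filter_upwards [h5] with ω hω
      (hω1 : ∫ s in window k N, levelInd X b (u n) ω (s / scaling α l (u n)) < x - η)
    by_cases hc : η ≤ ∫ s in U n \ window k N, levelInd X b (u n) ω (s / scaling α l (u n))
    · exact Or.inr hc
    · refine Or.inl ?_
      have : ∫ s in U n, levelInd X b (u n) ω (s / scaling α l (u n)) ≤ x := by
        push Not at hc
        linarith
      exact this
  have h6 := hYE.real_limitSojourn_lt_le hV w (x - η) N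
  have h7 : (Q n).real
      {ω | η ≤ ∫ s in U n \ window k N, levelInd X b (u n) ω (s / scaling α l (u n))} < ε / 4 := by
    have := (hmark.trans h4).trans_lt hN2
    exact lt_of_mul_lt_mul_left this hη0.le
  rw [Real.dist_eq, abs_lt]
  constructor <;> linarith

end Core

/-! ### Tails from truncated first moments -/

section InverseMoment

lemma integrableOn_inv_sq {x : ℝ} (hx : 0 < x) :
    IntegrableOn (fun z : ℝ => (z ^ 2)⁻¹) (Set.Ioi x) := by
  refine (integrableOn_Ioi_rpow_of_lt (a := -2) (by norm_num) hx).congr_fun (fun z hz => ?_)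
    measurableSet_Ioi
  have hz0 : (0 : ℝ) < z := hx.trans hz
  simp only
  rw [Real.rpow_neg hz0.le]
  norm_num

lemma lintegral_inv_sq {y : ℝ} (hy : 0 < y) :
    ∫⁻ z in Set.Ioi y, ENNReal.ofReal (z ^ 2)⁻¹ = (ENNReal.ofReal y)⁻¹ := by
  rw [← ofReal_integral_eq_lintegral_ofReal (integrableOn_inv_sq hy)
    (Eventually.of_forall fun z => by positivity), ← ENNReal.ofReal_inv_of_pos hy]
  congr 1
  have h1 := integral_Ioi_rpow_of_lt (a := -2) (by norm_num) hy
  rw [show (-2 : ℝ) + 1 = -1 by norm_num, Real.rpow_neg_one, neg_div_neg_eq, div_one] at h1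
  rw [← h1]
  refine setIntegral_congr_fun measurableSet_Ioi fun z hz => ?_
  have hz0 : (0 : ℝ) < z := hy.trans hz
  rw [Real.rpow_neg hz0.le]
  norm_num

/-- This is `1 / a = ∫_a^∞ z⁻² dz`. For `a = ∞` both sides vanish, in accordance with the convention
that mass at infinity does not contribute. -/
lemma lintegral_inv_sq_indicator {x : ℝ} (hx : 0 < x) (a : ℝ≥0∞) :
    ∫⁻ z in Set.Ioi x, ENNReal.ofReal (z ^ 2)⁻¹ *
        (Set.Ioc (ENNReal.ofReal x) (ENNReal.ofReal z)).indicator (fun _ => 1) a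
      = (Set.Ioi (ENNReal.ofReal x)).indicator (fun a => a⁻¹) a := by
  by_cases hxa : ENNReal.ofReal x < a
  · rw [Set.indicator_of_mem (show a ∈ Set.Ioi (ENNReal.ofReal x) from hxa)]
    by_cases ha : a = ⊤
    · subst ha
      simp
    set y := a.toReal with hy
    have hay : a = ENNReal.ofReal y := (ENNReal.ofReal_toReal ha).symm
    have hxy : x < y := by
      rw [hay] at hxa
      exact (ENNReal.ofReal_lt_ofReal_iff_of_nonneg hx.le).1 hxa
    have hy0 : 0 < y := hx.trans hxy
    rw [hay, ← lintegral_inv_sq hy0]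
    have h1 : ∀ z ∈ Set.Ioi x, ENNReal.ofReal (z ^ 2)⁻¹ *
        (Set.Ioc (ENNReal.ofReal x) (ENNReal.ofReal z)).indicator (fun _ => 1) (ENNReal.ofReal y)
        = (Set.Ici y).indicator (fun z => ENNReal.ofReal (z ^ 2)⁻¹) z := fun z hz => by
      have hz0 : (0 : ℝ) < z := hx.trans hz
      by_cases hyz : y ≤ z
      · rw [Set.indicator_of_mem (show z ∈ Set.Ici y from hyz), Set.indicator_of_mem, mul_one]
        exact ⟨by rwa [← hay], ENNReal.ofReal_le_ofReal hyz⟩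
      · rw [Set.indicator_of_notMem (show z ∉ Set.Ici y from hyz), Set.indicator_of_notMem, mul_zero]
        exact fun h => hyz ((ENNReal.ofReal_le_ofReal_iff hz0.le).1 h.2)
    have hinter : Set.Ici y ∩ Set.Ioi x = Set.Ici y :=
      Set.inter_eq_left.2 fun z (hz : y ≤ z) => lt_of_lt_of_le hxy hz
    rw [setLIntegral_congr_fun measurableSet_Ioi h1, lintegral_indicator measurableSet_Ici,
      Measure.restrict_restrict measurableSet_Ici, hinter]
    exact setLIntegral_congr Ioi_ae_eq_Ici.symm
  · rw [Set.indicator_of_notMem (show a ∉ Set.Ioi (ENNReal.ofReal x) from hxa)]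
    have h1 : ∀ z, (Set.Ioc (ENNReal.ofReal x) (ENNReal.ofReal z)).indicator
        (fun _ => (1 : ℝ≥0∞)) a = 0 := fun z => Set.indicator_of_notMem (fun h => hxa h.1) _
    simp [h1]

/-- Truncated inverse moments as integrals of distribution functions. -/
lemma lintegral_inv_eq (ν : Measure ℝ≥0∞) [SFinite ν] {x : ℝ} (hx : 0 < x) :
    ∫⁻ a in Set.Ioi (ENNReal.ofReal x), a⁻¹ ∂ν
      = ∫⁻ z in Set.Ioi x, ENNReal.ofReal (z ^ 2)⁻¹ *
        ν (Set.Ioc (ENNReal.ofReal x) (ENNReal.ofReal z)) := by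
  rw [← lintegral_indicator measurableSet_Ioi]
  simp_rw [← lintegral_inv_sq_indicator hx]
  have hm : Measurable fun p : ℝ≥0∞ × ℝ => ENNReal.ofReal (p.2 ^ 2)⁻¹ *
      (Set.Ioc (ENNReal.ofReal x) (ENNReal.ofReal p.2)).indicator (fun _ => (1 : ℝ≥0∞)) p.1 := by
    refine Measurable.mul (by fun_prop) ?_
    have hs : MeasurableSet {p : ℝ≥0∞ × ℝ | ENNReal.ofReal x < p.1 ∧ p.1 ≤ ENNReal.ofReal p.2} :=
      (measurableSet_lt measurable_const measurable_fst).inter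
        (measurableSet_le measurable_fst (by fun_prop))
    exact measurable_const.indicator hs
  rw [lintegral_lintegral_swap hm.aemeasurable]
  refine lintegral_congr fun z => ?_
  rw [lintegral_const_mul _ (measurable_const.indicator measurableSet_Ioc),
    lintegral_indicator measurableSet_Ioc]
  simp

lemma toReal_lintegral_inv_eq (ν : Measure ℝ≥0∞) [IsFiniteMeasure ν] {x : ℝ} (hx : 0 < x) :
    (∫⁻ a in Set.Ioi (ENNReal.ofReal x), a⁻¹ ∂ν).toReal
      = ∫ z in Set.Ioi x, (z ^ 2)⁻¹ * ν.real (Set.Ioc (ENNReal.ofReal x) (ENNReal.ofReal z)) := by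
  rw [lintegral_inv_eq ν hx, integral_eq_lintegral_of_nonneg_ae
    (Eventually.of_forall fun z => by positivity)]
  · congr 1
    refine lintegral_congr fun z => ?_
    rw [ENNReal.ofReal_mul (by positivity), ofReal_measureReal]
  · have hmono : Monotone fun z : ℝ => ν.real (Set.Ioc (ENNReal.ofReal x) (ENNReal.ofReal z)) :=
      fun z z' hz => measureReal_mono (Set.Ioc_subset_Ioc_right (ENNReal.ofReal_le_ofReal hz))
    have := hmono.measurable
    exact Measurable.aestronglyMeasurable (by fun_prop)

/-- The truncated inverse moment of the measure `y dF(y)` is the mass that `F` gives to `(x, ∞)`. -/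
lemma real_Ioi_eq_integral (F : Measure ℝ) [IsFiniteMeasure F] (hF : Integrable id F)
    {x : ℝ} (hx : 0 < x) :
    F.real (Set.Ioi x) = ∫ z in Set.Ioi x, (z ^ 2)⁻¹ * ∫ y in Set.Ioc x z, y ∂F := by
  have hfin : IsFiniteMeasure (F.withDensity fun y => ENNReal.ofReal y) :=
    isFiniteMeasure_withDensity_ofReal hF.2
  set ν := (F.withDensity fun y => ENNReal.ofReal y).map ENNReal.ofReal with hν
  have hνfin : IsFiniteMeasure ν := inferInstance
  have h1 := toReal_lintegral_inv_eq ν hx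
  have hpre : ENNReal.ofReal ⁻¹' Set.Ioi (ENNReal.ofReal x) = Set.Ioi x := by
    ext y
    simp only [Set.mem_preimage, Set.mem_Ioi]
    exact ENNReal.ofReal_lt_ofReal_iff_of_nonneg hx.le
  have h2 : ∫⁻ a in Set.Ioi (ENNReal.ofReal x), a⁻¹ ∂ν = F (Set.Ioi x) := by
    rw [hν, setLIntegral_map measurableSet_Ioi measurable_inv ENNReal.measurable_ofReal, hpre,
      restrict_withDensity measurableSet_Ioi,
      lintegral_withDensity_eq_lintegral_mul _ ENNReal.measurable_ofReal (by fun_prop)]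
    rw [setLIntegral_congr_fun (g := fun _ => 1) measurableSet_Ioi]
    · simp
    · intro y hy
      have hy0 : 0 < y := hx.trans hy
      exact ENNReal.mul_inv_cancel (ENNReal.ofReal_pos.2 hy0).ne' ENNReal.ofReal_ne_top
  rw [h2] at h1
  rw [Measure.real, h1]
  refine setIntegral_congr_fun measurableSet_Ioi fun z hz => ?_
  have hpre2 : ENNReal.ofReal ⁻¹' Set.Ioc (ENNReal.ofReal x) (ENNReal.ofReal z) = Set.Ioc x z := by
    ext y
    have hz0 : (0 : ℝ) < z := hx.trans hz
    simp only [Set.mem_preimage, Set.mem_Ioc]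
    rw [ENNReal.ofReal_lt_ofReal_iff_of_nonneg hx.le, ENNReal.ofReal_le_ofReal_iff hz0.le]
  have h3 : ν.real (Set.Ioc (ENNReal.ofReal x) (ENNReal.ofReal z)) = ∫ y in Set.Ioc x z, y ∂F := by
    rw [integral_eq_lintegral_of_nonneg_ae ?_ (by fun_prop), Measure.real, hν,
      Measure.map_apply ENNReal.measurable_ofReal measurableSet_Ioc, hpre2,
      withDensity_apply _ measurableSet_Ioc]
    filter_upwards [ae_restrict_mem measurableSet_Ioc] with y hy
    exact (hx.trans hy.1).le
  rw [h3]

/-- Convergence of tails from convergence of truncated first moments. -/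
lemma tendsto_inverse_moment {x : ℝ} (hx : 0 < x) {M : ℕ → ℝ → ℝ} {M' : ℝ → ℝ}
    (hmeas : ∀ n, Monotone (M n)) (hb : ∀ n z, |M n z| ≤ 1)
    (hlim : ∀ z, x < z → Tendsto (fun n => M n z) atTop (𝓝 (M' z))) :
    Tendsto (fun n => ∫ z in Set.Ioi x, (z ^ 2)⁻¹ * M n z) atTop
      (𝓝 (∫ z in Set.Ioi x, (z ^ 2)⁻¹ * M' z)) := by
  refine tendsto_integral_of_dominated_convergence (fun z => (z ^ 2)⁻¹) (fun n => ?_)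
    (integrableOn_inv_sq hx) (fun n => Eventually.of_forall fun z => ?_) ?_
  · have := (hmeas n).measurable
    exact Measurable.aestronglyMeasurable (by fun_prop)
  · rw [norm_mul, Real.norm_of_nonneg (by positivity)]
    exact mul_le_of_le_one_right (by positivity) (hb n z)
  · filter_upwards [ae_restrict_mem measurableSet_Ioi] with z hz
    exact (hlim z hz).const_mul _

end InverseMoment

/-! ### The observation cube -/

section Cube

variable {k : ℕ}

/-- The cube `[0, T]ᵏ`. -/
def cube (k : ℕ) (T : ℝ) : Set (Fin k → ℝ) := Set.Icc (0 : Fin k → ℝ) fun _ => T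

lemma measurableSet_cube (k : ℕ) (T : ℝ) : MeasurableSet (cube k T) := measurableSet_Icc

lemma real_volume_cube {T : ℝ} (hT : 0 ≤ T) : volume.real (cube k T) = T ^ k := by
  have h1 := Real.volume_Icc_pi_toReal (a := (0 : Fin k → ℝ)) (b := fun _ => T) fun _ => hT
  rw [Measure.real, cube, h1]
  simp

instance (k : ℕ) (T : ℝ) : IsFiniteMeasure ((volume : Measure (Fin k → ℝ)).restrict (cube k T)) :=
  isFiniteMeasure_restrict.2 isCompact_Icc.measure_lt_top.ne

/-- Conditioning is done at interior points only, where the shifted cube is a neighbourhood of the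
origin; the faces do not affect the integral. -/
lemma ae_mem_interior_cube (T : ℝ) :
    ∀ᵐ s ∂((volume : Measure (Fin k → ℝ)).restrict (cube k T)), ∀ i, s i ∈ Set.Ioo 0 T := by
  have h1 : (Set.univ.pi fun _ : Fin k => Set.Ioo (0 : ℝ) T) =ᵐ[volume] cube k T :=
    Measure.univ_pi_Ioo_ae_eq_Icc (f := fun _ => 0) (g := fun _ => T)
  rw [← Measure.restrict_congr_set h1]
  filter_upwards [ae_restrict_mem (MeasurableSet.univ_pi fun _ => measurableSet_Ioo)] with s hs i
  exact hs i trivial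

lemma shifted_cube_mem_nhds {T : ℝ} {s : Fin k → ℝ} (hs : ∀ i, s i ∈ Set.Ioo 0 T) :
    {t : Fin k → ℝ | t + s ∈ cube k T} ∈ 𝓝 0 := by
  have hopen : IsOpen {t : Fin k → ℝ | ∀ i, t i + s i ∈ Set.Ioo 0 T} := by
    rw [Set.ofPred_forall]
    exact isOpen_iInter_of_finite fun i => isOpen_Ioo.preimage (by fun_prop)
  refine mem_of_superset (hopen.mem_nhds (by simpa using hs)) fun t ht => ?_
  exact ⟨fun i => (ht i).1.le, fun i => (ht i).2.le⟩

lemma abs_le_of_shifted_cube {T : ℝ} {s t : Fin k → ℝ} (hs : ∀ i, s i ∈ Set.Ioo 0 T)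
    (ht : t + s ∈ cube k T) (i : Fin k) : |t i| ≤ T := by
  have h1 : 0 ≤ t i + s i := ht.1 i
  have h2 : t i + s i ≤ T := ht.2 i
  rw [abs_le]
  constructor <;> linarith [(hs i).1, (hs i).2]

end Cube

/-! ### Fubini for the truncated first moment -/

section Truncated

variable {Ω : Type*} [MeasurableSpace Ω] {P : Measure Ω} {k d : ℕ}
  {X : (Fin k → ℝ) → Ω → (Fin d → ℝ)} {b w : Fin d → ℝ} {T u : ℝ}

lemma cond_real_apply_of_null {A : Set Ω} (hA : NullMeasurableSet A P) (B : Set Ω) :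
    (P[|A]).real B = P.real (B ∩ A) / P.real A := by
  rw [ProbabilityTheory.cond, measureReal_ennreal_smul_apply, ENNReal.toReal_inv,
    Measure.real, Measure.restrict_apply₀' hA, inv_mul_eq_div]
  rfl

omit [MeasurableSpace Ω] in
lemma sojournTime_eq (ω : Ω) : sojournTime X b T u ω = ∫ t in cube k T, levelInd X b u ω t := rfl

omit [MeasurableSpace Ω] in
lemma sojournTime_nonneg (ω : Ω) : 0 ≤ sojournTime X b T u ω :=
  integral_nonneg fun _ => levelInd_nonneg _ _

omit [MeasurableSpace Ω] in
lemma sojournTime_shift (s : Fin k → ℝ) (ω : Ω) : sojournTime X b T u ω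
    = ∫ t in {t | t + s ∈ cube k T}, levelInd (fun t => X (t + s)) b u ω t := by
  have hm : MeasurableSet {t : Fin k → ℝ | t + s ∈ cube k T} :=
    (measurable_id.add_const s) (measurableSet_cube k T)
  rw [sojournTime_eq, ← integral_indicator (measurableSet_cube k T), ← integral_indicator hm,
    ← integral_add_right_eq_self _ s]
  rfl

lemma integrable_levelInd_cube [IsProbabilityMeasure P]
    (hmeas : AEMeasurable (fun p : Ω × (Fin k → ℝ) => X p.2 p.1) (P.prod volume)) (b : Fin d → ℝ)
    (T u : ℝ) : Integrable (Function.uncurry (levelInd X b u))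
      (P.prod (volume.restrict (cube k T))) :=
  Integrable.of_bound ((aestronglyMeasurable_levelInd hmeas b u).mono_ac
    (Measure.AbsolutelyContinuous.rfl.prod Measure.restrict_le_self.absolutelyContinuous)) 1
    (Eventually.of_forall fun _ => abs_levelInd_le_one _ _)

lemma integrable_sojournTime [IsProbabilityMeasure P]
    (hmeas : AEMeasurable (fun p : Ω × (Fin k → ℝ) => X p.2 p.1) (P.prod volume)) (b : Fin d → ℝ)
    (T u : ℝ) : Integrable (sojournTime X b T u) P :=
  (integrable_levelInd_cube hmeas b T u).integral_prod_left

lemma nullMeasurableSet_exceed (hX : IsCenteredGRF X P) (b : Fin d → ℝ) (u : ℝ) (s : Fin k → ℝ) :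
    NullMeasurableSet {ω | ∀ i, u * b i < X s ω i} P :=
  (hX.gaussian.aemeasurable s).nullMeasurable (measurableSet_level b u)

lemma IsStationary.real_exceed (hstat : IsStationary X P) (b : Fin d → ℝ) (u : ℝ)
    (s : Fin k → ℝ) : P.real {ω | ∀ i, u * b i < X s ω i} = P.real (tailEvent X b u) :=
  congrArg ENNReal.toReal
    ((hstat.identDistrib_apply s).measure_mem_eq (measurableSet_level b u))

/-- The mean sojourn time. -/
lemma integral_sojournTime (hX : IsCenteredGRF X P) (hstat : IsStationary X P)
    (hmeas : AEMeasurable (fun p : Ω × (Fin k → ℝ) => X p.2 p.1) (P.prod volume)) (b : Fin d → ℝ)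
    (hT : 0 ≤ T) (u : ℝ) :
    ∫ ω, sojournTime X b T u ω ∂P = T ^ k * P.real (tailEvent X b u) := by
  have hP := hX.gaussian.isProbabilityMeasure
  simp_rw [sojournTime_eq]
  rw [integral_integral_swap (integrable_levelInd_cube hmeas b T u)]
  have h1 : ∀ s, ∫ ω, levelInd X b u ω s ∂P = P.real (tailEvent X b u) := fun s => by
    rw [levelInd_eq_indicator, integral_indicator₀ (nullMeasurableSet_exceed hX b u s),
      ← hstat.real_exceed b u s]
    simp
  simp_rw [h1]
  rw [setIntegral_const, real_volume_cube hT, smul_eq_mul]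

/-- The truncated first moment of the sojourn time as an integral over the cube. -/
lemma integral_truncated (hX : IsCenteredGRF X P)
    (hmeas : AEMeasurable (fun p : Ω × (Fin k → ℝ) => X p.2 p.1) (P.prod volume)) (b : Fin d → ℝ)
    (T u : ℝ) {c : ℝ} (hc : 0 ≤ c) (z : ℝ) :
    Integrable (fun s => P.real ({ω | c * sojournTime X b T u ω ≤ z}
        ∩ {ω | ∀ i, u * b i < X s ω i})) (volume.restrict (cube k T)) ∧
      ∫ y in Set.Ioc 0 z, y ∂(P.map fun ω => c * sojournTime X b T u ω)
        = c * ∫ s in cube k T, P.real ({ω | c * sojournTime X b T u ω ≤ z}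
            ∩ {ω | ∀ i, u * b i < X s ω i}) := by
  have hP := hX.gaussian.isProbabilityMeasure
  set D : Ω → ℝ := fun ω => c * sojournTime X b T u ω with hD
  have hDm : AEMeasurable D P := (integrable_sojournTime hmeas b T u).aemeasurable.const_mul c
  have hA : NullMeasurableSet {ω | D ω ≤ z} P := nullMeasurableSet_le hDm aemeasurable_const
  have hI : NullMeasurableSet (D ⁻¹' Set.Ioc 0 z) P := hDm.nullMeasurable measurableSet_Ioc
  have hint : Integrable (Function.uncurry fun ω s => {ω | D ω ≤ z}.indicator (fun _ => (1 : ℝ)) ω *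
      levelInd X b u ω s) (P.prod (volume.restrict (cube k T))) := by
    have h1 : AEStronglyMeasurable (fun p : Ω × (Fin k → ℝ) =>
        {ω | D ω ≤ z}.indicator (fun _ => (1 : ℝ)) p.1) (P.prod (volume.restrict (cube k T))) :=
      (aestronglyMeasurable_const.indicator₀ hA).comp_quasiMeasurePreserving
        Measure.quasiMeasurePreserving_fst
    refine Integrable.of_bound
      (h1.mul (integrable_levelInd_cube hmeas b T u).aestronglyMeasurable) 1
      (Eventually.of_forall fun p => ?_)
    have h2 : |{ω | D ω ≤ z}.indicator (fun _ => (1 : ℝ)) p.1| ≤ 1 := by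
      rw [abs_of_nonneg (Set.indicator_nonneg (fun _ _ => zero_le_one) _)]
      exact Set.indicator_le_self' (fun _ _ => zero_le_one) _
    rw [Function.uncurry, norm_mul]
    exact mul_le_one₀ h2 (norm_nonneg _) (abs_levelInd_le_one _ _)
  have hprob : ∀ s, ∫ ω, {ω | D ω ≤ z}.indicator (fun _ => (1 : ℝ)) ω * levelInd X b u ω s ∂P
      = P.real ({ω | D ω ≤ z} ∩ {ω | ∀ i, u * b i < X s ω i}) := fun s => by
    have e : ∀ ω, {ω | D ω ≤ z}.indicator (fun _ => (1 : ℝ)) ω * levelInd X b u ω s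
        = ({ω | D ω ≤ z} ∩ {ω | ∀ i, u * b i < X s ω i}).indicator (fun _ => (1 : ℝ)) ω := fun ω => by
      rw [congrFun (levelInd_eq_indicator (X := X) (b := b) (u := u) s) ω]
      simpa using (Set.inter_indicator_mul (fun _ => (1 : ℝ)) (fun _ => (1 : ℝ)) ω).symm
    simp_rw [e]
    rw [integral_indicator₀ (hA.inter (nullMeasurableSet_exceed hX b u s))]
    simp
  refine ⟨?_, ?_⟩
  · refine hint.integral_prod_right.congr (Eventually.of_forall fun s => ?_)
    exact hprob s
  -- On `{D ≤ z}` the sojourn time is expanded into the integral of its indicators over the cube.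
  -- The excluded endpoint 0 carries no first moment.
  · rw [setIntegral_map measurableSet_Ioc (by fun_prop) hDm, ← integral_indicator₀ hI]
    have e2 : ∀ s, P.real ({ω | D ω ≤ z} ∩ {ω | ∀ i, u * b i < X s ω i}) = _ := fun s =>
      (hprob s).symm
    rw [setIntegral_congr_fun (measurableSet_cube k T) fun s _ => e2 s,
      ← integral_integral_swap hint, ← integral_const_mul]
    refine integral_congr_ae (Eventually.of_forall fun ω => ?_)
    beta_reduce
    rw [integral_const_mul, ← sojournTime_eq]
    have hD0 : 0 ≤ D ω := mul_nonneg hc (sojournTime_nonneg ω)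
    by_cases hz : D ω ≤ z
    · rw [Set.indicator_of_mem (show ω ∈ {ω | D ω ≤ z} from hz), one_mul]
      rcases hD0.eq_or_lt with h0 | h0
      · rw [Set.indicator_of_notMem (show ω ∉ D ⁻¹' Set.Ioc 0 z from fun h => h.1.ne h0)]
        exact h0
      · rw [Set.indicator_of_mem (show ω ∈ D ⁻¹' Set.Ioc 0 z from ⟨h0, hz⟩)]
    · rw [Set.indicator_of_notMem (show ω ∉ {ω | D ω ≤ z} from hz), zero_mul, mul_zero,
        Set.indicator_of_notMem (show ω ∉ D ⁻¹' Set.Ioc 0 z from fun h => hz h.2)]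

end Truncated

/-! ### The two limit relations along sequences -/

section Limits

variable {Ω : Type*} [MeasurableSpace Ω] {P : Measure Ω} {k d : ℕ}
  {X : (Fin k → ℝ) → Ω → (Fin d → ℝ)} {b w : Fin d → ℝ} {T : ℝ}
  {α : Fin k → ℝ} {l : Fin k → ℝ → ℝ} {V : (Fin k → ℝ) → Matrix (Fin d) (Fin d) ℝ}
  {Ω' : Type*} [MeasurableSpace Ω'] {P' : Measure Ω'}
  {Y : (Fin k → ℝ) → Ω' → (Fin d → ℝ)} {E : Ω' → (Fin d → ℝ)}

lemma aemeasurable_shift [SFinite P]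
    (hmeas : AEMeasurable (fun p : Ω × (Fin k → ℝ) => X p.2 p.1) (P.prod volume))
    (s : Fin k → ℝ) :
    AEMeasurable (fun p : Ω × (Fin k → ℝ) => X (p.2 + s) p.1) (P.prod volume) := by
  have h1 : MeasurePreserving (fun t : Fin k → ℝ => t + s) volume volume :=
    measurePreserving_add_right volume s
  exact hmeas.comp_quasiMeasurePreserving
    ((MeasurePreserving.id P).prod h1).quasiMeasurePreserving

/-- The law of the sojourn time conditionally on an exceedance at an interior point. -/
lemma tendsto_cond_sojournTime (hX : IsCenteredGRF X P) (hstat : IsStationary X P)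
    (hmeas : AEMeasurable (fun p : Ω × (Fin k → ℝ) => X p.2 p.1) (P.prod volume))
    (hdet : IsUnit (stationaryCov X P 0).det) (hw : w = (stationaryCov X P 0)⁻¹ *ᵥ b)
    (hwpos : ∀ i, 0 < w i) (hR : Continuous (stationaryCov X P))
    (hpos : ∀ τ, τ ≠ 0 → 0 < quadDefect (stationaryCov X P) w τ)
    (h : LocalExpansion (stationaryCov X P) w α l V) (hYE : IsLimitPair V Y E P')
    (hk : 0 < k) (hd : Nonempty (Fin d)) (hT : 0 < T) {s : Fin k → ℝ} (hs : ∀ i, s i ∈ Set.Ioo 0 T)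
    {u : ℕ → ℝ} (hu0 : ∀ n, 0 < u n) (hu : Tendsto u atTop atTop) {x : ℝ} (hx : 0 < x) :
    Tendsto (fun n => P.real ({ω | theta α l (u n) * sojournTime X b T (u n) ω ≤ x}
        ∩ {ω | ∀ i, u n * b i < X s ω i}) / P.real (tailEvent X b (u n))) atTop
      (𝓝 (distFun (limitSojourn V w Y E) P' x)) := by
  have hP := hX.gaussian.isProbabilityMeasure
  have hcov := hstat.stationaryCov_shift s
  have hcov0 : covMatrix (fun t => X (t + s)) P 0 0 = stationaryCov X P 0 := by
    rw [← hcov]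
    rfl
  -- Seen from `s`, the field is stationary with the same covariance and the cube is a bounded
  -- neighbourhood of the origin.
  have h1 := tendsto_cond_sojourn (X := fun t => X (t + s)) (w := w) (b := b) (α := α) (l := l)
    (V := V) (hX.shift s) (hstat.shift s) (aemeasurable_shift hmeas s) (by rwa [hcov0])
    (by rwa [hcov0]) hwpos (by rwa [hcov]) (by rwa [hcov]) (by rwa [hcov]) hYE hk hd hT
    (W := {t | t + s ∈ cube k T}) ((measurable_id.add_const s) (measurableSet_cube k T))
    (shifted_cube_mem_nhds hs) (fun t ht i => abs_le_of_shifted_cube hs ht i) hu0 hu hx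
  refine h1.congr fun n => ?_
  have htail : tailEvent (fun t => X (t + s)) b (u n) = {ω | ∀ i, u n * b i < X s ω i} := by
    simp [tailEvent]
  rw [cond_real_apply_of_null (nullMeasurableSet_tailEvent (hX.shift s) b (u n)), htail,
    hstat.real_exceed]
  simp_rw [sojournTime_shift s]

/-- The limit of the truncated first moments, along sequences. -/
lemma tendsto_truncated (hX : IsCenteredGRF X P) (hstat : IsStationary X P)
    (hmeas : AEMeasurable (fun p : Ω × (Fin k → ℝ) => X p.2 p.1) (P.prod volume))
    (hdet : IsUnit (stationaryCov X P 0).det) (hw : w = (stationaryCov X P 0)⁻¹ *ᵥ b)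
    (hwpos : ∀ i, 0 < w i) (hR : Continuous (stationaryCov X P))
    (hpos : ∀ τ, τ ≠ 0 → 0 < quadDefect (stationaryCov X P) w τ)
    (h : LocalExpansion (stationaryCov X P) w α l V) (hYE : IsLimitPair V Y E P')
    (hk : 0 < k) (hd : Nonempty (Fin d)) (hT : 0 < T)
    {u : ℕ → ℝ} (hu0 : ∀ n, 0 < u n) (hu : Tendsto u atTop atTop) {x : ℝ} (hx : 0 < x) :
    Tendsto (fun n => (∫ y in Set.Ioc 0 x, y
          ∂(P.map (fun ω => theta α l (u n) * sojournTime X b T (u n) ω))) /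
        (theta α l (u n) * ∫ ω, sojournTime X b T (u n) ω ∂P)) atTop
      (𝓝 (distFun (limitSojourn V w Y E) P' x)) := by
  have hP := hX.gaussian.isProbabilityMeasure
  have hTk : 0 < T ^ k := by positivity
  have hθ : ∀ n, 0 < theta α l (u n) := fun n => h.theta_pos (hu0 n)
  have hp : ∀ n, 0 < P.real (tailEvent X b (u n)) := fun n =>
    hX.tailEvent_pos hdet hw hwpos (hu0 n)
  set G : ℕ → (Fin k → ℝ) → ℝ := fun n s =>
    P.real ({ω | theta α l (u n) * sojournTime X b T (u n) ω ≤ x}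
        ∩ {ω | ∀ i, u n * b i < X s ω i}) / P.real (tailEvent X b (u n)) with hG
  -- The quotient is the average over the cube of conditional probabilities given an exceedance at
  -- `s`.
  have e : ∀ n, (∫ y in Set.Ioc 0 x, y
          ∂(P.map (fun ω => theta α l (u n) * sojournTime X b T (u n) ω))) /
        (theta α l (u n) * ∫ ω, sojournTime X b T (u n) ω ∂P)
      = (T ^ k)⁻¹ * ∫ s in cube k T, G n s := fun n => by
    rw [(integral_truncated hX hmeas b T (u n) (hθ n).le x).2,
      integral_sojournTime hX hstat hmeas b hT.le, hG]
    simp only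
    rw [integral_div]
    have h1 := (hθ n).ne'
    have h2 := (hp n).ne'
    field_simp
  simp_rw [e]
  have hlim : Tendsto (fun n => ∫ s in cube k T, G n s) atTop
      (𝓝 (∫ _s in cube k T, distFun (limitSojourn V w Y E) P' x)) := by
    refine tendsto_integral_of_dominated_convergence (fun _ => 1) (fun n => ?_)
      (integrable_const _) (fun n => Eventually.of_forall fun s => ?_) ?_
    · exact ((integral_truncated hX hmeas b T (u n) (hθ n).le x).1.div_const _).aestronglyMeasurable
    · rw [Real.norm_of_nonneg (div_nonneg measureReal_nonneg measureReal_nonneg),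
        div_le_one (hp n), ← hstat.real_exceed b (u n) s]
      exact measureReal_mono Set.inter_subset_right
    · filter_upwards [ae_mem_interior_cube T] with s hs
      exact tendsto_cond_sojournTime hX hstat hmeas hdet hw hwpos hR hpos h hYE hk hd hT hs hu0 hu
        hx
  have h3 := hlim.const_mul (T ^ k)⁻¹
  rwa [setIntegral_const, real_volume_cube hT.le, smul_eq_mul, inv_mul_cancel_left₀ hTk.ne'] at h3

/-- The limit of the tail of the sojourn time, along sequences. -/
lemma tendsto_tail_sojournTime (hX : IsCenteredGRF X P) (hstat : IsStationary X P)
    (hmeas : AEMeasurable (fun p : Ω × (Fin k → ℝ) => X p.2 p.1) (P.prod volume))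
    (hdet : IsUnit (stationaryCov X P 0).det) (hw : w = (stationaryCov X P 0)⁻¹ *ᵥ b)
    (hwpos : ∀ i, 0 < w i) (hR : Continuous (stationaryCov X P))
    (hpos : ∀ τ, τ ≠ 0 → 0 < quadDefect (stationaryCov X P) w τ)
    (h : LocalExpansion (stationaryCov X P) w α l V) (hYE : IsLimitPair V Y E P')
    (hk : 0 < k) (hd : Nonempty (Fin d)) (hT : 0 < T)
    {u : ℕ → ℝ} (hu0 : ∀ n, 0 < u n) (hu : Tendsto u atTop atTop) {x : ℝ} (hx : 0 < x) :
    Tendsto (fun n => P.real {ω | x < theta α l (u n) * sojournTime X b T (u n) ω} /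
        (T ^ k * theta α l (u n) * P.real (tailEvent X b (u n)))) atTop
      (𝓝 (bermanConst (limitSojourn V w Y E) P' x)) := by
  have hP := hX.gaussian.isProbabilityMeasure
  have hP' := hYE.isProbabilityMeasure
  have hTk : 0 < T ^ k := by positivity
  have hθ : ∀ n, 0 < theta α l (u n) := fun n => h.theta_pos (hu0 n)
  have hp : ∀ n, 0 < P.real (tailEvent X b (u n)) := fun n =>
    hX.tailEvent_pos hdet hw hwpos (hu0 n)
  set D : ℕ → Ω → ℝ := fun n ω => theta α l (u n) * sojournTime X b T (u n) ω with hD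
  have hDint : ∀ n, Integrable (D n) P := fun n =>
    (integrable_sojournTime hmeas b T (u n)).const_mul _
  have hD0 : ∀ n ω, 0 ≤ D n ω := fun n ω => mul_nonneg (hθ n).le (sojournTime_nonneg ω)
  set m : ℕ → ℝ := fun n => theta α l (u n) * ∫ ω, sojournTime X b T (u n) ω ∂P with hm
  have hm' : ∀ n, m n = T ^ k * theta α l (u n) * P.real (tailEvent X b (u n)) := fun n => by
    rw [hm]
    simp only
    rw [integral_sojournTime hX hstat hmeas b hT.le]
    ring
  have hm0 : ∀ n, 0 < m n := fun n => by
    rw [hm']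
    have := hθ n
    have := hp n
    positivity
  have hmD : ∀ n, m n = ∫ y, y ∂(P.map (D n)) := fun n => by
    rw [integral_map (hDint n).aemeasurable (by fun_prop)]
    exact (integral_const_mul _ _).symm
  have hFint : ∀ n, Integrable id (P.map (D n)) := fun n =>
    (integrable_map_measure (by fun_prop) (hDint n).aemeasurable).2 (hDint n)
  have hprob : ∀ n, IsProbabilityMeasure (P.map (D n)) := fun n =>
    Measure.isProbabilityMeasure_map (hDint n).aemeasurable
  have hFpos : ∀ n, ∀ᵐ y ∂(P.map (D n)), 0 ≤ y := fun n =>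
    (ae_map_iff (hDint n).aemeasurable measurableSet_Ici).2 (Eventually.of_forall (hD0 n))
  set M : ℕ → ℝ → ℝ := fun n z => (∫ y in Set.Ioc x z, y ∂(P.map (D n))) / m n with hM
  have e : ∀ n, P.real {ω | x < D n ω} / (T ^ k * theta α l (u n) * P.real (tailEvent X b (u n)))
      = ∫ z in Set.Ioi x, (z ^ 2)⁻¹ * M n z := fun n => by
    have h1 : P.real {ω | x < D n ω} = (P.map (D n)).real (Set.Ioi x) := by
      rw [Measure.real, Measure.real, Measure.map_apply_of_aemeasurable (hDint n).aemeasurable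
        measurableSet_Ioi]
      rfl
    rw [h1, real_Ioi_eq_integral _ (hFint n) hx, ← hm', ← integral_div]
    exact integral_congr_ae (Eventually.of_forall fun z => mul_div_assoc _ _ _)
  refine Tendsto.congr (fun n => (e n).symm) ?_
  -- The limit constant has the same representation, with increments of the distribution function of
  -- `J` in place of the normalized truncated moments.
  have hb : bermanConst (limitSojourn V w Y E) P' x = ∫ z in Set.Ioi x, (z ^ 2)⁻¹ *
      (distFun (limitSojourn V w Y E) P' z - distFun (limitSojourn V w Y E) P' x) := by
    have hJ := hYE.aemeasurable_limitSojourn h.continuous w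
    have : IsProbabilityMeasure (P'.map (limitSojourn V w Y E)) :=
      Measure.isProbabilityMeasure_map hJ
    rw [bermanConst, toReal_lintegral_inv_eq _ hx]
    refine setIntegral_congr_fun measurableSet_Ioi fun z (hz : x < z) => ?_
    have h1 : Set.Ioc (ENNReal.ofReal x) (ENNReal.ofReal z)
        = Set.Iic (ENNReal.ofReal z) \ Set.Iic (ENNReal.ofReal x) := by
      ext a
      simp [and_comm]
    have h2 : ∀ y : ℝ, (P'.map (limitSojourn V w Y E)).real (Set.Iic (ENNReal.ofReal y))
        = distFun (limitSojourn V w Y E) P' y := fun y => by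
      rw [Measure.real, Measure.map_apply_of_aemeasurable hJ measurableSet_Iic]
      rfl
    have h3 : (P'.map (limitSojourn V w Y E)).real (Set.Ioc (ENNReal.ofReal x) (ENNReal.ofReal z))
        = distFun (limitSojourn V w Y E) P' z - distFun (limitSojourn V w Y E) P' x := by
      rw [h1, measureReal_sdiff (Set.Iic_subset_Iic.2 (ENNReal.ofReal_le_ofReal hz.le))
        measurableSet_Iic, h2, h2]
    rw [h3]
  rw [hb]
  refine tendsto_inverse_moment hx (fun n z z' hz => ?_) (fun n z => ?_) fun z hz => ?_
  · refine div_le_div_of_nonneg_right (setIntegral_mono_set (hFint n).integrableOn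
      (ae_restrict_of_ae (hFpos n)) ?_) (hm0 n).le
    exact LE.le.eventuallyLE (Set.Ioc_subset_Ioc_right hz)
  · have h1 : 0 ≤ ∫ y in Set.Ioc x z, y ∂(P.map (D n)) :=
      integral_nonneg_of_ae (ae_restrict_of_ae (hFpos n))
    change |(∫ y in Set.Ioc x z, y ∂(P.map (D n))) / m n| ≤ 1
    rw [abs_of_nonneg (div_nonneg h1 (hm0 n).le), div_le_one (hm0 n), hmD]
    exact setIntegral_le_integral (hFint n) (hFpos n)
  · have h1 := (tendsto_truncated hX hstat hmeas hdet hw hwpos hR hpos h hYE hk hd hT hu0 hu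
      (hx.trans hz)).sub
      (tendsto_truncated hX hstat hmeas hdet hw hwpos hR hpos h hYE hk hd hT hu0 hu hx)
    refine h1.congr fun n => ?_
    rw [← sub_div]
    congr 1
    have hdisj : Disjoint (Set.Ioc 0 x) (Set.Ioc x z) := Set.Ioc_disjoint_Ioc_of_le le_rfl
    have h2 := setIntegral_union (f := fun y : ℝ => y) (μ := P.map (D n)) hdisj measurableSet_Ioc
      (hFint n).integrableOn (hFint n).integrableOn
    rw [Set.Ioc_union_Ioc_eq_Ioc hx.le hz.le] at h2
    rw [sub_eq_iff_eq_add, add_comm]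
    exact h2

/-- Replacing a sequence by its maximum with 1 changes only finitely many terms, so arguments by
sequences may assume a positive level throughout. -/
lemma tendsto_atTop_of_pos_seq {f : ℝ → ℝ} {a : ℝ}
    (hf : ∀ u : ℕ → ℝ, (∀ n, 0 < u n) → Tendsto u atTop atTop →
      Tendsto (fun n => f (u n)) atTop (𝓝 a)) : Tendsto f atTop (𝓝 a) := by
  refine tendsto_of_seq_tendsto fun u hu => ?_
  have h1 : Tendsto (fun n => max (u n) 1) atTop atTop :=
    tendsto_atTop_mono (fun n => le_max_left _ _) hu
  refine (hf (fun n => max (u n) 1) (fun n => by positivity) h1).congr' ?_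
  filter_upwards [hu.eventually_ge_atTop 1] with n hn
  rw [Function.comp, max_eq_left hn]

end Limits

/-! ### Hilbert space realization of a kernel -/

section FeatureMap

/-- A symmetric positive semidefinite kernel is a Gram kernel. -/
lemma exists_inner_eq {ι : Type} (c : ι → ι → ℝ) (hsymm : ∀ i j, c i j = c j i)
    (hpos : ∀ (s : Finset ι) (a : ι → ℝ), 0 ≤ ∑ i ∈ s, ∑ j ∈ s, a i * a j * c i j) :
    ∃ (H : Type) (_ : NormedAddCommGroup H) (_ : InnerProductSpace ℝ H) (φ : ι → H),
      ∀ i j, inner ℝ (φ i) (φ j) = c i j := by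
  -- The scalar kernel is viewed as an operator-valued one, acting on `ℝ` by multiplication; its
  -- reproducing kernel Hilbert space contains the required vectors.
  set K : Matrix ι ι (ℝ →L[ℝ] ℝ) := Matrix.of fun i j => c i j • ContinuousLinearMap.id ℝ ℝ with hK
  have hKps : K.PosSemidef := by
    refine ((RKHS.posSemidef_tfae (K := K)).out 0 2).mpr (And.intro ?_ fun a => ?_)
    · ext1 i j
      simp only [Matrix.conjTranspose_apply, hK, Matrix.of_apply, star_smul, hsymm i j]
      rw [ContinuousLinearMap.star_eq_adjoint, ContinuousLinearMap.adjoint_id]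
      simp
    · refine (hpos a.support a).trans_eq ?_
      simp only [Finsupp.sum, hK, Matrix.of_apply, RCLike.re_to_real]
      refine Finset.sum_congr rfl fun i _ => Finset.sum_congr rfl fun j _ => ?_
      simp [hsymm i j]
      ring
  have : Fact K.PosSemidef := ⟨hKps⟩
  refine ⟨RKHS.OfKernel K, inferInstance, inferInstance,
    fun i => RKHS.kerFun (RKHS.OfKernel K) i 1, fun i j => ?_⟩
  have := RKHS.kernel_inner (RKHS.OfKernel K) j i 1 1
  rw [← this, RKHS.OfKernel.kernel_ofKernel]
  simp [hK, hsymm i j]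

/-- A lower triangular factorization of the Gram matrix of a sequence. -/
lemma exists_triangular_factor {H : Type*} [NormedAddCommGroup H] [InnerProductSpace ℝ H]
    (f : ℕ → H) : ∃ c : ℕ → ℕ → ℝ, (∀ n i, n < i → c n i = 0) ∧
      ∀ N n m, n < N → m < N → ∑ i ∈ Finset.range N, c n i * c m i = inner ℝ (f n) (f m) := by
  -- The entry `c n i` is the Gram–Schmidt coordinate of `f n` along `e i`. Linear dependence gives
  -- `e i = 0`, and `⟪e i, e i⟫ • e i = e i` holds in that case too, which is all the normalization
  -- needed.
  set e := InnerProductSpace.gramSchmidtNormed ℝ f with he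
  have horth : ∀ i j, i ≠ j → inner ℝ (e i) (e j) = 0 := fun i j hij => by
    simp [he, InnerProductSpace.gramSchmidtNormed, inner_smul_left, inner_smul_right,
      InnerProductSpace.gramSchmidt_orthogonal ℝ f hij]
  have hnorm : ∀ i, inner ℝ (e i) (e i) • e i = e i := fun i => by
    by_cases h : e i = 0
    · simp [h]
    · rw [real_inner_self_eq_norm_sq, InnerProductSpace.gramSchmidtNormed_unit_length' h]
      simp
  have hmem : ∀ n, f n ∈ Submodule.span ℝ (e '' Set.Iic n) := fun n => by
    rw [he, InnerProductSpace.span_gramSchmidtNormed, InnerProductSpace.span_gramSchmidt_Iic]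
    exact Submodule.subset_span ⟨n, Set.mem_Iic.2 le_rfl, rfl⟩
  refine ⟨fun n i => inner ℝ (e i) (f n), fun n i hi => ?_, fun N n m hn hm => ?_⟩
  · have h1 : ∀ x ∈ Submodule.span ℝ (e '' Set.Iic n), inner ℝ (e i) x = 0 := fun x hx => by
      induction hx using Submodule.span_induction with
      | mem x hx =>
        obtain ⟨j, hj, rfl⟩ := hx
        exact horth i j (ne_of_gt (lt_of_le_of_lt hj hi))
      | zero => simp
      | add x y _ _ hx hy => rw [inner_add_right, hx, hy, add_zero]
      | smul a x _ hx => rw [inner_smul_right, hx, mul_zero]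
    exact h1 _ (hmem n)
  · have h1 : ∀ x ∈ Submodule.span ℝ (e '' Set.Iic n),
        ∑ i ∈ Finset.range N, inner ℝ (e i) x • e i = x := fun x hx => by
      induction hx using Submodule.span_induction with
      | mem x hx =>
        obtain ⟨j, hj, rfl⟩ := hx
        rw [Finset.sum_eq_single_of_mem j (Finset.mem_range.2 (lt_of_le_of_lt hj hn)), hnorm]
        intro i _ hij
        rw [horth i j hij, zero_smul]
      | zero => simp
      | add x y _ _ hx hy => simp only [inner_add_right, add_smul, Finset.sum_add_distrib, hx, hy]
      | smul a x _ hx =>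
        simp only [inner_smul_right, mul_smul, ← Finset.smul_sum, hx]
    conv_rhs => rw [← h1 _ (hmem n), sum_inner]
    refine Finset.sum_congr rfl fun i _ => ?_
    rw [real_inner_smul_left]

end FeatureMap

/-! ### Gaussian families with a given Gram kernel -/

section GaussianSequence

/-- The law of a sequence of independent standard normal variables. -/
noncomputable def noiseLaw : Measure (ℕ → ℝ) := Measure.infinitePi fun _ => gaussianReal 0 1

instance : IsProbabilityMeasure noiseLaw := by
  unfold noiseLaw
  infer_instance

lemma map_noiseLaw_sum (N : ℕ) (x : ℕ → ℝ) :
    noiseLaw.map (fun ω => ∑ i ∈ Finset.range N, x i * ω i)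
      = gaussianReal 0 (∑ i ∈ Finset.range N, x i ^ 2).toNNReal := by
  have hind : iIndepFun (fun (i : ℕ) (ω : ℕ → ℝ) => x i * ω i) noiseLaw :=
    iIndepFun_infinitePi (X := fun i y => x i * y) fun i => by fun_prop
  have hone : ∀ i, noiseLaw.map (fun ω : ℕ → ℝ => x i * ω i)
      = gaussianReal 0 (x i ^ 2).toNNReal := fun i => by
    have h1 : HasLaw (fun ω : ℕ → ℝ => ω i) (gaussianReal 0 1) noiseLaw :=
      ⟨(measurable_pi_apply i).aemeasurable, (measurePreserving_eval_infinitePi (fun _ : ℕ => gaussianReal 0 1) i).map_eq⟩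
    have h2 := (gaussianReal_const_mul h1 (x i)).map_eq
    rw [h2, mul_zero, mul_one]
    congr 1
    ext
    simp [Real.coe_toNNReal _ (sq_nonneg (x i))]
  induction N with
  | zero => simp [gaussianReal_zero_var]
  | succ N ih =>
    have h1 : IndepFun (fun ω : ℕ → ℝ => ∑ i ∈ Finset.range N, x i * ω i)
        (fun ω => x N * ω N) noiseLaw := by
      have := hind.indepFun_finsetSum_of_notMem (fun i => by fun_prop)
        (s := Finset.range N) (i := N) (by simp)
      convert this using 1
      ext ω
      simp
    have h2 := gaussianReal_add_gaussianReal_of_indepFun h1 ih (hone N)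
    simp only [Finset.sum_range_succ]
    rw [add_zero] at h2
    rw [Real.toNNReal_add (Finset.sum_nonneg fun i _ => sq_nonneg _) (sq_nonneg _)]
    exact h2

/-- A Gaussian sequence indexed by a countable type with a prescribed Gram kernel. -/
lemma exists_gaussian_family {H : Type*} [NormedAddCommGroup H] [InnerProductSpace ℝ H]
    {κ : Type*} [Countable κ] (f : κ → H) : ∃ G : κ → (ℕ → ℝ) → ℝ, (∀ p, Measurable (G p)) ∧
      ∀ {ι : Type} (s : Finset ι) (p : ι → κ) (a : ι → ℝ),
        noiseLaw.map (fun ω => ∑ j ∈ s, a j * G (p j) ω)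
          = gaussianReal 0 (‖∑ j ∈ s, a j • f (p j)‖ ^ 2).toNNReal := by
  -- Enumerating the index set makes the factorization triangular, so each variable is a finite
  -- combination of the noise and no series has to converge.
  obtain ⟨g, hg⟩ := exists_injective_nat κ
  obtain ⟨c, hc0, hc⟩ := exists_triangular_factor (Function.extend g f 0)
  refine ⟨fun p ω => ∑ i ∈ Finset.range (g p + 1), c (g p) i * ω i, fun p => by fun_prop,
    fun {ι} s p a => ?_⟩
  obtain ⟨N, hN⟩ : ∃ N, ∀ j ∈ s, g (p j) < N :=
    ⟨s.sup (fun j => g (p j)) + 1, fun j hj =>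
      Nat.lt_succ_of_le (Finset.le_sup (f := fun j => g (p j)) hj)⟩
  have h1 : ∀ ω : ℕ → ℝ, ∑ j ∈ s, a j * ∑ i ∈ Finset.range (g (p j) + 1), c (g (p j)) i * ω i
      = ∑ i ∈ Finset.range N, (∑ j ∈ s, a j * c (g (p j)) i) * ω i := fun ω => by
    have e : ∀ j ∈ s, ∑ i ∈ Finset.range (g (p j) + 1), c (g (p j)) i * ω i
        = ∑ i ∈ Finset.range N, c (g (p j)) i * ω i := fun j hj => by
      refine Finset.sum_subset (Finset.range_mono (hN j hj)) fun i _ hi => ?_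
      rw [hc0 _ _ (by simpa using hi), zero_mul]
    simp_rw [Finset.sum_mul]
    rw [Finset.sum_comm]
    refine Finset.sum_congr rfl fun j hj => ?_
    rw [e j hj, Finset.mul_sum]
    exact Finset.sum_congr rfl fun i _ => by ring
  have h2 : ∑ i ∈ Finset.range N, (∑ j ∈ s, a j * c (g (p j)) i) ^ 2
      = ‖∑ j ∈ s, a j • f (p j)‖ ^ 2 := by
    rw [← real_inner_self_eq_norm_sq, sum_inner]
    simp_rw [inner_sum, pow_two, Finset.sum_mul_sum]
    rw [Finset.sum_comm]
    refine Finset.sum_congr rfl fun j hj => ?_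
    rw [Finset.sum_comm]
    refine Finset.sum_congr rfl fun m hm => ?_
    have := hc N _ _ (hN j hj) (hN m hm)
    rw [hg.extend_apply, hg.extend_apply] at this
    rw [real_inner_smul_left, real_inner_smul_right, ← this, Finset.mul_sum, Finset.mul_sum]
    exact Finset.sum_congr rfl fun i _ => by ring
  simp_rw [h1]
  rw [map_noiseLaw_sum, h2]

end GaussianSequence

/-! ### The limiting covariance kernel -/

section LimitKernel

variable {Ω : Type*} [MeasurableSpace Ω] {P : Measure Ω} {k d : ℕ}
  {X : (Fin k → ℝ) → Ω → (Fin d → ℝ)} {w : Fin d → ℝ}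
  {α : Fin k → ℝ} {l : Fin k → ℝ → ℝ} {V : (Fin k → ℝ) → Matrix (Fin d) (Fin d) ℝ}

/-- The covariance kernel of the components of the limiting field. -/
def limitKernel (V : (Fin k → ℝ) → Matrix (Fin d) (Fin d) ℝ)
    (p q : (Fin k → ℝ) × Fin d) : ℝ :=
  (V p.1 + V (-q.1) - V (p.1 - q.1)) p.2 q.2

lemma limitKernel_symm (hV : ∀ t, V (-t) = (V t)ᵀ) (p q : (Fin k → ℝ) × Fin d) :
    limitKernel V p q = limitKernel V q p := by
  have h : p.1 - q.1 = -(q.1 - p.1) := (neg_sub _ _).symm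
  simp only [limitKernel, Matrix.add_apply, Matrix.sub_apply]
  rw [h, hV, hV, hV]
  simp only [Matrix.transpose_apply]
  ring

lemma IsCenteredGRF.integral_increment_mul (hX : IsCenteredGRF X P) (hstat : IsStationary X P)
    (u : ℝ) (p q : (Fin k → ℝ) × Fin d) :
    u ^ 2 * ∫ ω, (X (p.1 / scaling α l u) ω p.2 - X 0 ω p.2)
        * (X (q.1 / scaling α l u) ω q.2 - X 0 ω q.2) ∂P
      = (scaledDefect (stationaryCov X P) α l u p.1 + scaledDefect (stationaryCov X P) α l u (-q.1)
        - scaledDefect (stationaryCov X P) α l u (p.1 - q.1)) p.2 q.2 := by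
  have e : ∀ ω, (X (p.1 / scaling α l u) ω p.2 - X 0 ω p.2)
        * (X (q.1 / scaling α l u) ω q.2 - X 0 ω q.2)
      = X (p.1 / scaling α l u) ω p.2 * X (q.1 / scaling α l u) ω q.2
        - X (p.1 / scaling α l u) ω p.2 * X 0 ω q.2
        - X 0 ω p.2 * X (q.1 / scaling α l u) ω q.2 + X 0 ω p.2 * X 0 ω q.2 := fun ω => by ring
  have hi := fun (s t : Fin k → ℝ) => hX.integrable_mul s t p.2 q.2
  have h1 : ∀ s t : Fin k → ℝ, ∫ ω, X s ω p.2 * X t ω q.2 ∂P = covMatrix X P s t p.2 q.2 :=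
    fun s t => rfl
  set s := p.1 / scaling α l u with hs
  set t := q.1 / scaling α l u with ht
  have i1 : Integrable (fun ω => X s ω p.2 * X t ω q.2 - X s ω p.2 * X 0 ω q.2) P :=
    (hi s t).sub (hi s 0)
  have i2 : Integrable (fun ω => X s ω p.2 * X t ω q.2 - X s ω p.2 * X 0 ω q.2
      - X 0 ω p.2 * X t ω q.2) P := i1.sub (hi 0 t)
  simp_rw [e]
  rw [integral_add i2 (hi 0 0), integral_sub i1 (hi 0 t), integral_sub (hi s t) (hi s 0), h1, h1,
    h1, h1, hs, ht, hstat.covMatrix_scaled, hstat.covMatrix_zero_scaled]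
  simp only [scaledDefect, stationaryCov, Matrix.add_apply, Matrix.sub_apply, Matrix.smul_apply,
    smul_eq_mul]
  ring

/-- The kernel is the limit of `u²` times the covariances of the increments `X(t / v(u)) - X(0)`,
and nonnegativity of the quadratic forms passes to the limit. -/
lemma LocalExpansion.limitKernel_nonneg (hX : IsCenteredGRF X P) (hstat : IsStationary X P)
    (h : LocalExpansion (stationaryCov X P) w α l V) (s : Finset ((Fin k → ℝ) × Fin d))
    (a : (Fin k → ℝ) × Fin d → ℝ) :
    0 ≤ ∑ p ∈ s, ∑ q ∈ s, a p * a q * limitKernel V p q := by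
  have h1 : Tendsto (fun u => ∑ p ∈ s, ∑ q ∈ s, a p * a q *
      (scaledDefect (stationaryCov X P) α l u p.1 + scaledDefect (stationaryCov X P) α l u (-q.1)
        - scaledDefect (stationaryCov X P) α l u (p.1 - q.1)) p.2 q.2) atTop
      (𝓝 (∑ p ∈ s, ∑ q ∈ s, a p * a q * limitKernel V p q)) := by
    refine tendsto_finsetSum _ fun p _ => tendsto_finsetSum _ fun q _ => Tendsto.const_mul _ ?_
    have h2 := ((h.tendsto_scaledDefect p.1).add (h.tendsto_scaledDefect (-q.1))).sub
      (h.tendsto_scaledDefect (p.1 - q.1))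
    exact tendsto_pi_nhds.1 (tendsto_pi_nhds.1 h2 p.2) q.2
  refine ge_of_tendsto' h1 fun u => ?_
  simp_rw [← hX.integral_increment_mul hstat u]
  have hL : ∀ p : (Fin k → ℝ) × Fin d,
      MemLp (fun ω => X (p.1 / scaling α l u) ω p.2 - X 0 ω p.2) 2 P := fun p =>
    (hX.memLp_two _ _).sub (hX.memLp_two _ _)
  have h2 : ∑ p ∈ s, ∑ q ∈ s, a p * a q *
        (u ^ 2 * ∫ ω, (X (p.1 / scaling α l u) ω p.2 - X 0 ω p.2)
          * (X (q.1 / scaling α l u) ω q.2 - X 0 ω q.2) ∂P)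
      = u ^ 2 * ∫ ω, (∑ p ∈ s, a p * (X (p.1 / scaling α l u) ω p.2 - X 0 ω p.2)) ^ 2 ∂P := by
    simp_rw [pow_two (∑ p ∈ s, _), Finset.sum_mul_sum]
    have hint : ∀ p q : (Fin k → ℝ) × Fin d, Integrable (fun ω =>
        a p * (X (p.1 / scaling α l u) ω p.2 - X 0 ω p.2)
          * (a q * (X (q.1 / scaling α l u) ω q.2 - X 0 ω q.2))) P := fun p q =>
      ((hL p).const_mul (a p)).integrable_mul ((hL q).const_mul (a q))
    rw [integral_finsetSum _ fun p _ => integrable_finsetSum _ fun q _ => hint p q, Finset.mul_sum]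
    refine Finset.sum_congr rfl fun p _ => ?_
    rw [integral_finsetSum _ fun q _ => hint p q, Finset.mul_sum]
    refine Finset.sum_congr rfl fun q _ => ?_
    rw [show (fun ω => a p * (X (p.1 / scaling α l u) ω p.2 - X 0 ω p.2)
          * (a q * (X (q.1 / scaling α l u) ω q.2 - X 0 ω q.2)))
        = fun ω => (a p * a q) * ((X (p.1 / scaling α l u) ω p.2 - X 0 ω p.2)
          * (X (q.1 / scaling α l u) ω q.2 - X 0 ω q.2)) from funext fun ω => by ring,
      integral_const_mul]
    ring
  rw [h2]
  exact mul_nonneg (sq_nonneg u) (integral_nonneg fun _ => sq_nonneg _)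

/-- The limiting kernel is the Gram kernel of a Hölder continuous curve. -/
lemma LocalExpansion.exists_gram (hX : IsCenteredGRF X P) (hstat : IsStationary X P)
    (h : LocalExpansion (stationaryCov X P) w α l V) :
    ∃ (H : Type) (_ : NormedAddCommGroup H) (_ : InnerProductSpace ℝ H)
      (φ : (Fin k → ℝ) × Fin d → H), (∀ p q, inner ℝ (φ p) (φ q) = limitKernel V p q) ∧
      (∀ i, Continuous fun t => φ (t, i)) ∧
      ∃ C β ρ : ℝ, 0 < C ∧ 0 < β ∧ 0 < ρ ∧ ∀ s t : Fin k → ℝ, ‖s - t‖ ≤ ρ →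
        ∀ i, ‖φ (s, i) - φ (t, i)‖ ^ 2 ≤ C * ‖s - t‖ ^ β := by
  obtain ⟨H, i1, i2, φ, hφ⟩ := exists_inner_eq (limitKernel V)
    (limitKernel_symm (h.limit_neg hstat)) (h.limitKernel_nonneg hX hstat)
  -- Squared increments depend on `s - t` only, so the Hölder bound for `V` at the origin becomes a
  -- bound uniform in position.
  have hinc : ∀ s t i, ‖φ (s, i) - φ (t, i)‖ ^ 2 = V (s - t) i i + V (t - s) i i := fun s t i => by
    rw [← real_inner_self_eq_norm_sq, inner_sub_left, inner_sub_right, inner_sub_right, hφ, hφ, hφ,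
      hφ]
    simp only [limitKernel, Matrix.add_apply, Matrix.sub_apply, sub_self, h.apply_zero,
      Matrix.zero_apply]
    ring
  refine ⟨H, i1, i2, φ, hφ, fun i => continuous_iff_continuousAt.2 fun t => ?_, ?_⟩
  · refine tendsto_iff_norm_sub_tendsto_zero.2 ?_
    have h1 : Continuous fun s => V (s - t) i i + V (t - s) i i :=
      ((h.continuous.comp (continuous_id.sub continuous_const)).matrix_elem i i).add
        ((h.continuous.comp (continuous_const.sub continuous_id)).matrix_elem i i)
    have h2 := (h1.sqrt).tendsto t
    simp only [sub_self, h.apply_zero, Matrix.zero_apply, add_zero, Real.sqrt_zero] at h2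
    refine h2.congr fun s => ?_
    rw [← hinc, Real.sqrt_sq (norm_nonneg _)]
  · obtain ⟨C, β, ρ, hC, hβ, hρ, -, hV⟩ := h.exists_holder
    refine ⟨2 * C, β, ρ, by positivity, hβ, hρ, fun s t hst i => ?_⟩
    have h1 := le_of_abs_le (hV (s - t) hst i i)
    have h2 := le_of_abs_le (hV (t - s) (norm_sub_rev s t ▸ hst) i i)
    rw [norm_sub_rev t s] at h2
    rw [hinc]
    linarith

end LimitKernel

/-! ### Chaining on dyadic points -/

section Chaining

variable {k d : ℕ}

/-- The lattice points of order `n` with coordinates at most `4 ^ n`. -/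
noncomputable def dyadicBox (k n : ℕ) : Finset (Fin k → ℤ) :=
  Fintype.piFinset fun _ => Finset.Icc (-(4 ^ n)) (4 ^ n)

lemma card_dyadicBox_le (k n : ℕ) : ((dyadicBox k n).card : ℝ) ≤ (3 * 4 ^ n) ^ k := by
  have h : (dyadicBox k n).card = (2 * 4 ^ n + 1) ^ k := by
    simp only [dyadicBox, Fintype.card_piFinset_const, Int.card_Icc]
    congr 1
    have : ((4 ^ n : ℕ) : ℤ) = 4 ^ n := by push_cast; rfl
    rw [← this]
    omega
  rw [h]
  push_cast
  refine pow_le_pow_left₀ (by positivity) ?_ k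
  have : (1 : ℝ) ≤ 4 ^ n := one_le_pow₀ (by norm_num)
  linarith

/-- Coordinates up to `4 ^ m` at mesh `2 ^ (-m)` cover times up to about `2 ^ m`. Every fixed time
is thus eventually covered, while the number of lattice points grows only geometrically. -/
lemma dyadicFloor_mem_dyadicBox {n m : ℕ} {t : Fin k → ℝ} (hnm : n ≤ m) (ht : ‖t‖ + 1 ≤ 2 ^ n) :
    dyadicFloor m t ∈ dyadicBox k m := by
  have hm : ‖t‖ + 1 ≤ 2 ^ m := ht.trans (pow_le_pow_right₀ (by norm_num) hnm)
  have h1 : (1 : ℝ) ≤ 2 ^ m := one_le_pow₀ (by norm_num)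
  rw [dyadicBox, Fintype.mem_piFinset]
  intro i
  have hi : |t i| ≤ ‖t‖ := norm_le_pi_norm t i
  have h2 : |2 ^ m * t i| + 1 ≤ 4 ^ m := by
    rw [abs_mul, abs_of_pos (by positivity : (0 : ℝ) < 2 ^ m)]
    have : (4 : ℝ) ^ m = 2 ^ m * 2 ^ m := by rw [← mul_pow]; norm_num
    rw [this]
    nlinarith
  have h3 := abs_le.1 (le_sub_iff_add_le.2 h2)
  rw [Finset.mem_Icc, dyadicFloor]
  constructor
  · rw [Int.le_floor]
    push_cast
    linarith
  · have : (⌊2 ^ m * t i⌋ : ℝ) ≤ ((4 ^ m : ℤ) : ℝ) := by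
      push_cast
      linarith [Int.floor_le (2 ^ m * t i)]
    exact_mod_cast this

lemma norm_sub_dyadicPoint_le (n : ℕ) (t : Fin k → ℝ) :
    ‖t - dyadicPoint (n, dyadicFloor n t)‖ ≤ (1 / 2) ^ n := by
  refine (pi_norm_le_iff_of_nonneg (by positivity)).2 fun i => ?_
  have h2 : (0 : ℝ) < 2 ^ n := by positivity
  have e : (t - dyadicPoint (n, dyadicFloor n t)) i = Int.fract (2 ^ n * t i) / 2 ^ n := by
    simp only [Pi.sub_apply, dyadicPoint, dyadicFloor, Int.fract]
    field_simp
  rw [e, Real.norm_eq_abs, abs_of_nonneg (div_nonneg (Int.fract_nonneg _) h2.le), one_div, inv_pow,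
    div_eq_mul_inv]
  exact mul_le_of_le_one_left (by positivity) (Int.fract_lt_one _).le

/-- Values at dyadic points with uniformly small increments converge to a continuous path. -/
lemma exists_continuous_of_dyadic_increments {y : ℕ × (Fin k → ℤ) → Fin d → ℝ} {r : ℝ}
    (hr0 : 0 ≤ r) (hr1 : r < 1)
    (hy : ∀ᶠ n in atTop, ∀ m, n ≤ m → m ≤ n + 1 → ∀ z ∈ dyadicBox k n, ∀ z' ∈ dyadicBox k m,
      ‖dyadicPoint (n, z) - dyadicPoint (m, z')‖ ≤ 3 * (1 / 2) ^ n →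
        ‖y (n, z) - y (m, z')‖ ≤ r ^ n) :
    Continuous (pathOf y) ∧
      ∀ t, Tendsto (fun n => y (n, dyadicFloor n t)) atTop (𝓝 (pathOf y t)) := by
  -- The factor 3 in the hypothesis serves two uses: lattice points of consecutive orders next to
  -- the same time are within `2 · 2⁻ⁿ`, and those next to two times at distance at most `2⁻ⁿ` are
  -- within `3 · 2⁻ⁿ`.
  obtain ⟨N₀, hN₀⟩ := eventually_atTop.1 hy
  have hstep : ∀ N, N₀ ≤ N → ∀ t : Fin k → ℝ, ‖t‖ + 1 ≤ 2 ^ N → ∀ n,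
      dist (y (n + N, dyadicFloor (n + N) t)) (y (n + 1 + N, dyadicFloor (n + 1 + N) t))
        ≤ r ^ N * r ^ n := fun N hN t ht n => by
    rw [dist_eq_norm, ← pow_add, add_comm N n]
    refine hN₀ (n + N) (by omega) _ (by omega) (by omega) _
      (dyadicFloor_mem_dyadicBox (by omega) ht) _ (dyadicFloor_mem_dyadicBox (by omega) ht) ?_
    have h1 := norm_sub_dyadicPoint_le (n + N) t
    have h2 := norm_sub_dyadicPoint_le (n + 1 + N) t
    have h3 : ((1 : ℝ) / 2) ^ (n + 1 + N) ≤ (1 / 2) ^ (n + N) :=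
      pow_le_pow_of_le_one (by norm_num) (by norm_num) (by omega)
    have h4 := norm_sub_le (t - dyadicPoint (n + 1 + N, dyadicFloor (n + 1 + N) t))
      (t - dyadicPoint (n + N, dyadicFloor (n + N) t))
    rw [sub_sub_sub_cancel_left] at h4
    have h5 : (0 : ℝ) ≤ (1 / 2) ^ (n + N) := by positivity
    linarith
  have hlim : ∀ t, Tendsto (fun n => y (n, dyadicFloor n t)) atTop (𝓝 (pathOf y t)) := fun t => by
    obtain ⟨M, hM⟩ := pow_unbounded_of_one_lt (‖t‖ + 1) (one_lt_two (α := ℝ))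
    have ht : ‖t‖ + 1 ≤ 2 ^ (max N₀ M) :=
      hM.le.trans (pow_le_pow_right₀ (by norm_num) (le_max_right _ _))
    obtain ⟨x, hx⟩ := cauchySeq_tendsto_of_complete
      (cauchySeq_of_le_geometric r _ hr1 (hstep _ (le_max_left _ _) t ht))
    have hx' : Tendsto (fun n => y (n, dyadicFloor n t)) atTop (𝓝 x) :=
      (tendsto_add_atTop_iff_nat (max N₀ M)).1 hx
    rwa [pathOf_eq_of_tendsto hx']
  refine ⟨?_, hlim⟩
  have htail : ∀ N, N₀ ≤ N → ∀ t : Fin k → ℝ, ‖t‖ + 1 ≤ 2 ^ N →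
      dist (y (N, dyadicFloor N t)) (pathOf y t) ≤ r ^ N / (1 - r) := fun N hN t ht => by
    have := dist_le_of_le_geometric_of_tendsto₀ r _ hr1 (hstep N hN t ht)
      ((tendsto_add_atTop_iff_nat N).2 (hlim t))
    simpa using this
  rw [Metric.continuous_iff]
  intro t ε hε
  obtain ⟨M, hM⟩ := pow_unbounded_of_one_lt (‖t‖ + 2) (one_lt_two (α := ℝ))
  have hsmall : Tendsto (fun N : ℕ => 2 * (r ^ N / (1 - r)) + r ^ N) atTop (𝓝 0) := by
    have := tendsto_pow_atTop_nhds_zero_of_lt_one hr0 hr1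
    simpa using ((this.div_const (1 - r)).const_mul 2).add this
  obtain ⟨N, hN, hNM, hNN⟩ := ((hsmall.eventually_lt_const hε).and
    ((eventually_ge_atTop M).and (eventually_ge_atTop N₀))).exists
  have hpow : ‖t‖ + 2 ≤ 2 ^ N := hM.le.trans (pow_le_pow_right₀ (by norm_num) hNM)
  refine ⟨(1 / 2) ^ N, by positivity, fun s hs => ?_⟩
  rw [dist_eq_norm] at hs
  have hs1 : ‖s‖ ≤ ‖t‖ + 1 := by
    have h1 : ((1 : ℝ) / 2) ^ N ≤ 1 := pow_le_one₀ (by norm_num) (by norm_num)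
    have h2 := norm_le_norm_add_norm_sub t s
    rw [norm_sub_rev] at h2
    linarith
  have ht' : ‖t‖ + 1 ≤ 2 ^ N := by linarith
  have hs' : ‖s‖ + 1 ≤ 2 ^ N := by linarith
  have hmid : dist (y (N, dyadicFloor N s)) (y (N, dyadicFloor N t)) ≤ r ^ N := by
    rw [dist_eq_norm]
    refine hN₀ N hNN N le_rfl (by omega) _ (dyadicFloor_mem_dyadicBox le_rfl hs') _
      (dyadicFloor_mem_dyadicBox le_rfl ht') ?_
    have h1 := norm_sub_dyadicPoint_le N t
    have h2 := norm_sub_dyadicPoint_le N s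
    have e : dyadicPoint (N, dyadicFloor N s) - dyadicPoint (N, dyadicFloor N t)
        = (t - dyadicPoint (N, dyadicFloor N t)) + (s - t)
          - (s - dyadicPoint (N, dyadicFloor N s)) := by abel
    rw [e]
    refine (norm_sub_le _ _).trans ?_
    have := norm_add_le (t - dyadicPoint (N, dyadicFloor N t)) (s - t)
    linarith
  have h1 := htail N hNN t ht'
  have h2 := htail N hNN s hs'
  rw [dist_comm] at h2
  have h3 := dist_triangle4 (pathOf y s) (y (N, dyadicFloor N s)) (y (N, dyadicFloor N t))
    (pathOf y t)
  linarith

end Chaining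

/-! ### Gaussian tail bound and almost sure limits -/

section GaussianLimit

variable {Ω : Type*} [MeasurableSpace Ω] {P : Measure Ω} [IsProbabilityMeasure P]

/-- A polynomial tail bound of arbitrary order for centered Gaussian variables. -/
lemma real_lt_abs_le_of_gaussian {Z : Ω → ℝ} (hZm : Measurable Z) {v c r : ℝ}
    (hZ : P.map Z = gaussianReal 0 v.toNNReal) (hv : 0 ≤ v) (hvc : v ≤ c) (hc : 0 < c)
    (hr : 0 < r) (m : ℕ) :
    P.real {ω | r < |Z ω|} ≤ 2 * (m.factorial * (2 * c / r ^ 2) ^ m) := by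
  have key : ∀ {Z : Ω → ℝ}, Measurable Z → P.map Z = gaussianReal 0 v.toNNReal →
      P.real {ω | r ≤ Z ω} ≤ m.factorial * (2 * c / r ^ 2) ^ m := by
    intro Z hZm hZ
    -- The tilt `r / c` gives the bound `exp(-r² / (2c))`, which `y ^ m / m! ≤ exp y` turns into a
    -- polynomial one. Using `c > 0` instead of the variance covers the degenerate case.
    have hint : Integrable (fun ω => Real.exp (r / c * Z ω)) P := by
      have := integrable_exp_mul_gaussianReal (μ := 0) (v := v.toNNReal) (r / c)
      rw [← hZ] at this
      exact this.comp_measurable hZm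
    refine (measure_ge_le_exp_mul_mgf r (by positivity : 0 ≤ r / c) hint).trans ?_
    rw [mgf_gaussianReal hZ, ← Real.exp_add, Real.coe_toNNReal _ hv]
    have hx : 0 < r ^ 2 / (2 * c) := by positivity
    have h1 : -(r / c) * r + (0 * (r / c) + v * (r / c) ^ 2 / 2) ≤ -(r ^ 2 / (2 * c)) := by
      have : v * (r / c) ^ 2 ≤ c * (r / c) ^ 2 := mul_le_mul_of_nonneg_right hvc (sq_nonneg _)
      have e1 : c * (r / c) ^ 2 = r ^ 2 / c := by field_simp
      have e2 : -(r / c) * r = -(r ^ 2 / c) := by ring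
      have e3 : r ^ 2 / (2 * c) = r ^ 2 / c / 2 := by field_simp
      rw [e2, e3]
      linarith
    refine (Real.exp_le_exp.2 h1).trans ?_
    have h2 := Real.pow_div_factorial_le_exp _ hx.le m
    have h3 : 0 < (r ^ 2 / (2 * c)) ^ m / m.factorial := by positivity
    rw [Real.exp_neg]
    refine (inv_anti₀ h3 h2).trans_eq ?_
    rw [inv_div, div_eq_mul_inv, ← inv_pow, inv_div]
  have hneg : P.map (fun ω => -Z ω) = gaussianReal 0 v.toNNReal := by
    have : P.map (fun ω => -Z ω) = (P.map Z).map (fun x => -x) :=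
      (Measure.map_map measurable_neg hZm).symm
    rw [this, hZ, gaussianReal_map_neg, neg_zero]
  have hsub : {ω | r < |Z ω|} ⊆ {ω | r ≤ Z ω} ∪ {ω | r ≤ -Z ω} := fun ω hω => by
    rcases lt_abs.1 (show r < |Z ω| from hω) with h | h
    · exact Or.inl h.le
    · exact Or.inr h.le
  have := (measureReal_mono hsub (measure_ne_top P _)).trans (measureReal_union_le _ _)
  have h2 : P.real {ω | r ≤ -Z ω} ≤ m.factorial * (2 * c / r ^ 2) ^ m := key hZm.neg hneg
  linarith [key hZm hZ]

/-- An almost sure limit of centered Gaussian variables is Gaussian. -/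
lemma map_eq_gaussianReal_of_tendsto_ae {L : ℕ → Ω → ℝ} {L' : Ω → ℝ} {v : ℕ → ℝ} {v' : ℝ}
    (hLm : ∀ n, Measurable (L n)) (hLm' : Measurable L') (hv0 : ∀ n, 0 ≤ v n)
    (hL : ∀ n, P.map (L n) = gaussianReal 0 (v n).toNNReal)
    (hlim : ∀ᵐ ω ∂P, Tendsto (fun n => L n ω) atTop (𝓝 (L' ω)))
    (hv : Tendsto v atTop (𝓝 v')) : P.map L' = gaussianReal 0 v'.toNNReal := by
  have hv0' : 0 ≤ v' := ge_of_tendsto' hv hv0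
  have : IsProbabilityMeasure (P.map L') := Measure.isProbabilityMeasure_map hLm'.aemeasurable
  refine Measure.ext_of_charFun ?_
  ext x
  have h1 : ∀ {g : Ω → ℝ}, Measurable g →
      charFun (P.map g) x = ∫ ω, Complex.exp (x * g ω * Complex.I) ∂P := fun hg => by
    rw [charFun_apply_real, integral_map hg.aemeasurable (by fun_prop)]
  have h2 : ∀ {z : ℝ}, 0 ≤ z →
      charFun (gaussianReal 0 z.toNNReal) x = Complex.exp (-(x ^ 2 * z / 2 : ℝ)) := fun hz => by
    rw [charFun_gaussianReal, Real.coe_toNNReal _ hz]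
    congr 1
    push_cast
    ring
  rw [h1 hLm', h2 hv0']
  have h3 : Tendsto (fun n => ∫ ω, Complex.exp (x * L n ω * Complex.I) ∂P) atTop
      (𝓝 (∫ ω, Complex.exp (x * L' ω * Complex.I) ∂P)) := by
    refine tendsto_integral_of_dominated_convergence (fun _ => (1 : ℝ)) (fun n => ?_)
      (integrable_const _) (fun n => Eventually.of_forall fun ω => ?_) ?_
    · have := hLm n
      exact Measurable.aestronglyMeasurable (by fun_prop)
    · rw [← Complex.ofReal_mul, Complex.norm_exp_ofReal_mul_I]
    · filter_upwards [hlim] with ω hω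
      have h4 : Continuous fun y : ℝ => Complex.exp (x * y * Complex.I) := by fun_prop
      exact (h4.tendsto _).comp hω
  refine tendsto_nhds_unique h3 ?_
  have h5 : Continuous fun z : ℝ => Complex.exp (-(x ^ 2 * z / 2 : ℝ)) := by fun_prop
  refine ((h5.tendsto v').comp hv).congr fun n => ?_
  rw [← h1 (hLm n), hL, h2 (hv0 n), Function.comp]

end GaussianLimit

/-! ### Gaussian fields from their linear combinations -/

section GaussianField

variable {Ω : Type*} [MeasurableSpace Ω] {P : Measure Ω}

/-- A field all of whose linear combinations are centered Gaussian is a centered Gaussian field. -/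
lemma isCenteredGRF_of_linear {k d : ℕ} {Y : (Fin k → ℝ) → Ω → (Fin d → ℝ)}
    (hY : ∀ t, Measurable (Y t))
    {H : Type*} [NormedAddCommGroup H] [InnerProductSpace ℝ H] {φ : (Fin k → ℝ) × Fin d → H}
    (h : ∀ {ι : Type} (s : Finset ι) (p : ι → (Fin k → ℝ) × Fin d) (a : ι → ℝ),
      P.map (fun ω => ∑ j ∈ s, a j * Y (p j).1 ω (p j).2)
        = gaussianReal 0 (‖∑ j ∈ s, a j • φ (p j)‖ ^ 2).toNNReal) :
    IsCenteredGRF Y P ∧ ∀ s t i j, covMatrix Y P s t i j = inner ℝ (φ (s, i)) (φ (t, j)) := by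
  have hm : ∀ t i, Measurable fun ω => Y t ω i := fun t i => (measurable_pi_apply i).comp (hY t)
  have hone : ∀ t i, P.map (fun ω => Y t ω i) = gaussianReal 0 (‖φ (t, i)‖ ^ 2).toNNReal :=
    fun t i => by simpa using h {()} (fun _ => (t, i)) (fun _ => 1)
  have htwo : ∀ s t i j, P.map (fun ω => Y s ω i + Y t ω j)
      = gaussianReal 0 (‖φ (s, i) + φ (t, j)‖ ^ 2).toNNReal := fun s t i j => by
    simpa using h (Finset.univ : Finset (Fin 2)) ![(s, i), (t, j)] (fun _ => 1)
  have hsq : ∀ {g : Ω → ℝ} {v : ℝ}, Measurable g → 0 ≤ v → P.map g = gaussianReal 0 v.toNNReal →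
      Integrable (fun ω => g ω ^ 2) P ∧ ∫ ω, g ω ^ 2 ∂P = v := fun {g v} hg hv hl => by
    have h1 : MemLp id 2 (P.map g) := by rw [hl]; exact IsGaussian.memLp_two_id
    have h2 : MemLp g 2 P := h1.comp_of_map hg.aemeasurable
    refine ⟨h2.integrable_sq, ?_⟩
    have h3 : ∫ ω, g ω ∂P = 0 := by
      have : ∫ ω, g ω ∂P = ∫ y, y ∂(P.map g) :=
        (integral_map hg.aemeasurable aestronglyMeasurable_id).symm
      rw [this, hl, integral_id_gaussianReal]
    have h4 : Var[g; P] = v := by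
      have : Var[g; P] = Var[id; P.map g] := (variance_map aemeasurable_id hg.aemeasurable).symm
      rw [this, hl, variance_id_gaussianReal, Real.coe_toNNReal _ hv]
    rw [← h4, variance_of_integral_eq_zero hg.aemeasurable h3]
  refine ⟨⟨⟨fun I => ⟨isGaussian_of_map_eq_gaussianReal fun L => ?_⟩⟩, fun t i => ?_⟩,
    fun s t i j => ?_⟩
  · classical
    refine ⟨0, (‖∑ q : I × Fin d, L (Pi.single q.1 (Pi.single q.2 1)) •
      φ ((q.1 : Fin k → ℝ), q.2)‖ ^ 2).toNNReal, ?_⟩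
    have hR : Measurable fun ω => I.restrict (Y · ω) := measurable_pi_lambda _ fun j => hY j
    rw [Measure.map_map L.continuous.measurable hR, ← h]
    congr 1
    ext ω
    have e : ∀ x : I → Fin d → ℝ, L x = ∑ q : I × Fin d,
        L (Pi.single q.1 (Pi.single q.2 1)) * x q.1 q.2 := fun x => by
      conv_lhs => rw [← Finset.univ_sum_single x, map_sum]
      rw [Fintype.sum_prod_type]
      refine Finset.sum_congr rfl fun j _ => ?_
      have := congrFun (dual_eq_dotProduct (L.comp (ContinuousLinearMap.single ℝ (fun _ : I => Fin d → ℝ) j))) (x j)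
      simpa [dotProduct] using this
    exact e _
  · have : ∫ ω, Y t ω i ∂P = ∫ y, y ∂(P.map fun ω => Y t ω i) :=
      (integral_map (hm t i).aemeasurable aestronglyMeasurable_id).symm
    rw [this, hone, integral_id_gaussianReal]
  · obtain ⟨i1, e1⟩ := hsq (hm s i) (sq_nonneg _) (hone s i)
    obtain ⟨i2, e2⟩ := hsq (hm t j) (sq_nonneg _) (hone t j)
    have hadd : Measurable fun ω => Y s ω i + Y t ω j := (hm s i).add (hm t j)
    obtain ⟨i3, e3⟩ := hsq hadd (sq_nonneg _) (htwo s t i j)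
    -- Polarization: only the laws of single linear combinations are given.
    have e : ∀ ω, Y s ω i * Y t ω j
        = ((Y s ω i + Y t ω j) ^ 2 - (Y s ω i ^ 2 + Y t ω j ^ 2)) / 2 := fun ω => by ring
    have i4 : Integrable (fun ω => Y s ω i ^ 2 + Y t ω j ^ 2) P := i1.add i2
    simp only [covMatrix, Matrix.of_apply]
    simp_rw [e]
    rw [integral_div, integral_sub i3 i4, integral_add i1 i2, e1, e2, e3, norm_add_sq_real]
    ring

end GaussianField

/-! ### Borel–Cantelli for dyadic increments -/

section DyadicIncrements

lemma _root_.Measurable.pathOf {Ω : Type*} [MeasurableSpace Ω] {k d : ℕ}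
    {y : Ω → ℕ × (Fin k → ℤ) → Fin d → ℝ} (hy : Measurable y) (t : Fin k → ℝ) :
    Measurable fun ω => pathOf (y ω) t := by
  refine measurable_pi_lambda _ fun i => Measurable.limsup fun n => ?_
  exact (measurable_pi_apply i).comp ((measurable_pi_apply (n, dyadicFloor n t)).comp hy)

variable {Ω : Type*} [MeasurableSpace Ω] {P : Measure Ω} [IsProbabilityMeasure P] {k d : ℕ}

/-- Gaussian variables at dyadic points with Hölder continuous variance of increments almost surely
have uniformly small increments. -/
lemma ae_dyadic_increments {G : (ℕ × (Fin k → ℤ)) × Fin d → Ω → ℝ} (hG : ∀ p, Measurable (G p))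
    {g : (ℕ × (Fin k → ℤ)) × Fin d → (ℕ × (Fin k → ℤ)) × Fin d → ℝ} (hg0 : ∀ p q, 0 ≤ g p q)
    (hlaw : ∀ p q, P.map (fun ω => G p ω - G q ω) = gaussianReal 0 (g p q).toNNReal)
    {C β ρ : ℝ} (hC : 0 < C) (hβ : 0 < β) (hρ : 0 < ρ)
    (hg : ∀ p q : ℕ × (Fin k → ℤ), ‖dyadicPoint p - dyadicPoint q‖ ≤ ρ →
      ∀ i, g (p, i) (q, i) ≤ C * ‖dyadicPoint p - dyadicPoint q‖ ^ β) :
    ∃ r : ℝ, 0 ≤ r ∧ r < 1 ∧ ∀ᵐ ω ∂P, ∀ᶠ n in atTop, ∀ m, n ≤ m → m ≤ n + 1 →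
      ∀ z ∈ dyadicBox k n, ∀ z' ∈ dyadicBox k m,
        ‖dyadicPoint (n, z) - dyadicPoint (m, z')‖ ≤ 3 * (1 / 2) ^ n →
          ‖(fun i => G ((n, z), i) ω) - (fun i => G ((m, z'), i) ω)‖ ≤ r ^ n := by
  -- Increments of order `n` have variance of order `2 ^ (-β n) = r ^ (4 n)`; divided by the squared
  -- threshold `r ^ (2 n)` this leaves `r ^ (2 n)`.
  set r : ℝ := (1 / 2) ^ (β / 4) with hr
  have hr0 : 0 < r := by positivity
  have hr1 : r < 1 := Real.rpow_lt_one (by norm_num) (by norm_num) (by positivity)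
  have hr4 : ((1 : ℝ) / 2) ^ β = r ^ 4 := by
    rw [hr, ← Real.rpow_natCast, ← Real.rpow_mul (by norm_num)]
    congr 1
    push_cast
    ring
  -- The order `M` of the tail bound must beat the number of pairs of lattice points, which grows
  -- like `16 ^ (k n)`.
  obtain ⟨M, hM⟩ : ∃ M : ℕ, 16 ^ k * (r ^ 2) ^ M < 1 := by
    obtain ⟨M, hM⟩ := exists_pow_lt_of_lt_one (inv_pos.2 (by positivity : (0 : ℝ) < 16 ^ k))
      (pow_lt_one₀ hr0.le hr1 two_ne_zero)
    exact ⟨M, by rwa [lt_inv_comm₀ (by positivity) (by positivity), ← one_div,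
      lt_div_iff₀ (by positivity)] at hM⟩
  refine ⟨r, hr0.le, hr1, ?_⟩
  obtain ⟨N₀, hN₀⟩ : ∃ N₀ : ℕ, ∀ n, N₀ ≤ n → 3 * (1 / 2 : ℝ) ^ n ≤ ρ := by
    have h1 : Tendsto (fun n : ℕ => 3 * (1 / 2 : ℝ) ^ n) atTop (𝓝 0) := by
      simpa using (tendsto_pow_atTop_nhds_zero_of_lt_one (r := (1 / 2 : ℝ)) (by norm_num)
        (by norm_num)).const_mul 3
    exact eventually_atTop.1 (h1.eventually_le_const hρ)
  classical
  set S : ℕ → Finset ((ℕ × (Fin k → ℤ) × (Fin k → ℤ)) × Fin d) := fun n =>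
    ((({n} ×ˢ dyadicBox k n ×ˢ dyadicBox k n) ∪ ({n + 1} ×ˢ dyadicBox k n ×ˢ dyadicBox k (n + 1)))
      ×ˢ Finset.univ).filter fun q =>
        ‖dyadicPoint (n, q.1.2.1) - dyadicPoint (q.1.1, q.1.2.2)‖ ≤ 3 * (1 / 2) ^ n with hS
  set B : ℕ → Set Ω := fun n => ⋃ q ∈ S n,
    {ω | r ^ n < |G ((n, q.1.2.1), q.2) ω - G ((q.1.1, q.1.2.2), q.2) ω|} with hB
  have hcard : ∀ n, ((S n).card : ℝ) ≤ 2 * 12 ^ k * 12 ^ k * d * (16 ^ k) ^ n := fun n => by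
    have h1 : (S n).card ≤ ((dyadicBox k n).card * (dyadicBox k n).card
        + (dyadicBox k n).card * (dyadicBox k (n + 1)).card) * d := by
      refine (Finset.card_filter_le _ _).trans ?_
      rw [Finset.card_product, Finset.card_univ, Fintype.card_fin]
      refine Nat.mul_le_mul_right _ ((Finset.card_union_le _ _).trans_eq ?_)
      simp [Finset.card_product]
    have h2 : ((dyadicBox k n).card : ℝ) ≤ 12 ^ k * (4 ^ k) ^ n := by
      refine (card_dyadicBox_le k n).trans ?_
      rw [mul_pow, pow_right_comm]
      gcongr
      norm_num
    have h3 : ((dyadicBox k (n + 1)).card : ℝ) ≤ 12 ^ k * (4 ^ k) ^ n := by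
      refine (card_dyadicBox_le k (n + 1)).trans_eq ?_
      rw [pow_right_comm, ← mul_pow]
      ring_nf
    have h4 : ((S n).card : ℝ) ≤ ((dyadicBox k n).card * (dyadicBox k n).card
        + (dyadicBox k n).card * (dyadicBox k (n + 1)).card) * d := by exact_mod_cast h1
    refine h4.trans ?_
    have h5 : (16 : ℝ) ^ k = 4 ^ k * 4 ^ k := by rw [← mul_pow]; norm_num
    calc _ ≤ ((12 ^ k * (4 ^ k) ^ n) * (12 ^ k * (4 ^ k) ^ n)
        + (12 ^ k * (4 ^ k) ^ n) * (12 ^ k * (4 ^ k) ^ n) : ℝ) * d := by gcongr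
      _ = _ := by rw [h5, mul_pow]; ring
  set c : ℝ := C * 3 ^ β with hc
  have hc0 : 0 < c := by positivity
  have hmeas : ∀ n, N₀ ≤ n → P.real (B n)
      ≤ 2 * 12 ^ k * 12 ^ k * d * (2 * (M.factorial * (2 * c) ^ M)) * (16 ^ k * (r ^ 2) ^ M) ^ n :=
      fun n hn => by
    have h1 : ∀ q ∈ S n,
        P.real {ω | r ^ n < |G ((n, q.1.2.1), q.2) ω - G ((q.1.1, q.1.2.2), q.2) ω|}
          ≤ 2 * (M.factorial * (2 * c) ^ M) * ((r ^ 2) ^ M) ^ n := fun q hq => by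
      have hq' := (Finset.mem_filter.1 hq).2
      have h2 := hg _ _ (hq'.trans (hN₀ n hn)) q.2
      have h3 : g ((n, q.1.2.1), q.2) ((q.1.1, q.1.2.2), q.2) ≤ c * (r ^ 4) ^ n := by
        refine h2.trans ?_
        rw [hc, mul_assoc]
        refine mul_le_mul_of_nonneg_left ?_ hC.le
        refine (Real.rpow_le_rpow (norm_nonneg _) hq' hβ.le).trans_eq ?_
        rw [Real.mul_rpow (by norm_num) (by positivity), ← hr4, ← Real.rpow_natCast,
          ← Real.rpow_natCast, ← Real.rpow_mul (by norm_num), ← Real.rpow_mul (by norm_num),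
          mul_comm β]
      refine (real_lt_abs_le_of_gaussian ((hG _).sub (hG _)) (hlaw _ _) (hg0 _ _) h3
        (by positivity) (by positivity) M).trans_eq ?_
      have e : 2 * (c * (r ^ 4) ^ n) / (r ^ n) ^ 2 = 2 * c * (r ^ 2) ^ n := by
        field_simp
        ring
      rw [e, mul_pow _ _ M, pow_right_comm (r ^ 2)]
      ring
    calc P.real (B n) ≤ ∑ q ∈ S n,
          P.real {ω | r ^ n < |G ((n, q.1.2.1), q.2) ω - G ((q.1.1, q.1.2.2), q.2) ω|} :=
          measureReal_biUnion_finset_le _ _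
      _ ≤ ∑ q ∈ S n, 2 * (M.factorial * (2 * c) ^ M) * ((r ^ 2) ^ M) ^ n := Finset.sum_le_sum h1
      _ = (S n).card * (2 * (M.factorial * (2 * c) ^ M) * ((r ^ 2) ^ M) ^ n) := by
          rw [Finset.sum_const, nsmul_eq_mul]
      _ ≤ (2 * 12 ^ k * 12 ^ k * d * (16 ^ k) ^ n)
          * (2 * (M.factorial * (2 * c) ^ M) * ((r ^ 2) ^ M) ^ n) :=
          mul_le_mul_of_nonneg_right (hcard n) (by positivity)
      _ = _ := by rw [mul_pow]; ring
  set K : ℝ := 2 * 12 ^ k * 12 ^ k * d * (2 * (M.factorial * (2 * c) ^ M)) with hK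
  have hsum : ∑' n, P (B (n + N₀)) ≠ ∞ := by
    have h1 : Summable fun n : ℕ => K * (16 ^ k * (r ^ 2) ^ M) ^ (n + N₀) :=
      ((summable_nat_add_iff N₀).2
        (summable_geometric_of_lt_one (by positivity) hM)).mul_left K
    refine ne_top_of_le_ne_top h1.tsum_ofReal_ne_top (ENNReal.tsum_le_tsum fun n => ?_)
    rw [← ofReal_measureReal (measure_ne_top P _)]
    exact ENNReal.ofReal_le_ofReal (hmeas _ (Nat.le_add_left _ _))
  filter_upwards [ae_eventually_notMem hsum] with ω hω
  have hω' := hω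
  rw [eventually_atTop] at hω' ⊢
  obtain ⟨N, hN⟩ := hω'
  refine ⟨N + N₀, fun n hn m hnm hmn z hz z' hz' hd => ?_⟩
  have h1 := hN (n - N₀) (by omega)
  rw [Nat.sub_add_cancel (by omega)] at h1
  refine (pi_norm_le_iff_of_nonneg (by positivity)).2 fun i => ?_
  by_contra hcon
  refine h1 (Set.mem_iUnion₂.2 ⟨((m, z, z'), i), ?_, not_le.1 hcon⟩)
  refine Finset.mem_filter.2 ⟨?_, hd⟩
  rcases (by omega : m = n ∨ m = n + 1) with rfl | rfl
  · simp [hz, hz']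
  · simp [hz, hz']

end DyadicIncrements

/-! ### Existence of the limit pair -/

section Existence

variable {Ω : Type*} [MeasurableSpace Ω] {P : Measure Ω} {k d : ℕ}
  {X : (Fin k → ℝ) → Ω → (Fin d → ℝ)} {w : Fin d → ℝ}
  {α : Fin k → ℝ} {l : Fin k → ℝ → ℝ} {V : (Fin k → ℝ) → Matrix (Fin d) (Fin d) ℝ}

/-- A continuous centered Gaussian field with the limiting covariance function exists. -/
lemma LocalExpansion.exists_limit_field (hX : IsCenteredGRF X P) (hstat : IsStationary X P)
    (h : LocalExpansion (stationaryCov X P) w α l V) :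
    ∃ Y : (Fin k → ℝ) → (ℕ → ℝ) → (Fin d → ℝ), (∀ t, Measurable (Y t)) ∧
      IsCenteredGRF Y noiseLaw ∧ (∀ᵐ ω ∂noiseLaw, Continuous fun t => Y t ω) ∧
      ∀ t s, covMatrix Y noiseLaw t s = V t + V (-s) - V (t - s) := by
  obtain ⟨H, i1, i2, φ, hφ, hφc, C, β, ρ, hC, hβ, hρ, hinc⟩ := h.exists_gram hX hstat
  obtain ⟨G, hGm, hG⟩ := exists_gaussian_family
    (fun p : (ℕ × (Fin k → ℤ)) × Fin d => φ (dyadicPoint p.1, p.2))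
  have hdiff : ∀ p q, noiseLaw.map (fun ω => G p ω - G q ω) = gaussianReal 0
      (‖φ (dyadicPoint p.1, p.2) - φ (dyadicPoint q.1, q.2)‖ ^ 2).toNNReal := fun p q => by
    simpa [sub_eq_add_neg] using hG (Finset.univ : Finset (Fin 2)) ![p, q] ![1, -1]
  obtain ⟨r, hr0, hr1, hr⟩ := ae_dyadic_increments hGm (fun p q => sq_nonneg _) hdiff hC hβ hρ
    fun p q hpq i => hinc _ _ hpq i
  obtain ⟨y, hy⟩ : ∃ y : (ℕ → ℝ) → ℕ × (Fin k → ℤ) → Fin d → ℝ, ∀ ω p i, y ω p i = G (p, i) ω :=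
    ⟨fun ω p i => G (p, i) ω, fun _ _ _ => rfl⟩
  have hym : Measurable y := measurable_pi_lambda _ fun p => measurable_pi_lambda _ fun i => by
    simp_rw [hy]
    exact hGm _
  simp_rw [← hy] at hr
  have hpath : ∀ᵐ ω ∂noiseLaw, Continuous (pathOf (y ω)) ∧
      ∀ t, Tendsto (fun n => y ω (n, dyadicFloor n t)) atTop (𝓝 (pathOf (y ω) t)) := by
    filter_upwards [hr] with ω hω
    exact exists_continuous_of_dyadic_increments hr0 hr1 hω
  have hYm : ∀ t, Measurable fun ω => pathOf (y ω) t := hym.pathOf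
  -- Values of the path are almost sure limits of dyadic values with Gaussian linear combinations,
  -- and continuity of `φ` makes the variances converge, so Gaussianity survives in the limit.
  have hlin : ∀ {ι : Type} (s : Finset ι) (p : ι → (Fin k → ℝ) × Fin d) (a : ι → ℝ),
      noiseLaw.map (fun ω => ∑ j ∈ s, a j * pathOf (y ω) (p j).1 (p j).2)
        = gaussianReal 0 (‖∑ j ∈ s, a j • φ (p j)‖ ^ 2).toNNReal := by
    intro ι s p a
    have h1 : ∀ n, Measurable fun ω => ∑ j ∈ s, a j * G ((n, dyadicFloor n (p j).1), (p j).2) ω :=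
      fun n => Finset.measurable_fun_sum _ fun j _ => (hGm _).const_mul _
    have h2 : Measurable fun ω => ∑ j ∈ s, a j * pathOf (y ω) (p j).1 (p j).2 :=
      Finset.measurable_fun_sum _ fun j _ =>
        ((measurable_pi_apply (p j).2).comp (hYm (p j).1)).const_mul _
    have h3 : ∀ n, noiseLaw.map
          (fun ω => ∑ j ∈ s, a j * G ((n, dyadicFloor n (p j).1), (p j).2) ω)
        = gaussianReal 0 (‖∑ j ∈ s,
          a j • φ (dyadicPoint (n, dyadicFloor n (p j).1), (p j).2)‖ ^ 2).toNNReal := fun n =>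
      hG s (fun j => ((n, dyadicFloor n (p j).1), (p j).2)) a
    refine map_eq_gaussianReal_of_tendsto_ae h1 h2 (fun n => sq_nonneg _) h3 ?_ ?_
    · filter_upwards [hpath] with ω hω
      exact tendsto_finsetSum _ fun j _ =>
        ((tendsto_pi_nhds.1 (hω.2 (p j).1) (p j).2).congr fun n => hy _ _ _).const_mul (a j)
    · refine ((tendsto_finsetSum _ fun j _ => ?_).norm).pow 2
      have h4 : Tendsto (fun t => φ (t, (p j).2)) (𝓝 (p j).1) (𝓝 (φ (p j))) :=
        (hφc (p j).2).tendsto (p j).1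
      exact (h4.comp (tendsto_dyadicPoint _)).const_smul (a j)
  obtain ⟨hgrf, hcov⟩ := isCenteredGRF_of_linear (P := noiseLaw) (Y := fun t ω => pathOf (y ω) t)
    hYm hlin
  refine ⟨fun t ω => pathOf (y ω) t, hYm, hgrf, hpath.mono fun ω hω => hω.1, fun t s => ?_⟩
  ext i j
  rw [hcov, hφ]
  rfl

/-- The limit pair exists. -/
lemma LocalExpansion.exists_limitPair (hX : IsCenteredGRF X P) (hstat : IsStationary X P)
    (h : LocalExpansion (stationaryCov X P) w α l V) :
    ∃ (Y : (Fin k → ℝ) → (ℕ → ℝ) × (Fin d → ℝ) → (Fin d → ℝ))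
      (E : (ℕ → ℝ) × (Fin d → ℝ) → (Fin d → ℝ)),
      IsLimitPair V Y E (noiseLaw.prod (expLaw d)) := by
  obtain ⟨Y, hYm, hgrf, hcont, hcov⟩ := h.exists_limit_field hX hstat
  have := isProbabilityMeasure_expMeasure one_pos
  have hfst : MeasurePreserving Prod.fst (noiseLaw.prod (expLaw d)) noiseLaw :=
    measurePreserving_fst
  have hsnd : MeasurePreserving Prod.snd (noiseLaw.prod (expLaw d)) (expLaw d) :=
    measurePreserving_snd
  have hint : ∀ f : (ℕ → ℝ) → ℝ,
      ∫ ω, f ω.1 ∂(noiseLaw.prod (expLaw d)) = ∫ ω, f ω ∂noiseLaw := fun f => by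
    rw [integral_fun_fst]
    simp
  refine ⟨fun t ω => Y t ω.1, fun ω => ω.2, ⟨⟨fun I => ⟨?_⟩⟩, fun t i => ?_⟩, ?_, fun t s => ?_,
    fun i => ?_, ?_, ?_⟩
  · have hR : Measurable fun ω => I.restrict (Y · ω) := measurable_pi_lambda _ fun j => hYm j
    have h1 : (noiseLaw.prod (expLaw d)).map (fun ω => I.restrict (Y · ω.1))
        = noiseLaw.map fun ω => I.restrict (Y · ω) := by
      conv_rhs => rw [← hfst.map_eq]
      exact (Measure.map_map hR measurable_fst).symm
    rw [h1]
    exact (hgrf.gaussian.hasGaussianLaw I).isGaussian_map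
  · rw [hint fun ω => Y t ω i, hgrf.centered]
  · exact hfst.quasiMeasurePreserving.ae hcont
  · rw [← hcov]
    ext i j
    exact hint fun ω => Y t ω i * Y s ω j
  · exact ⟨by fun_prop, ((measurePreserving_eval (fun _ : Fin d => expMeasure 1) i).comp hsnd).map_eq⟩
  · have h1 : iIndepFun (fun (i : Fin d) (x : Fin d → ℝ) => x i) (expLaw d) :=
      iIndepFun_pi (X := fun _ x => x) fun i => aemeasurable_id
    rw [iIndepFun_iff_map_fun_eq_pi_map fun i => (measurable_pi_apply i).aemeasurable] at h1
    rw [iIndepFun_iff_map_fun_eq_pi_map fun i => by fun_prop]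
    have e : ∀ {γ : Type} [MeasurableSpace γ] {g : (Fin d → ℝ) → γ}, Measurable g →
        (noiseLaw.prod (expLaw d)).map (fun ω => g ω.2) = (expLaw d).map g := fun hg => by
      conv_rhs => rw [← hsnd.map_eq]
      exact (Measure.map_map hg measurable_snd).symm
    rw [e (g := fun x i => x i) (by fun_prop), h1]
    congr 1
    ext1 i
    exact (e (measurable_pi_apply i)).symm
  · exact indepFun_prod (measurable_pi_lambda _ hYm) measurable_id

end Existence

end Sojourn

theorem mainTheorem1
    {Ω : Type*} [MeasurableSpace Ω] (P : Measure Ω) [IsProbabilityMeasure P]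
    (k d : ℕ) (hk : 0 < k)
    (X : (Fin k → ℝ) → Ω → (Fin d → ℝ))
    (hX : Sojourn.IsCenteredGRF X P)
    (hstat : Sojourn.IsStationary X P)
    (hmeas : AEMeasurable (fun p : Ω × (Fin k → ℝ) => X p.2 p.1) (P.prod volume))
    (b : Fin d → ℝ) (hb : ∃ i, 0 < b i)
    (hSigma : IsUnit (Sojourn.stationaryCov X P 0).det)
    (w : Fin d → ℝ) (hw : w = (Sojourn.stationaryCov X P 0)⁻¹ *ᵥ b) (hwpos : ∀ i, 0 < w i)
    (hB0 : Continuous (Sojourn.stationaryCov X P))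
    (hB1 : ∀ t : Fin k → ℝ, t ≠ 0 →
      Sojourn.IsPosDef (Sojourn.stationaryCov X P 0 - Sojourn.stationaryCov X P t))
    (α : Fin k → ℝ) (l : Fin k → ℝ → ℝ) (V : (Fin k → ℝ) → Matrix (Fin d) (Fin d) ℝ)
    (hB2 : Sojourn.LocalExpansion (Sojourn.stationaryCov X P) w α l V)
    (T : ℝ) (hT : 0 < T) :
    (∃ (Ω' : Type) (_ : MeasurableSpace Ω') (P' : Measure Ω')
        (Y : (Fin k → ℝ) → Ω' → (Fin d → ℝ)) (E : Ω' → (Fin d → ℝ)),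
        Sojourn.IsLimitPair V Y E P') ∧
    (∀ u : ℝ, 0 < u →
      ∫ ω, Sojourn.sojournTime X b T u ω ∂P = T ^ k * P.real {ω | ∀ i, u * b i < X 0 ω i}) ∧
    (∀ (Ω' : Type*) [MeasurableSpace Ω'] (P' : Measure Ω')
        (Y : (Fin k → ℝ) → Ω' → (Fin d → ℝ)) (E : Ω' → (Fin d → ℝ)),
        Sojourn.IsLimitPair V Y E P' →
      ∀ x : ℝ, 0 < x →
        Tendsto
          (fun u : ℝ =>
            (∫ y in Set.Ioc 0 x, y
                ∂(P.map (fun ω => Sojourn.theta α l u * Sojourn.sojournTime X b T u ω))) /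
              (Sojourn.theta α l u * ∫ ω, Sojourn.sojournTime X b T u ω ∂P))
          atTop (𝓝 (Sojourn.distFun (Sojourn.limitSojourn V w Y E) P' x)) ∧
        Tendsto
          (fun u : ℝ =>
            P.real {ω | x < Sojourn.theta α l u * Sojourn.sojournTime X b T u ω} /
              (T ^ k * Sojourn.theta α l u * P.real {ω | ∀ i, u * b i < X 0 ω i}))
          atTop (𝓝 (Sojourn.bermanConst (Sojourn.limitSojourn V w Y E) P' x))) := by
  obtain ⟨i₀, -⟩ := hb
  have hd : Nonempty (Fin d) := ⟨i₀⟩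
  have hw0 : w ≠ 0 := fun h => (hwpos i₀).ne' (congrFun h i₀)
  -- Of the positive definiteness in (B1) only the direction `w` enters.
  have hpos : ∀ τ, τ ≠ 0 → 0 < Sojourn.quadDefect (Sojourn.stationaryCov X P) w τ :=
    fun τ hτ => hB1 τ hτ w hw0
  refine ⟨?_, fun u _ => Sojourn.integral_sojournTime hX hstat hmeas b hT.le u,
    fun Ω' _ P' Y E hYE x hx => ⟨Sojourn.tendsto_atTop_of_pos_seq fun u hu0 hu => ?_,
      Sojourn.tendsto_atTop_of_pos_seq fun u hu0 hu => ?_⟩⟩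
  · obtain ⟨Y, E, hYE⟩ := hB2.exists_limitPair hX hstat
    exact ⟨_, _, _, Y, E, hYE⟩
  · exact Sojourn.tendsto_truncated hX hstat hmeas hSigma hw hwpos hB0 hpos hB2 hYE hk hd hT hu0 hu
      hx
  · exact Sojourn.tendsto_tail_sojournTime hX hstat hmeas hSigma hw hwpos hB0 hpos hB2 hYE hk hd hT
      hu0 hu hx
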